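/- **Setting.** Let $\kappa\in\mathbb R$ and $R>0$ with $R^2|\kappa|<1$, and let $M=\{z\in\mathbb C:|z|\le R\}$ carry the metric $g_\kappa=(1+\kappa|z|^2)^{-2}|dz|^2$ (constant curvature $4\kappa$), with area $dVol$. Parametrize $\partial_+SM$ by $(\beta,\alpha)\in\mathbb R/2\pi\mathbb Z\times(-\frac\pi2,\frac\pi2)$, standing for the boundary point $Re^{i\beta}$ with the inward unit vector $(1+\kappa R^2)e^{i(\beta+\pi+\alpha)}$, and put $d\Sigma^2=\frac{R}{1+\kappa R^2}\,d\beta\,d\alpha$. Let $I_0f(\beta,\alpha)=\int_0^{\tau}f(\gamma(t))\,dt$ be the geodesic X-ray transform, where $\gamma$ is the unit-speed geodesic issued from $(\beta,\alpha)$ and $\tau$ is its first exit time out of $M$. Put $$w(z)=\frac{1+\kappa|z|^2}{1-\kappa|z|^2},\quad c_{\kappa,R}=\frac{4\pi R}{1-\kappa R^2},\quad \Phi(z)=\frac{1-\kappa R^2}{1-\kappa|z|^2}\frac zR,\quad \mathfrak s(\alpha)=\arctan\Big(\frac{1-\kappa R^2}{1+\kappa R^2}\tan\alpha\Big),$$ so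 that $\Phi$ is a diffeomorphism of $M$ onto the closed unit disk. Let $\mathcal S_A(\beta,\alpha)=(\beta+\pi+2\mathfrak s(\alpha),-\alpha)$, and let $L^2_+$ be the space of those $u\in L^2(\partial_+SM,d\Sigma^2)$ with $u\circ\mathcal S_A=u$. All function spaces are complex. **The operators.** Let $\mathcal L_e=-\big((1-\rho^2)\partial_\rho^2+(\frac1\rho-3\rho)\partial_\rho+\frac1{\rho^2}\partial_\omega^2\big)+1$ in polar coordinates on the unit disk, and let $\mathcal L$ be the closure in $L^2(M,w\,dVol)$ of the operator $u\mapsto w\cdot\big(\mathcal L_e[(u/w)\circ\Phi^{-1}]\big)\circ\Phi$ on $C^\infty(M)$ (smoothness up to the boundary). Let $T=\sqrt{\mathfrak s'}\,\big(\partial_\beta-\frac1{\mathfrak s'}\partial_\alpha\big)\frac1{\sqrt{\mathfrak s'}}$, and let $-T^2$ denote the closure in $L^2_+$ of this differential operator on the space $C^\infty_{\alpha,-,+}(\partial_+SM)$ of the functions $u$ for which the function on $\partial SM$ that equals $u$ on $\partial_+SM$ and is odd under the scattering relation $(\beta,\alpha)\mapsto(\beta+\pi+2\mathfrak s(\alpha),\pi-\alpha)$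 is smooth and is odd in the fibers of $\partial SM$ ($\alpha\mapsto\alpha+\pi$). **Powers.** For a self-adjoint operator $A$ with positive eigenvalues and a dense span of eigenvectors, let $P_\mu$ be the orthogonal projection onto $\ker(A-\mu)$. For $s\in\mathbb R$ let $H^s_A$ be the space of formal expansions $\sum_\mu U_\mu$ with $U_\mu\in\ker(A-\mu)$ and $\sum_\mu\mu^s\|U_\mu\|^2<\infty$; a vector $u$ of the Hilbert space is identified with $\sum_\mu P_\mu u\in H^0_A$. For $p\in\mathbb R$ the power $A^p\colon\sum_\mu U_\mu\mapsto\sum_\mu\mu^pU_\mu$ maps $H^s_A$ to $H^{s-2p}_A$; as an unbounded operator on the Hilbert space $H^0_A$, it has the domain $H^0_A\cap H^{2p}_A$. **Theorem.** 1. $\mathcal L$ on $L^2(M,w\,dVol)$ and $-T^2$ on $L^2_+$ are self-adjoint, with positive eigenvalues and a dense span of eigenvectors. 2. $I_0$ is bounded from $L^2(M,w\,dVol)$ (which, as a set, is $L^2(M,dVol)$) to $L^2_+$. Let $I_0^*$ be its adjoint with respect to the inner products of $L^2(M,dVol)$ and $L^2(\partial_+SM,d\Sigma^2)$, extended to formal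 expansions of $-T^2$ term by term: the component of $I_0^*\sum_\mu U_\mu$ in $\ker(\mathcal L-\nu)$ is $\sum_\mu P_\nu I_0^*U_\mu$. 3. For every $\alpha\in\mathbb R$ and every $f\in L^2(M,w\,dVol)$, $$f=\frac{w}{c_{\kappa,R}}\;\mathcal L^{\frac12-\alpha}\circ I_0^*\circ(-T^2)^\alpha\circ I_0f .$$ Here $(-T^2)^\alpha I_0f\in H^{1/2-2\alpha}_{-T^2}$; the series that define $I_0^*(-T^2)^\alpha I_0f$ converge, and it lies in $H^{1-2\alpha}_{\mathcal L}$; and its image under $\mathcal L^{1/2-\alpha}$ lies in $L^2(M,w\,dVol)$. If $I_0f$ lies in the domain of the unbounded operator $(-T^2)^\alpha$ on $L^2_+$, which is the case for all $f$ when $\alpha\le\frac14$, then $I_0^*(-T^2)^\alpha I_0f$ lies in the domain of the unbounded operator $\mathcal L^{1/2-\alpha}$ on $L^2(M,w\,dVol)$ and the formula holds with all operators taken on these $L^2$ spaces. -/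

import Mathlib

open MeasureTheory Set

open scoped ENNReal ContDiff InnerProductSpace ComplexConjugate

namespace XrayDisk

noncomputable section

/-! ## Powers of a positive operator with pure point spectrum -/

section Spectral

variable {H : Type*} [NormedAddCommGroup H] [InnerProductSpace ℂ H] [CompleteSpace H]
variable {K : Type*} [NormedAddCommGroup K] [InnerProductSpace ℂ K] [CompleteSpace K]

/-- The eigenspace `{u ∈ D(A) : A u = μ u}` of an unbounded operator `A`. -/
def eigenspace (A : H →ₗ.[ℂ] H) (μ : ℝ) : Submodule ℂ H where
  carrier := {u | (u, (μ : ℂ) • u) ∈ A.graph}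
  zero_mem' := by
    have h := A.graph.zero_mem
    change ((0 : H), (μ : ℂ) • (0 : H)) ∈ A.graph
    rw [smul_zero]
    exact h
  add_mem' := by
    intro u v hu hv
    have h := A.graph.add_mem hu hv
    change (u + v, (μ : ℂ) • (u + v)) ∈ A.graph
    rw [smul_add]
    exact h
  smul_mem' := by
    intro c u hu
    have h := A.graph.smul_mem c hu
    change (c • u, (μ : ℂ) • (c • u)) ∈ A.graph
    rw [smul_comm (μ : ℂ) c u]
    exact h

/-- The orthogonal projection onto the eigenspace of `A` for `μ` (the eigenspaces of a closed
operator are closed, so that the closure taken here changes nothing for such an `A`). -/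
def eigenProj (A : H →ₗ.[ℂ] H) (μ : ℝ) : H →L[ℂ] H :=
  (eigenspace A μ).topologicalClosure.starProjection

/-- `A` is self-adjoint, all its eigenvalues are positive and its eigenvectors span a dense
subspace. For such an `A` the spectral theorem reads `F(A) = ∑_μ F(μ) P_μ`, where `P_μ` is the
orthogonal projection onto the eigenspace for `μ`. -/
structure IsPositivePurePoint (A : H →ₗ.[ℂ] H) : Prop where
  selfAdjoint : IsSelfAdjoint A
  pos : ∀ μ : ℝ, eigenspace A μ ≠ ⊥ → 0 < μ
  total : (⨆ μ : ℝ, eigenspace A μ).topologicalClosure = ⊤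

/-- The eigen-expansion `(P_μ u)_μ` of a vector. -/
def coeffs (A : H →ₗ.[ℂ] H) (u : H) : ℝ → H := fun μ => eigenProj A μ u

/-- The Hilbert scale of `A`: for every real `s`, the space of formal expansions `∑_μ U_μ` with
`U_μ` in the eigenspace for `μ` and `∑_μ μ ^ s ‖U_μ‖² < ∞`. -/
def HilbertScale (A : H →ₗ.[ℂ] H) (s : ℝ) : Set (ℝ → H) :=
  {U | (∀ μ, U μ ∈ eigenspace A μ) ∧ Summable fun μ : ℝ => μ ^ s * ‖U μ‖ ^ 2}

/-- The power `A ^ s`, acting on formal expansions `∑_μ U_μ` as multiplication of `U_μ` by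
`μ ^ s`; it maps the space of order `t` to the space of order `t - 2 s`. -/
def powExpansion (s : ℝ) (U : ℝ → H) : ℝ → H := fun μ => ((μ ^ s : ℝ) : ℂ) • U μ

/-- `u ∈ D(A ^ s)` and `A ^ s u = v`, for the unbounded operator `A ^ s` on the Hilbert space. -/
def IsPow (A : H →ₗ.[ℂ] H) (s : ℝ) (u v : H) : Prop :=
  coeffs A v = powExpansion s (coeffs A u)

/-- The extension of a bounded operator `B` to formal expansions: the `ν`-component of the image
`V` of `U = ∑_μ U_μ` is `∑_μ P_ν (B U_μ)`. -/
def IsImageOfExpansion (A' : K →ₗ.[ℂ] K) (B : H →L[ℂ] K) (U : ℝ → H) (V : ℝ → K) : Prop :=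
  ∀ ν : ℝ, HasSum (fun μ : ℝ => eigenProj A' ν (B (U μ))) (V ν)

/-- The closure of an operator given by its graph on a core. -/
def closureOfCore (G : Set (H × H)) : H →ₗ.[ℂ] H :=
  (Submodule.span ℂ G).topologicalClosure.toLinearPMap

end Spectral

/-! ## The disk `M = {|z| ≤ R}` with the metric `(1 + κ |z|²)⁻² |dz|²` -/

/-- The Riemannian area `dVol` of the disk. -/
def dVol (κ R : ℝ) : Measure ℂ :=
  (volume.restrict (Metric.closedBall (0 : ℂ) R)).withDensity
    fun z => ENNReal.ofReal (((1 + κ * ‖z‖ ^ 2) ^ 2)⁻¹)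

/-- The weight `w = (1 + κ |z|²) / (1 - κ |z|²)`. -/
def weight (κ : ℝ) (z : ℂ) : ℝ := (1 + κ * ‖z‖ ^ 2) / (1 - κ * ‖z‖ ^ 2)

/-- The measure `w dVol`. -/
def wdVol (κ R : ℝ) : Measure ℂ :=
  (dVol κ R).withDensity fun z => ENNReal.ofReal (weight κ z)

/-- `L²(M, w dVol)`. As `w` is bounded above and below by positive constants on `M`, it has the
same elements as `L²(M, dVol)`, and an equivalent norm. -/
abbrev L2M (κ R : ℝ) : Type := Lp ℂ 2 (wdVol κ R)

/-- The constant `4 π R / (1 - κ R²)`. -/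
def cConst (κ R : ℝ) : ℝ := 4 * Real.pi * R / (1 - κ * R ^ 2)

/-- The operator of the Euclidean unit disk, in polar coordinates `z = ρ e^{iφ}`:
`-((1 - ρ²) ∂_ρ² + (1/ρ - 3ρ) ∂_ρ + ρ⁻² ∂_φ²) + 1`. -/
def Leuclid (h : ℂ → ℂ) (z : ℂ) : ℂ :=
  let U : ℝ → ℝ → ℂ := fun r t => h (r * Complex.exp (t * Complex.I))
  let ρ : ℝ := ‖z‖
  let φ : ℝ := z.arg
  h z - (((1 - ρ ^ 2 : ℝ) : ℂ) * iteratedDeriv 2 (fun r => U r φ) ρ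
      + ((1 / ρ - 3 * ρ : ℝ) : ℂ) * deriv (fun r => U r φ) ρ
      + ((1 / ρ ^ 2 : ℝ) : ℂ) * iteratedDeriv 2 (fun t => U ρ t) φ)

/-- The diffeomorphism from the disk of radius `R` onto the unit disk. -/
def Phi (κ R : ℝ) (z : ℂ) : ℂ := (((1 - κ * R ^ 2) / (1 - κ * ‖z‖ ^ 2) / R : ℝ) : ℂ) * z

/-- The inverse of `Phi`, from the unit disk onto the disk of radius `R`. -/
def PhiInv (κ R : ℝ) (ζ : ℂ) : ℂ :=
  ((2 * R / ((1 - κ * R ^ 2)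
    + Real.sqrt ((1 - κ * R ^ 2) ^ 2 + 4 * (κ * R ^ 2) * ‖ζ‖ ^ 2)) : ℝ) : ℂ) * ζ

theorem PhiInv_Phi {κ R : ℝ} (hR : 0 < R) (hκ : R ^ 2 * |κ| < 1) {z : ℂ} (hz : ‖z‖ ≤ R) :
    PhiInv κ R (Phi κ R z) = z := by
  have hz2 : ‖z‖ ^ 2 ≤ R ^ 2 := pow_le_pow_left₀ (norm_nonneg z) hz 2
  have hb : |κ * ‖z‖ ^ 2| < 1 := by
    rw [abs_mul, abs_of_nonneg (sq_nonneg ‖z‖)]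
    nlinarith [abs_nonneg κ]
  have hb' : |κ * R ^ 2| < 1 := by
    rw [abs_mul, abs_of_nonneg (sq_nonneg R)]
    linarith
  obtain ⟨h1, h2⟩ := abs_lt.1 hb
  obtain ⟨_, h4⟩ := abs_lt.1 hb'
  have hd : 0 < 1 - κ * ‖z‖ ^ 2 := by linarith
  have hl : 0 < 1 - κ * R ^ 2 := by linarith
  have hn : ‖Phi κ R z‖ = (1 - κ * R ^ 2) / (1 - κ * ‖z‖ ^ 2) / R * ‖z‖ := by
    rw [Phi, norm_mul, Complex.norm_real, Real.norm_of_nonneg (by positivity)]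
  have hs : Real.sqrt ((1 - κ * R ^ 2) ^ 2 + 4 * (κ * R ^ 2) * ‖Phi κ R z‖ ^ 2)
      = (1 - κ * R ^ 2) * (1 + κ * ‖z‖ ^ 2) / (1 - κ * ‖z‖ ^ 2) := by
    rw [Real.sqrt_eq_iff_mul_self_eq_of_pos]
    · rw [hn]
      field_simp
      ring
    · have : 0 < 1 + κ * ‖z‖ ^ 2 := by linarith
      positivity
  rw [PhiInv, hs, Phi, ← mul_assoc, ← Complex.ofReal_mul]
  have : 2 * R / (1 - κ * R ^ 2 + (1 - κ * R ^ 2) * (1 + κ * ‖z‖ ^ 2) / (1 - κ * ‖z‖ ^ 2)) *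
      ((1 - κ * R ^ 2) / (1 - κ * ‖z‖ ^ 2) / R) = 1 := by
    have e : 1 - κ * R ^ 2 + (1 - κ * R ^ 2) * (1 + κ * ‖z‖ ^ 2) / (1 - κ * ‖z‖ ^ 2)
        = 2 * (1 - κ * R ^ 2) / (1 - κ * ‖z‖ ^ 2) := by
      field_simp
      ring
    rw [e]
    have hl' := hl.ne'
    have hd' := hd.ne'
    have hR' := hR.ne'
    generalize 1 - κ * R ^ 2 = a at hl' ⊢
    generalize 1 - κ * ‖z‖ ^ 2 = b at hd' ⊢
    field_simp
  rw [this]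
  simp

/-- The second-order differential operator `u ↦ w · (Leuclid ((u / w) ∘ Φ⁻¹)) ∘ Φ`. -/
def Lfun (κ R : ℝ) (u : ℂ → ℂ) (z : ℂ) : ℂ :=
  (weight κ z : ℂ) *
    Leuclid (fun ζ => u (PhiInv κ R ζ) / (weight κ (PhiInv κ R ζ) : ℂ)) (Phi κ R z)

/-- The self-adjoint operator `𝓛` on `L²(M, w dVol)`: the closure of the differential operator
on `C^∞(M)`, the functions that are smooth up to the boundary. -/
def opL (κ R : ℝ) : L2M κ R →ₗ.[ℂ] L2M κ R :=
  closureOfCore {p | ∃ u : ℂ → ℂ, ContDiffOn ℝ ∞ u (Metric.closedBall 0 R) ∧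
    p.1 =ᵐ[wdVol κ R] u ∧ p.2 =ᵐ[wdVol κ R] Lfun κ R u}

/-! ## The inward boundary `∂₊SM` in fan-beam coordinates

The pair `(β, α)`, with `β` in the circle and `α ∈ (-π/2, π/2)`, stands for the boundary point
`R e^{iβ}` with the inward unit vector `(1 + κ R²) e^{i(β + π + α)}`. -/

/-- The circle `ℝ / 2πℤ`. -/
abbrev S1 : Type := AddCircle (2 * Real.pi)

instance fact_two_pi_pos : Fact (0 < 2 * Real.pi) := ⟨Real.two_pi_pos⟩

/-- The area form `dΣ² = R (1 + κ R²)⁻¹ dβ dα` on `∂₊SM`. -/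
def dSigma (κ R : ℝ) : Measure (S1 × ℝ) :=
  ENNReal.ofReal (R / (1 + κ * R ^ 2)) •
    ((volume : Measure S1).prod (volume.restrict (Ioo (-(Real.pi / 2)) (Real.pi / 2))))

/-- The function `𝔰(α) = arctan ((1 - κ R²) / (1 + κ R²) tan α)`, for `|α| < π/2`. -/
def scat (κ R : ℝ) (a : ℝ) : ℝ :=
  Real.arctan ((1 - κ * R ^ 2) / (1 + κ * R ^ 2) * Real.tan a)

/-- The antipodal scattering relation `(β, α) ↦ (β + π + 2 𝔰(α), -α)`: the same geodesic,
travelled backwards. -/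
def SA (κ R : ℝ) (p : S1 × ℝ) : S1 × ℝ :=
  (p.1 + ((Real.pi + 2 * scat κ R p.2 : ℝ) : S1), -p.2)

theorem measurable_scat (κ R : ℝ) : Measurable (scat κ R) := by
  have htan : Measurable Real.tan := by
    have h : Real.tan = fun x => Real.sin x / Real.cos x := by
      funext x; exact Real.tan_eq_sin_div_cos x
    rw [h]
    exact Real.measurable_sin.div Real.measurable_cos
  exact Real.measurable_arctan.comp (htan.const_mul _)

theorem measurePreserving_SA (κ R : ℝ) :
    MeasurePreserving (SA κ R) (dSigma κ R) (dSigma κ R) := by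
  set I : Set ℝ := Ioo (-(Real.pi / 2)) (Real.pi / 2) with hI
  set μ : Measure ℝ := volume.restrict I with hμ
  set ν : Measure S1 := volume with hν
  have hneg : MeasurePreserving (fun a : ℝ => -a) μ μ := by
    have h := (Measure.measurePreserving_neg (volume : Measure ℝ)).restrict_preimage
      (s := I) measurableSet_Ioo
    have hpre : Neg.neg ⁻¹' I = I := by
      ext x
      simp only [hI, mem_preimage, mem_Ioo]
      constructor <;> rintro ⟨h1, h2⟩ <;> constructor <;> linarith
    rw [hpre] at h
    exact h
  have hshift : Measurable fun a : ℝ => ((Real.pi + 2 * scat κ R a : ℝ) : S1) :=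
    AddCircle.measurable_mk'.comp (((measurable_scat κ R).const_mul 2).const_add _)
  have hskew : MeasurePreserving
      (fun p : ℝ × S1 => (-p.1, p.2 + ((Real.pi + 2 * scat κ R p.1 : ℝ) : S1)))
      (μ.prod ν) (μ.prod ν) := by
    refine hneg.skew_product
      (g := fun (a : ℝ) (b : S1) => b + ((Real.pi + 2 * scat κ R a : ℝ) : S1)) ?_ ?_
    · exact measurable_snd.add (hshift.comp measurable_fst)
    · exact Filter.Eventually.of_forall fun a =>
        (measurePreserving_add_right ν ((Real.pi + 2 * scat κ R a : ℝ) : S1)).map_eq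
  have hswap1 : MeasurePreserving (Prod.swap : S1 × ℝ → ℝ × S1) (ν.prod μ) (μ.prod ν) :=
    Measure.measurePreserving_swap
  have hswap2 : MeasurePreserving (Prod.swap : ℝ × S1 → S1 × ℝ) (μ.prod ν) (ν.prod μ) :=
    Measure.measurePreserving_swap
  have h : MeasurePreserving (SA κ R) (ν.prod μ) (ν.prod μ) :=
    (hswap2.comp (hskew.comp hswap1))
  exact h.smul_measure _

/-- `L²₊(∂₊SM, dΣ²)`: the square-integrable functions that are invariant under the antipodal
scattering relation. -/
def L2plus (κ R : ℝ) : Submodule ℂ (Lp ℂ 2 (dSigma κ R)) where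
  carrier := {u | (fun p => u (SA κ R p)) =ᵐ[dSigma κ R] u}
  zero_mem' := by
    have h0 := Lp.coeFn_zero ℂ 2 (dSigma κ R)
    have h1 := (measurePreserving_SA κ R).quasiMeasurePreserving.ae h0
    filter_upwards [h0, h1] with p h0 h1
    rw [h0, h1]
    rfl
  add_mem' := by
    intro u v hu hv
    change (fun p => (u + v : Lp ℂ 2 (dSigma κ R)) (SA κ R p)) =ᵐ[dSigma κ R] (u + v : Lp ℂ 2 (dSigma κ R))
    have h0 := Lp.coeFn_add u v
    have h1 := (measurePreserving_SA κ R).quasiMeasurePreserving.ae h0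
    filter_upwards [h0, h1, hu, hv] with p h0 h1 hu hv
    rw [h0, h1, Pi.add_apply, Pi.add_apply, hu, hv]
  smul_mem' := by
    intro c u hu
    change (fun p => (c • u : Lp ℂ 2 (dSigma κ R)) (SA κ R p)) =ᵐ[dSigma κ R] (c • u : Lp ℂ 2 (dSigma κ R))
    have h0 := Lp.coeFn_smul c u
    have h1 := (measurePreserving_SA κ R).quasiMeasurePreserving.ae h0
    filter_upwards [h0, h1, hu] with p h0 h1 hu
    rw [h0, h1, Pi.smul_apply, Pi.smul_apply, hu]

theorem isClosed_L2plus (κ R : ℝ) : IsClosed (L2plus κ R : Set (Lp ℂ 2 (dSigma κ R))) := by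
  have hcont : Continuous
      (Lp.compMeasurePreserving (E := ℂ) (p := 2) (SA κ R) (measurePreserving_SA κ R)) :=
    (Lp.isometry_compMeasurePreserving (measurePreserving_SA κ R)).continuous
  have hset : (L2plus κ R : Set (Lp ℂ 2 (dSigma κ R))) =
      {u | Lp.compMeasurePreserving (SA κ R) (measurePreserving_SA κ R) u = u} := by
    ext u
    have h := Lp.coeFn_compMeasurePreserving u (measurePreserving_SA κ R)
    constructor
    · intro hu
      exact Lp.ext (h.trans hu)
    · intro hu
      have hu' : Lp.compMeasurePreserving (SA κ R) (measurePreserving_SA κ R) u = u := hu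
      rw [hu'] at h
      exact h.symm
  rw [hset]
  exact isClosed_eq hcont continuous_id

instance completeSpace_L2plus (κ R : ℝ) : CompleteSpace (L2plus κ R) :=
  (isClosed_L2plus κ R).completeSpace_coe

/-- The vector field with weights
`T = √𝔰' (∂_β - (1 / 𝔰') ∂_α) (1 / √𝔰')`. -/
def Tfun (κ R : ℝ) (v : S1 × ℝ → ℂ) (p : S1 × ℝ) : ℂ :=
  let s' : ℝ → ℝ := deriv (scat κ R)
  (Real.sqrt (s' p.2) : ℂ) *
    (deriv (fun t : ℝ => v (p.1 + (t : S1), p.2) / (Real.sqrt (s' p.2) : ℂ)) 0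
      - (1 / s' p.2 : ℂ) * deriv (fun a : ℝ => v (p.1, a) / (Real.sqrt (s' a) : ℂ)) p.2)

/-- The space `C^∞_{α,-,+}(∂₊SM)`, through the odd extensions `v = A₋ u` of its elements `u` with
respect to the scattering relation: `v` is smooth on the whole boundary `∂SM` (both coordinates
run through the circle), is odd in the fibers, and its restriction `u` to `|α| < π/2` is invariant
under the antipodal scattering relation (for a fiberwise odd `v` this says that `v` changes sign
under the scattering relation `(β, α) ↦ (β + π + 2 𝔰(α), π - α)`). -/
structure IsSmoothPlus (κ R : ℝ) (v : S1 × ℝ → ℂ) : Prop where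
  smooth : ContDiff ℝ ∞ fun q : ℝ × ℝ => v ((q.1 : S1), q.2)
  odd : ∀ (b : S1) (a : ℝ), v (b, a + Real.pi) = -v (b, a)
  invariant : ∀ (b : S1) (a : ℝ), |a| < Real.pi / 2 → v (SA κ R (b, a)) = v (b, a)

/-- The self-adjoint operator `-T²` on `L²₊(∂₊SM, dΣ²)`: the closure of the differential operator
on `C^∞_{α,-,+}(∂₊SM)`. -/
def opNegTsq (κ R : ℝ) : L2plus κ R →ₗ.[ℂ] L2plus κ R :=
  closureOfCore {p | ∃ v : S1 × ℝ → ℂ, IsSmoothPlus κ R v ∧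
    (p.1 : Lp ℂ 2 (dSigma κ R)) =ᵐ[dSigma κ R] v ∧
    (p.2 : Lp ℂ 2 (dSigma κ R)) =ᵐ[dSigma κ R] fun q => -Tfun κ R (Tfun κ R v) q}

/-! ## The geodesic X-ray transform -/

/-- `γ : [0, τ] → M`, with velocity `γ'`, is the geodesic of the metric `(1 + κ |z|²)⁻² |dz|²`
with initial condition `(x, v)`, followed until its first exit time `τ` out of `M`. The geodesic
equation of this conformally Euclidean metric is `γ'' = 2 κ conj(γ) (γ')² / (1 + κ |γ|²)`. -/
structure IsGeodesicChord (κ R : ℝ) (x v : ℂ) (τ : ℝ) (γ γ' : ℝ → ℂ) : Prop where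
  pos : 0 < τ
  init : γ 0 = x
  init_vel : γ' 0 = v
  vel : ∀ t ∈ Icc 0 τ, HasDerivWithinAt γ (γ' t) (Icc 0 τ) t
  geodesic : ∀ t ∈ Icc 0 τ, HasDerivWithinAt γ'
    (2 * κ * conj (γ t) * γ' t ^ 2 / (1 + κ * (‖γ t‖ : ℂ) ^ 2)) (Icc 0 τ) t
  inside : ∀ t ∈ Ioo 0 τ, ‖γ t‖ < R
  exit : ‖γ τ‖ = R

/-- The boundary point `R e^{iβ}`. -/
def basePoint (R : ℝ) (p : S1 × ℝ) : ℂ := R * (AddCircle.toCircle p.1 : ℂ)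

/-- The inward unit vector `(1 + κ R²) e^{i(β + π + α)}`. -/
def inwardVec (κ R : ℝ) (p : S1 × ℝ) : ℂ :=
  ((1 + κ * R ^ 2 : ℝ) : ℂ) *
    ((AddCircle.toCircle p.1 : ℂ) * Complex.exp (((Real.pi + p.2 : ℝ) : ℂ) * Complex.I))

/-- `y = ∫₀^τ f(γ(t)) dt` along the geodesic issued from the point `p` of `∂₊SM`, the integral
being absolutely convergent. -/
def HasXray (κ R : ℝ) (f : ℂ → ℂ) (p : S1 × ℝ) (y : ℂ) : Prop :=
  ∃ (τ : ℝ) (γ γ' : ℝ → ℂ),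
    IsGeodesicChord κ R (basePoint R p) (inwardVec κ R p) τ γ γ' ∧
    IntervalIntegrable (fun t => f (γ t)) volume 0 τ ∧
    y = ∫ t in (0 : ℝ)..τ, f (γ t)

/-- The bounded operator `I₀ : L²(M) → L²₊(∂₊SM, dΣ²)` is the geodesic X-ray transform. -/
def IsXrayTransform (κ R : ℝ) (I₀ : L2M κ R →L[ℂ] L2plus κ R) : Prop :=
  ∀ f : L2M κ R, ∀ᵐ p ∂(dSigma κ R), HasXray κ R f p ((I₀ f : Lp ℂ 2 (dSigma κ R)) p)

/-- `B` is the adjoint of `I₀` for the inner products of `L²(M, dVol)` (without the weight) and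
of `L²(∂₊SM, dΣ²)`. -/
def IsXrayAdjoint (κ R : ℝ) (I₀ : L2M κ R →L[ℂ] L2plus κ R)
    (B : L2plus κ R →L[ℂ] L2M κ R) : Prop :=
  ∀ (f : L2M κ R) (g : L2plus κ R), ∫ z, conj (f z) * B g z ∂(dVol κ R) = ⟪I₀ f, g⟫_ℂ

end

end XrayDisk

/-! Write f = w u and let J u = I₀(w u). The weight in the inner product of L²(M, w dVol) cancels
the weight in J, so the adjoint J† for w dVol is exactly the adjoint I₀* for dVol
(`integral_conj_mul_dVol`). The inversion formula becomes c u = 𝓛^(1/2-α) J† (-T²)^α J u. It follows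
from a simultaneous diagonalization: a total family of vectors x with 𝓛 x = l x, -T² J x = l J x and
J†J x = c l^(-1/2) x, for then the powers of l multiply to 1 on each eigenspace (`power_formula`).

The family consists of the ridge functions w · U_n(Re(Φ e^{-iθ})), with U_n the Chebyshev
polynomials of the second kind, n ≥ 0, θ real, and l = (n+1)². It is neither orthogonal nor linearly
independent; only its totality is used, so no orthonormal basis is ever chosen. That 𝓛 acts on it by
(n+1)² is Chebyshev's differential equation (`Leuclid_ridge`). Green's formula (`DiskJet.green`)
needs no boundary condition, because the radial coefficient r(1-r²) vanishes at both ends. Totality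
holds because the three-term recurrence turns orthogonality to all ridges into the vanishing of all
moments along Φ (`ae_eq_zero_of_moments`).

On the boundary, T acts on √𝔰' k as √𝔰' (∂_β - (1/𝔰')∂_α) k, and the products e^{iaβ} E^b, where E
extends e^{i𝔰(α)}, diagonalize this field with eigenvalues i(a-b). Oddness in the fibers allows only
odd b and removes the boundary terms at α = ±π/2 (`integral_flowDeriv`). The scattering relation
reflects b about a, and the invariant combinations of b = a+m and b = a-m are eigenvectors of -T²
for m². In both cases self-adjointness and pure point spectrum come from
`isPositivePurePoint_closureOfCore`: the core contains a total family of eigenvectors and is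
symmetric against it.

The geometric link is that Φ carries geodesics to straight chords of the unit disk, with arc length
element a constant multiple of w⁻² dy on each chord (`hasXray_of_integrableOn`). Hence J of a ridge
function is the integral of a Chebyshev ridge along a chord, a product of a sine and a Chebyshev
polynomial (`integral_chebyshev_chord`), and expanding both in exponentials gives n+1 boundary modes
with m = n+1 (`xray_weight_mul_ridgeM`). The inner products of two ridges of degree n, and of their
transforms, are both multiples of U_n(cos(θ-θ')); the ratio of the constants is c/(n+1)
(`inner_xray_ridgeLp`). Boundedness of I₀ is Cauchy–Schwarz on each chord together with Santaló's
formula (`lintegral_santalo`). -/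

namespace XrayDisk
-- Abstract part: operators diagonal on a total family, and their powers.
section AbstractSpectral

variable {H : Type*} [NormedAddCommGroup H] [InnerProductSpace ℂ H] [CompleteSpace H]
variable {K : Type*} [NormedAddCommGroup K] [InnerProductSpace ℂ K] [CompleteSpace K]

/-- The graph of the operator that is diagonal, with eigenvalues `l`, with respect to `x`. -/
def diagGraph {ι : Type*} (x : ι → H) (l : ι → ℝ) : Submodule ℂ (H × H) where
  carrier := {p | ∀ a, ⟪x a, p.2⟫_ℂ = (l a : ℂ) * ⟪x a, p.1⟫_ℂ}
  zero_mem' := by intro a; simp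
  add_mem' := by
    intro p q hp hq a
    simp only [Prod.snd_add, Prod.fst_add, inner_add_right, hp a, hq a]
    ring
  smul_mem' := by
    intro c p hp a
    simp only [Prod.smul_snd, Prod.smul_fst, inner_smul_right, hp a]
    ring

omit [CompleteSpace H] in
theorem isClosed_diagGraph {ι : Type*} (x : ι → H) (l : ι → ℝ) :
    IsClosed (diagGraph x l : Set (H × H)) := by
  have : (diagGraph x l : Set (H × H)) =
      ⋂ a, {p : H × H | ⟪x a, p.2⟫_ℂ = (l a : ℂ) * ⟪x a, p.1⟫_ℂ} := by
    ext p
    simp [diagGraph]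
  rw [this]
  exact isClosed_iInter fun a => isClosed_eq (by fun_prop) (by fun_prop)

theorem eq_zero_of_forall_inner_eq_zero {ι : Type*} {x : ι → H}
    (htot : (Submodule.span ℂ (range x)).topologicalClosure = ⊤) {u : H}
    (hu : ∀ a, ⟪x a, u⟫_ℂ = 0) : u = 0 := by
  have h : u ∈ (Submodule.span ℂ (range x))ᗮ := by
    rw [Submodule.mem_orthogonal]
    intro v hv
    induction hv using Submodule.span_induction with
    | mem v hv => obtain ⟨a, rfl⟩ := hv; exact hu a
    | zero => simp
    | add v w _ _ hv hw => rw [inner_add_left, hv, hw, add_zero]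
    | smul c v _ hv => rw [inner_smul_left, hv, mul_zero]
  rw [Submodule.topologicalClosure_eq_top_iff] at htot
  rw [htot] at h
  simpa using h

theorem total_of_forall_inner_eq_zero {ι : Type*} {x : ι → H}
    (h : ∀ u : H, (∀ a, ⟪x a, u⟫_ℂ = 0) → u = 0) :
    (Submodule.span ℂ (range x)).topologicalClosure = ⊤ := by
  rw [Submodule.topologicalClosure_eq_top_iff, Submodule.eq_bot_iff]
  intro u hu
  refine h u fun a => ?_
  exact (Submodule.mem_orthogonal _ _).1 hu _ (Submodule.subset_span ⟨a, rfl⟩)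

omit [CompleteSpace H] [CompleteSpace K] in
/-- Continuous linear maps that agree on a total family are equal. -/
theorem clm_eq_of_total {ι : Type*} {x : ι → H}
    (htot : (Submodule.span ℂ (range x)).topologicalClosure = ⊤) {f g : H →L[ℂ] K}
    (h : ∀ a, f (x a) = g (x a)) : f = g := by
  refine ContinuousLinearMap.ext_on (s := range x) ?_ ?_
  · exact Submodule.dense_iff_topologicalClosure_eq_top.2 htot
  · rintro _ ⟨a, rfl⟩
    exact h a

/-- A pair in the diagonal graph that is orthogonal to every (x a, l a • x a) has a first component
r with (1 + (l a)²)⟪x a, r⟫ = 0 for all a, so r = 0 by totality, and then the second component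
vanishes too. The family need not be orthogonal. -/
theorem diagGraph_eq_topologicalClosure {ι : Type*} {x : ι → H} {l : ι → ℝ}
    (htot : (Submodule.span ℂ (range x)).topologicalClosure = ⊤) {G : Set (H × H)}
    (hG : ∀ a, (x a, (l a : ℂ) • x a) ∈ G) (hsym : G ⊆ diagGraph x l) :
    (Submodule.span ℂ G).topologicalClosure = diagGraph x l := by
  apply le_antisymm
  · exact Submodule.topologicalClosure_minimal _ (Submodule.span_le.2 hsym) (isClosed_diagGraph x l)
  intro p hp
  -- The norm of `H × H` is a maximum; the orthogonal projection is taken in the Hilbert space with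
  -- the same topology.
  let e := WithLp.prodContinuousLinearEquiv 2 ℂ H H
  let S : Submodule ℂ (WithLp 2 (H × H)) :=
    (Submodule.span ℂ G).topologicalClosure.comap (e : WithLp 2 (H × H) →ₗ[ℂ] H × H)
  have hScl : IsClosed (S : Set (WithLp 2 (H × H))) :=
    (Submodule.isClosed_topologicalClosure _).preimage e.continuous
  have : CompleteSpace S := hScl.completeSpace_coe
  set q : WithLp 2 (H × H) := e.symm p with hq
  set r := q - S.starProjection q with hr
  have hrS : r ∈ Sᗮ := Submodule.sub_starProjection_mem_orthogonal q
  have hmem : e (S.starProjection q) ∈ (Submodule.span ℂ G).topologicalClosure :=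
    S.starProjection_apply_mem q
  have hle : (Submodule.span ℂ G).topologicalClosure ≤ diagGraph x l :=
    Submodule.topologicalClosure_minimal _ (Submodule.span_le.2 hsym) (isClosed_diagGraph x l)
  have hrD : e r ∈ diagGraph x l := by
    rw [hr, map_sub]
    refine Submodule.sub_mem _ ?_ (hle hmem)
    rw [hq, ContinuousLinearEquiv.apply_symm_apply]
    exact hp
  have hfst : (e r).1 = 0 := by
    refine eq_zero_of_forall_inner_eq_zero htot fun a => ?_
    have h1 := (Submodule.mem_orthogonal _ _).1 hrS (e.symm (x a, (l a : ℂ) • x a)) (by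
      change e (e.symm (x a, (l a : ℂ) • x a)) ∈ (Submodule.span ℂ G).topologicalClosure
      rw [ContinuousLinearEquiv.apply_symm_apply]
      exact Submodule.le_topologicalClosure _ (Submodule.subset_span (hG a)))
    have h1' : ⟪x a, (e r).1⟫_ℂ + ⟪(l a : ℂ) • x a, (e r).2⟫_ℂ = 0 := by
      rw [← h1, WithLp.prod_inner_apply]
      rfl
    rw [inner_smul_left, hrD a, Complex.conj_ofReal] at h1'
    have h2 : ((1 + l a ^ 2 : ℝ) : ℂ) * ⟪x a, (e r).1⟫_ℂ = 0 := by
      rw [← h1']; push_cast; ring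
    rcases mul_eq_zero.1 h2 with h3 | h3
    · have : 1 + l a ^ 2 = 0 := by exact_mod_cast h3
      nlinarith [sq_nonneg (l a)]
    · exact h3
  have hsnd : (e r).2 = 0 := by
    refine eq_zero_of_forall_inner_eq_zero htot fun a => ?_
    rw [hrD a, hfst, inner_zero_right, mul_zero]
  have hr0 : e r = 0 := Prod.ext hfst hsnd
  have hpe : p = e (S.starProjection q) := by
    have : e q = e r + e (S.starProjection q) := by rw [← map_add, hr, sub_add_cancel]
    rw [hr0, zero_add, hq, ContinuousLinearEquiv.apply_symm_apply] at this
    exact this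
  rw [hpe]
  exact hmem

/-- Totality makes the diagonal relation single valued, so the passage from the closed subspace to
an operator loses nothing: the core is closable, and the graph of its closure is known explicitly.
-/
theorem closureOfCore_graph {ι : Type*} {x : ι → H} {l : ι → ℝ}
    (htot : (Submodule.span ℂ (range x)).topologicalClosure = ⊤) {G : Set (H × H)}
    (hG : ∀ a, (x a, (l a : ℂ) • x a) ∈ G) (hsym : G ⊆ diagGraph x l) :
    (closureOfCore G).graph = diagGraph x l := by
  rw [closureOfCore, diagGraph_eq_topologicalClosure htot hG hsym]
  refine Submodule.toLinearPMap_graph_eq _ fun p hp hp1 => ?_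
  refine eq_zero_of_forall_inner_eq_zero htot fun a => ?_
  rw [hp a, hp1, inner_zero_right, mul_zero]

omit [CompleteSpace H] in
theorem mem_eigenspace {A : H →ₗ.[ℂ] H} {μ : ℝ} {u : H} :
    u ∈ eigenspace A μ ↔ (u, (μ : ℂ) • u) ∈ A.graph := Iff.rfl

/-- A symmetric core that contains a total family of eigenvectors with positive eigenvalues
generates a self-adjoint operator with pure point spectrum. -/
theorem isPositivePurePoint_closureOfCore {ι : Type*} {x : ι → H} {l : ι → ℝ}
    (htot : (Submodule.span ℂ (range x)).topologicalClosure = ⊤) {G : Set (H × H)}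
    (hG : ∀ a, (x a, (l a : ℂ) • x a) ∈ G) (hsym : G ⊆ diagGraph x l) (hpos : ∀ a, 0 < l a) :
    IsPositivePurePoint (closureOfCore G) := by
  have hgr := closureOfCore_graph htot hG hsym
  have hx : ∀ a, x a ∈ eigenspace (closureOfCore G) (l a) := fun a => by
    rw [mem_eigenspace, hgr]; exact hsym (hG a)
  refine ⟨?_, ?_, ?_⟩
  · have hdense : Dense ((closureOfCore G).domain : Set H) := by
      refine (Submodule.dense_iff_topologicalClosure_eq_top.2 htot).mono ?_
      refine SetLike.coe_subset_coe.2 (Submodule.span_le.2 ?_)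
      rintro _ ⟨a, rfl⟩
      obtain ⟨y, hy, -⟩ := (LinearPMap.mem_graph_iff _).1 (hx a)
      change (y : H) = x a at hy
      exact hy ▸ y.2
    rw [LinearPMap.isSelfAdjoint_def]
    apply LinearPMap.eq_of_eq_graph
    rw [LinearPMap.adjoint_graph_eq_graph_adjoint hdense]
    ext p
    rw [Submodule.mem_adjoint_iff]
    constructor
    · intro hp
      rw [hgr]
      intro a
      have := hp _ _ (hx a)
      rw [inner_smul_left, Complex.conj_ofReal, sub_eq_zero] at this
      exact this.symm
    · intro hp a b hab
      -- The eigenpairs alone span a dense subspace of the graph, and the adjoint relation is a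
      -- closed condition stable under linear combinations, so it has to be checked on eigenpairs
      -- only.
      rw [hgr, ← diagGraph_eq_topologicalClosure htot
        (G := range fun a => (x a, (l a : ℂ) • x a)) (fun a => ⟨a, rfl⟩)
        (by rintro _ ⟨a, rfl⟩; exact hsym (hG a))] at hab
      rw [hgr] at hp
      have hcl : IsClosed {q : H × H | ⟪q.2, p.1⟫_ℂ - ⟪q.1, p.2⟫_ℂ = 0} :=
        isClosed_eq (by fun_prop) (by fun_prop)
      refine closure_minimal (s := ↑(Submodule.span ℂ (range fun a => (x a, (l a : ℂ) • x a))))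
        ?_ hcl hab
      intro q hq
      induction hq using Submodule.span_induction with
      | mem q hq =>
        obtain ⟨a, rfl⟩ := hq
        simp only [mem_ofPred_eq]
        rw [inner_smul_left, hp a, Complex.conj_ofReal, sub_self]
      | zero => simp
      | add v w _ _ hv hw =>
        simp only [mem_ofPred_eq, Prod.snd_add, Prod.fst_add, inner_add_left] at *
        linear_combination hv + hw
      | smul c v _ hv =>
        simp only [mem_ofPred_eq, Prod.smul_snd, Prod.smul_fst, inner_smul_left] at *
        linear_combination (starRingEnd ℂ) c * hv
  · intro μ hμ
    obtain ⟨u, hu, hu0⟩ := (Submodule.ne_bot_iff _).1 hμ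
    -- A number μ that is not positive differs from every l a, so an eigenvector for μ would be
    -- orthogonal to the whole family.
    by_contra hneg
    refine hu0 (eq_zero_of_forall_inner_eq_zero htot fun a => ?_)
    rw [mem_eigenspace, hgr] at hu
    have h1 := hu a
    rw [inner_smul_right] at h1
    have h2 : ((μ - l a : ℝ) : ℂ) * ⟪x a, u⟫_ℂ = 0 := by push_cast; linear_combination h1
    rcases mul_eq_zero.1 h2 with h3 | h3
    · have : μ - l a = 0 := by exact_mod_cast h3
      linarith [hpos a]
    · exact h3
  · rw [eq_top_iff, ← htot]
    refine Submodule.topologicalClosure_mono (Submodule.span_le.2 ?_)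
    rintro _ ⟨a, rfl⟩
    exact Submodule.mem_iSup_of_mem (l a) (hx a)

namespace IsPositivePurePoint

variable {A : H →ₗ.[ℂ] H} {A' : K →ₗ.[ℂ] K}

theorem isClosed_eigenspace (hA : IsPositivePurePoint A) (μ : ℝ) :
    IsClosed (eigenspace A μ : Set H) := by
  have : (eigenspace A μ : Set H) = (fun u => (u, (μ : ℂ) • u)) ⁻¹' (A.graph : Set (H × H)) := rfl
  rw [this]
  exact IsClosed.preimage (by fun_prop) hA.selfAdjoint.isClosed

theorem eigenProj_mem (hA : IsPositivePurePoint A) (μ : ℝ) (u : H) :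
    eigenProj A μ u ∈ eigenspace A μ := by
  have := Submodule.starProjection_apply_mem (eigenspace A μ).topologicalClosure u
  exact (hA.isClosed_eigenspace μ).submodule_topologicalClosure_eq.le this

theorem inner_eq_zero (hA : IsPositivePurePoint A) {μ ν : ℝ} (hne : μ ≠ ν) {u v : H}
    (hu : u ∈ eigenspace A μ) (hv : v ∈ eigenspace A ν) : ⟪u, v⟫_ℂ = 0 := by
  have hv' := hv
  rw [mem_eigenspace, ← LinearPMap.isSelfAdjoint_def.1 hA.selfAdjoint,
    LinearPMap.adjoint_graph_eq_graph_adjoint hA.selfAdjoint.dense_domain,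
    Submodule.mem_adjoint_iff] at hv'
  have h := hv' _ _ hu
  rw [inner_smul_left, inner_smul_right, Complex.conj_ofReal, ← sub_mul] at h
  rcases mul_eq_zero.1 h with h | h
  · exact absurd (by exact_mod_cast sub_eq_zero.1 h) hne
  · exact h

theorem eigenProj_of_mem {μ : ℝ} {u : H} (hu : u ∈ eigenspace A μ) : eigenProj A μ u = u :=
  Submodule.starProjection_eq_self_iff.2 (Submodule.le_topologicalClosure _ hu)

theorem eigenProj_of_mem_of_ne (hA : IsPositivePurePoint A) {μ ν : ℝ} (hne : μ ≠ ν) {u : H}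
    (hu : u ∈ eigenspace A μ) : eigenProj A ν u = 0 := by
  refine (Submodule.starProjection_apply_eq_zero_iff _).2 ((Submodule.mem_orthogonal _ _).2 ?_)
  intro v hv
  rw [(hA.isClosed_eigenspace ν).submodule_topologicalClosure_eq] at hv
  exact hA.inner_eq_zero hne.symm hv hu

theorem eigenProj_symm (A : H →ₗ.[ℂ] H) (μ : ℝ) (u v : H) :
    ⟪eigenProj A μ u, v⟫_ℂ = ⟪u, eigenProj A μ v⟫_ℂ :=
  Submodule.inner_starProjection_left_eq_right _ u v

theorem norm_sq_eigenProj (hA : IsPositivePurePoint A) (μ : ℝ) (u : H) :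
    ⟪eigenProj A μ u, u⟫_ℂ = ((‖eigenProj A μ u‖ ^ 2 : ℝ) : ℂ) := by
  conv_lhs => rw [← eigenProj_of_mem (hA.eigenProj_mem μ u), eigenProj_symm]
  rw [inner_self_eq_norm_sq_to_K]
  simp

/-- Bessel's inequality: the sum S of the projections satisfies ⟪S, u⟫ = ‖S‖² by orthogonality of
the eigenspaces, and Cauchy–Schwarz gives ‖S‖² ≤ ‖S‖ ‖u‖. -/
theorem sum_norm_sq_eigenProj_le (hA : IsPositivePurePoint A) (s : Finset ℝ) (u : H) :
    ∑ μ ∈ s, ‖eigenProj A μ u‖ ^ 2 ≤ ‖u‖ ^ 2 := by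
  have h2 : ⟪∑ μ ∈ s, eigenProj A μ u, u⟫_ℂ
      = ((∑ μ ∈ s, ‖eigenProj A μ u‖ ^ 2 : ℝ) : ℂ) := by
    rw [sum_inner]
    simp only [hA.norm_sq_eigenProj]
    push_cast
    rfl
  have h1 : ‖∑ μ ∈ s, eigenProj A μ u‖ ^ 2 = ∑ μ ∈ s, ‖eigenProj A μ u‖ ^ 2 := by
    have : ((‖∑ μ ∈ s, eigenProj A μ u‖ ^ 2 : ℝ) : ℂ)
        = ((∑ μ ∈ s, ‖eigenProj A μ u‖ ^ 2 : ℝ) : ℂ) := by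
      have h3 := inner_self_eq_norm_sq_to_K (𝕜 := ℂ) (∑ μ ∈ s, eigenProj A μ u)
      have h4 : ((‖∑ μ ∈ s, eigenProj A μ u‖ ^ 2 : ℝ) : ℂ)
        = ⟪∑ μ ∈ s, eigenProj A μ u, ∑ μ ∈ s, eigenProj A μ u⟫_ℂ := by rw [h3]; simp
      rw [h4, sum_inner]
      push_cast
      refine Finset.sum_congr rfl fun μ hμ => ?_
      rw [inner_sum, Finset.sum_eq_single μ]
      · rw [inner_self_eq_norm_sq_to_K]; simp
      · intro ν _ hν
        exact hA.inner_eq_zero hν.symm (hA.eigenProj_mem _ _) (hA.eigenProj_mem _ _)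
      · intro h; exact absurd hμ h
    exact_mod_cast this
  have h3 := norm_inner_le_norm (𝕜 := ℂ) (∑ μ ∈ s, eigenProj A μ u) u
  rw [h2, Complex.norm_real, Real.norm_of_nonneg (by positivity), ← h1] at h3
  rw [← h1]
  nlinarith [norm_nonneg (∑ μ ∈ s, eigenProj A μ u), norm_nonneg u, sq_nonneg
    (‖∑ μ ∈ s, eigenProj A μ u‖ - ‖u‖)]

theorem summable_norm_sq_eigenProj (hA : IsPositivePurePoint A) (u : H) :
    Summable fun μ => ‖eigenProj A μ u‖ ^ 2 :=
  summable_of_sum_le (fun _ => by positivity) fun s => hA.sum_norm_sq_eigenProj_le s u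

/-- Let `J` map a total family of eigenvectors of `A` to eigenvectors of `A'` with the same
eigenvalues `l ≥ 1`, and let `J† J` act on it as `c · l ^ (-1/2)`. Then
`c = A ^ (1/2 - α) J† A' ^ α J`. -/
theorem power_formula (hA : IsPositivePurePoint A) (hA' : IsPositivePurePoint A')
    {ι : Type*} {x : ι → H} {l : ι → ℝ}
    (htot : (Submodule.span ℂ (range x)).topologicalClosure = ⊤)
    (hl : ∀ a, 1 ≤ l a) (hx : ∀ a, x a ∈ eigenspace A (l a)) (J : H →L[ℂ] K)
    (hJ : ∀ a, J (x a) ∈ eigenspace A' (l a)) {c : ℝ}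
    (hJJ : ∀ a, (ContinuousLinearMap.adjoint J) (J (x a)) = ((c * l a ^ (-(1 / 2) : ℝ) : ℝ) : ℂ) • x a)
    (α : ℝ) (u : H) :
    (∃ V : ℝ → H,
      powExpansion α (coeffs A' (J u)) ∈ HilbertScale A' (1 / 2 - 2 * α) ∧
      IsImageOfExpansion A (ContinuousLinearMap.adjoint J) (powExpansion α (coeffs A' (J u))) V ∧
      V ∈ HilbertScale A (1 - 2 * α) ∧
      coeffs A ((c : ℂ) • u) = powExpansion (1 / 2 - α) V) ∧
    (∀ v : K, IsPow A' α (J u) v →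
      IsPow A (1 / 2 - α) (ContinuousLinearMap.adjoint J v) ((c : ℂ) • u)) ∧
    (α ≤ 1 / 4 → ∃ v : K, IsPow A' α (J u) v) := by
  set B := ContinuousLinearMap.adjoint J with hB
  have hPx : ∀ μ a, eigenProj A μ (x a) = if l a = μ then x a else 0 := by
    intro μ a
    split_ifs with h
    · rw [← h]; exact eigenProj_of_mem (hx a)
    · exact hA.eigenProj_of_mem_of_ne h (hx a)
  -- J intertwines the spectral projections, by comparison on the total family; taking adjoints
  -- gives the same for J† without any knowledge of J† off the range of J.
  have hPJ : ∀ μ v, eigenProj A' μ (J v) = J (eigenProj A μ v) := by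
    intro μ v
    have : (eigenProj A' μ).comp J = J.comp (eigenProj A μ) := by
      refine clm_eq_of_total htot fun a => ?_
      simp only [ContinuousLinearMap.comp_apply, hPx]
      split_ifs with h
      · rw [← h]; exact eigenProj_of_mem (hJ a)
      · rw [map_zero]; exact hA'.eigenProj_of_mem_of_ne h (hJ a)
    exact congrArg (fun f : H →L[ℂ] K => f v) this
  have hPB : ∀ μ v, eigenProj A μ (B v) = B (eigenProj A' μ v) := by
    intro μ v
    refine ext_inner_left ℂ fun w => ?_
    rw [← eigenProj_symm, hB, ContinuousLinearMap.adjoint_inner_right,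
      ContinuousLinearMap.adjoint_inner_right, ← hPJ, eigenProj_symm]
  have hBJ : ∀ μ v, B (J (eigenProj A μ v)) = ((c * μ ^ (-(1 / 2) : ℝ) : ℝ) : ℂ) • eigenProj A μ v := by
    intro μ v
    have : (B.comp J).comp (eigenProj A μ)
        = ((c * μ ^ (-(1 / 2) : ℝ) : ℝ) : ℂ) • (eigenProj A μ) := by
      refine clm_eq_of_total htot fun a => ?_
      simp only [ContinuousLinearMap.comp_apply, smul_apply, hPx]
      split_ifs with h
      · rw [← h]; exact hJJ a
      · simp
    exact congrArg (fun f : H →L[ℂ] H => f v) this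
  -- Only μ ≥ 1 contributes. Positivity makes the real powers of μ additive in the exponent, and μ ≥
  -- 1 bounds the nonpositive powers by 1 in the last part.
  have hμ : ∀ μ v, eigenProj A μ v = 0 ∨ 1 ≤ μ := by
    intro μ v
    by_cases h : ∃ a, l a = μ
    · obtain ⟨a, rfl⟩ := h; exact Or.inr (hl a)
    · left
      push Not at h
      have : eigenProj A μ = 0 := by
        refine clm_eq_of_total htot fun a => ?_
        rw [hPx, if_neg (h a)]; rfl
      rw [this]; rfl
  -- J gains exactly half an order in the scale of A', which is the source of the order 1/2 - 2α and
  -- of the threshold α ≤ 1/4.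
  have hnorm : ∀ μ v, ‖J (eigenProj A μ v)‖ ^ 2 = c * μ ^ (-(1 / 2) : ℝ) * ‖eigenProj A μ v‖ ^ 2 := by
    intro μ v
    have h1 : ⟪J (eigenProj A μ v), J (eigenProj A μ v)⟫_ℂ
        = ((c * μ ^ (-(1 / 2) : ℝ) : ℝ) : ℂ) * ⟪eigenProj A μ v, eigenProj A μ v⟫_ℂ := by
      rw [← ContinuousLinearMap.adjoint_inner_right, ← hB, hBJ, inner_smul_right]
    rw [inner_self_eq_norm_sq_to_K, inner_self_eq_norm_sq_to_K] at h1
    have h2 : ((‖J (eigenProj A μ v)‖ ^ 2 : ℝ) : ℂ)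
        = ((c * μ ^ (-(1 / 2) : ℝ) * ‖eigenProj A μ v‖ ^ 2 : ℝ) : ℂ) := by
      push_cast; push_cast at h1; exact h1
    exact_mod_cast h2
  -- The components of V: the power of A' contributes ν^α, and J†J contributes c ν^(-1/2).
  refine ⟨⟨fun ν => ((c * ν ^ (α - 1 / 2) : ℝ) : ℂ) • eigenProj A ν u, ⟨?_, ?_⟩, ?_, ⟨?_, ?_⟩, ?_⟩,
    ?_, ?_⟩
  · intro μ
    exact Submodule.smul_mem _ _ (hA'.eigenProj_mem _ _)
  · refine ((hA.summable_norm_sq_eigenProj u).mul_left c).congr fun μ => ?_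
    simp only [powExpansion, coeffs, hPJ]
    rw [norm_smul, mul_pow, hnorm]
    rcases hμ μ u with h | h
    · simp [h]
    have h0 : 0 < μ := by linarith
    rw [Complex.norm_real, Real.norm_of_nonneg (by positivity), ← Real.rpow_natCast (μ ^ α),
      ← Real.rpow_mul h0.le]
    have : μ ^ (1 / 2 - 2 * α) * μ ^ (α * ((2 : ℕ) : ℝ)) * μ ^ (-(1 / 2) : ℝ) = 1 := by
      rw [← Real.rpow_add h0, ← Real.rpow_add h0]
      convert Real.rpow_zero μ using 2
      push_cast; ring
    linear_combination (-c * ‖eigenProj A μ u‖ ^ 2) * this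
  · intro ν
    have hz : ∀ μ, μ ≠ ν → eigenProj A ν (B (powExpansion α (coeffs A' (J u)) μ)) = 0 := by
      intro μ hne
      simp only [powExpansion, coeffs, hPJ, map_smul, hBJ]
      rw [hA.eigenProj_of_mem_of_ne hne (hA.eigenProj_mem _ _), smul_zero, smul_zero]
    convert hasSum_single ν hz using 1
    simp only [powExpansion, coeffs, hPJ, map_smul, hBJ, smul_smul]
    rw [eigenProj_of_mem (hA.eigenProj_mem _ _)]
    rcases hμ ν u with h | h
    · simp [h]
    have h0 : 0 < ν := by linarith
    congr 1
    rw [sub_eq_add_neg, Real.rpow_add h0]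
    push_cast; ring
  · intro μ
    exact Submodule.smul_mem _ _ (hA.eigenProj_mem _ _)
  · refine ((hA.summable_norm_sq_eigenProj u).mul_left (c ^ 2)).congr fun μ => ?_
    rw [norm_smul, mul_pow, Complex.norm_real]
    rcases hμ μ u with h | h
    · simp [h]
    have h0 : 0 < μ := by linarith
    rw [Real.norm_eq_abs, sq_abs, mul_pow, ← Real.rpow_natCast (μ ^ _), ← Real.rpow_mul h0.le]
    have : μ ^ (1 - 2 * α) * μ ^ ((α - 1 / 2) * ((2 : ℕ) : ℝ)) = 1 := by
      rw [← Real.rpow_add h0]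
      convert Real.rpow_zero μ using 2
      push_cast; ring
    linear_combination (-c ^ 2 * ‖eigenProj A μ u‖ ^ 2) * this
  · funext ν
    simp only [powExpansion, coeffs, map_smul, smul_smul]
    rcases hμ ν u with h | h
    · simp [h]
    have h0 : 0 < ν := by linarith
    congr 1
    have : ν ^ (1 / 2 - α) * ν ^ (α - 1 / 2) = 1 := by
      rw [← Real.rpow_add h0]
      convert Real.rpow_zero ν using 2
      ring
    have h2 : (((ν ^ (1 / 2 - α) * ν ^ (α - 1 / 2) : ℝ)) : ℂ) = 1 := by rw [this]; simp
    push_cast at h2 ⊢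
    linear_combination (-(c : ℂ)) * h2
  · intro v hv
    funext ν
    have hv1 : eigenProj A' ν v = ((ν ^ α : ℝ) : ℂ) • J (eigenProj A ν u) := by
      rw [← hPJ]; exact congrFun hv ν
    simp only [powExpansion, coeffs, map_smul, hPB, hv1, hBJ, smul_smul]
    rcases hμ ν u with h | h
    · simp [h]
    have h0 : 0 < ν := by linarith
    congr 1
    have : ν ^ (1 / 2 - α) * ν ^ α * ν ^ (-(1 / 2) : ℝ) = 1 := by
      rw [← Real.rpow_add h0, ← Real.rpow_add h0]
      convert Real.rpow_zero ν using 2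
      ring
    have h2 : (((ν ^ (1 / 2 - α) * ν ^ α * ν ^ (-(1 / 2) : ℝ) : ℝ)) : ℂ) = 1 := by rw [this]; simp
    push_cast at h2 ⊢
    linear_combination (-(c : ℂ)) * h2
  -- The series for the power applied to J u is orthogonal, with squared norms c μ^(2α - 1/2) ‖P_μ
  -- u‖²; the exponent is nonpositive for α ≤ 1/4, so it converges in the Hilbert space.
  · intro hα
    have hof : OrthogonalFamily ℂ (fun μ : ℝ => eigenspace A' μ)
        fun μ => (eigenspace A' μ).subtypeₗᵢ := by
      intro μ ν hne v w
      exact hA'.inner_eq_zero hne v.2 w.2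
    let W : ∀ μ : ℝ, eigenspace A' μ := fun μ =>
      ((μ ^ α : ℝ) : ℂ) • ⟨eigenProj A' μ (J u), hA'.eigenProj_mem _ _⟩
    have hW : ∀ μ, (W μ : K) = ((μ ^ α : ℝ) : ℂ) • J (eigenProj A μ u) := fun μ => by
      rw [← hPJ]; rfl
    have hsum : Summable fun μ => (W μ : K) := by
      refine (hof.summable_iff_norm_sq_summable W).2 ?_
      refine Summable.of_nonneg_of_le (fun _ => by positivity) (fun μ => ?_)
        ((hA.summable_norm_sq_eigenProj u).mul_left |c|)
      change ‖(W μ : K)‖ ^ 2 ≤ _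
      rw [hW, norm_smul, mul_pow, hnorm]
      rcases hμ μ u with h | h
      · simp [h]
      have h0 : 0 < μ := by linarith
      rw [Complex.norm_real, Real.norm_of_nonneg (by positivity), ← Real.rpow_natCast (μ ^ α),
        ← Real.rpow_mul h0.le]
      have : μ ^ (α * ((2 : ℕ) : ℝ)) * μ ^ (-(1 / 2) : ℝ) ≤ 1 := by
        rw [← Real.rpow_add h0]
        refine Real.rpow_le_one_of_one_le_of_nonpos h ?_
        push_cast; linarith
      calc _ = (μ ^ (α * ((2 : ℕ) : ℝ)) * μ ^ (-(1 / 2) : ℝ)) * (c * ‖eigenProj A μ u‖ ^ 2) := by ring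
        _ ≤ (μ ^ (α * ((2 : ℕ) : ℝ)) * μ ^ (-(1 / 2) : ℝ)) * (|c| * ‖eigenProj A μ u‖ ^ 2) := by
          gcongr; exact le_abs_self c
        _ ≤ 1 * (|c| * ‖eigenProj A μ u‖ ^ 2) := by gcongr
        _ = _ := by ring
    refine ⟨∑' μ, (W μ : K), ?_⟩
    funext ν
    simp only [coeffs, powExpansion]
    rw [(eigenProj A' ν).map_tsum hsum, tsum_eq_single ν]
    · rw [eigenProj_of_mem (W ν).2, hW, hPJ]
    · intro μ hne
      exact hA'.eigenProj_of_mem_of_ne hne (W μ).2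

end IsPositivePurePoint
end AbstractSpectral
end XrayDisk

/-! ### Measure theory: bounded operators on L² spaces, and uniqueness in a moment problem. -/

namespace XrayDisk
section GeneralMeasure

/-- A bounded operator between `L²` spaces from a linear operation on functions that satisfies an
`L²` bound. -/
theorem exists_clm_of_bound {X Y : Type*} [MeasurableSpace X] [MeasurableSpace Y]
    {μ : Measure X} {ν : Measure Y} (S : (X → ℂ) → Y → ℂ) (C : NNReal)
    (hcongr : ∀ f g, Measurable f → Measurable g → f =ᵐ[μ] g → S f =ᵐ[ν] S g)
    (hadd : ∀ f g, Measurable f → Measurable g → MemLp f 2 μ → MemLp g 2 μ →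
      S (f + g) =ᵐ[ν] S f + S g)
    (hsmul : ∀ (c : ℂ) f, S (c • f) = c • S f)
    (hmeas : ∀ f, Measurable f → AEStronglyMeasurable (S f) ν)
    (hbound : ∀ f, Measurable f → MemLp f 2 μ → eLpNorm (S f) 2 ν ≤ C * eLpNorm f 2 μ) :
    ∃ J : Lp ℂ 2 μ →L[ℂ] Lp ℂ 2 ν, ∀ f : Lp ℂ 2 μ, J f =ᵐ[ν] S f := by
  have hm : ∀ f : Lp ℂ 2 μ, Measurable f := fun f => (Lp.stronglyMeasurable f).measurable
  have hmem : ∀ f : Lp ℂ 2 μ, MemLp (S f) 2 ν := fun f =>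
    ⟨hmeas f (hm f), (hbound f (hm f) (Lp.memLp f)).trans_lt
      (ENNReal.mul_lt_top ENNReal.coe_lt_top (Lp.memLp f).2)⟩
  let T : Lp ℂ 2 μ →ₗ[ℂ] Lp ℂ 2 ν :=
    { toFun := fun f => (hmem f).toLp
      map_add' := by
        intro f g
        refine Lp.ext ?_
        filter_upwards [(hmem (f + g)).coeFn_toLp, (hmem f).coeFn_toLp, (hmem g).coeFn_toLp,
          Lp.coeFn_add (hmem f).toLp (hmem g).toLp,
          hcongr _ _ (hm (f + g)) ((hm f).add (hm g)) (Lp.coeFn_add f g),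
          hadd f g (hm f) (hm g) (Lp.memLp f) (Lp.memLp g)] with y h1 h2 h3 h4 h5 h6
        rw [h1, h4, h5, h6, Pi.add_apply, Pi.add_apply, h2, h3]
      map_smul' := by
        intro c f
        refine Lp.ext ?_
        filter_upwards [(hmem (c • f)).coeFn_toLp, (hmem f).coeFn_toLp,
          Lp.coeFn_smul c (hmem f).toLp,
          hcongr _ _ (hm (c • f)) ((hm f).const_smul c) (Lp.coeFn_smul c f)] with y h1 h2 h4 h5
        rw [h1, RingHom.id_apply, h4, h5, hsmul, Pi.smul_apply, Pi.smul_apply, h2] }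
  refine ⟨T.mkContinuous C fun f => ?_, fun f => (hmem f).coeFn_toLp⟩
  change ‖(hmem f).toLp‖ ≤ _
  rw [Lp.norm_toLp, Lp.norm_def]
  refine (ENNReal.toReal_mono (ENNReal.mul_lt_top ENNReal.coe_lt_top (Lp.memLp f).2).ne
    (hbound f (hm f) (Lp.memLp f))).trans_eq ?_
  rw [ENNReal.toReal_mul]; rfl

/-- The positive and negative parts of g are densities of two finite measures. Their images under q
have equal characteristic functions, hence are equal; applying r recovers the measures on X, so the
two densities agree almost everywhere. -/
theorem ae_eq_zero_of_charFun_real {X E : Type*} [MeasurableSpace X] [NormedAddCommGroup E]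
    [NormedSpace ℝ E] [MeasurableSpace E] [BorelSpace E] [SecondCountableTopology E]
    [CompleteSpace E] {μ : Measure X} {q : X → E} (hq : Measurable q) {r : E → X}
    (hr : Measurable r) (hrq : ∀ᵐ x ∂μ, r (q x) = x) {g : X → ℝ} (hg : Integrable g μ)
    (h : ∀ L : StrongDual ℝ E, ∫ x, Complex.exp (L (q x) * Complex.I) * (g x : ℂ) ∂μ = 0) :
    g =ᵐ[μ] 0 := by
  have hfin : ∀ f : X → ℝ, Integrable f μ →
      IsFiniteMeasure (μ.withDensity fun x => ENNReal.ofReal (f x)) := fun f hf =>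
    isFiniteMeasure_withDensity_ofReal hf.2
  have hg' : Integrable (fun x => -g x) μ := hg.neg
  have := hfin _ hg
  have := hfin _ hg'
  have hcf : ∀ f : X → ℝ, Integrable f μ → ∀ L : StrongDual ℝ E,
      charFunDual ((μ.withDensity fun x => ENNReal.ofReal (f x)).map q) L
        = ∫ x, Complex.exp (L (q x) * Complex.I) * ((max (f x) 0 : ℝ) : ℂ) ∂μ := by
    intro f hf L
    rw [charFunDual_apply, integral_map hq.aemeasurable (by fun_prop),
      integral_withDensity_eq_integral_toReal_smul₀ hf.aemeasurable.ennreal_ofReal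
        (Filter.Eventually.of_forall fun _ => ENNReal.ofReal_lt_top)]
    refine integral_congr_ae (Filter.Eventually.of_forall fun x => ?_)
    simp only [ENNReal.toReal_ofReal', Complex.real_smul]
    ring
  have hint : ∀ f : X → ℝ, Integrable f μ → ∀ L : StrongDual ℝ E,
      Integrable (fun x => Complex.exp (L (q x) * Complex.I) * ((max (f x) 0 : ℝ) : ℂ)) μ := by
    intro f hf L
    refine Integrable.bdd_mul (c := 1) hf.pos_part.ofReal (by fun_prop) ?_
    filter_upwards with x
    rw [Complex.norm_exp_ofReal_mul_I]
  have hP : (μ.withDensity fun x => ENNReal.ofReal (g x)).map q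
      = (μ.withDensity fun x => ENNReal.ofReal (-g x)).map q := by
    apply Measure.ext_of_charFunDual
    funext L
    rw [hcf g hg, hcf _ hg', ← sub_eq_zero, ← integral_sub (hint g hg L) (hint _ hg' L), ← h L]
    refine integral_congr_ae (Filter.Eventually.of_forall fun x => ?_)
    simp only [← mul_sub, ← Complex.ofReal_sub]
    congr 2
    rcases le_total (g x) 0 with h0 | h0
    · rw [max_eq_right h0, max_eq_left (by linarith)]; ring
    · rw [max_eq_left h0, max_eq_right (by linarith)]; ring
  have hback : ∀ f : X → ENNReal, ((μ.withDensity f).map q).map r = μ.withDensity f := by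
    intro f
    rw [Measure.map_map hr hq]
    conv_rhs => rw [← Measure.map_id (μ := μ.withDensity f)]
    refine Measure.map_congr ?_
    exact (withDensity_absolutelyContinuous μ f).ae_le hrq
  have hD := congrArg (Measure.map r) hP
  rw [hback, hback, withDensity_eq_iff hg.aemeasurable.ennreal_ofReal
    hg'.aemeasurable.ennreal_ofReal] at hD
  · filter_upwards [hD] with x hx
    rcases lt_trichotomy (g x) 0 with h0 | h0 | h0
    · rw [ENNReal.ofReal_of_nonpos h0.le, eq_comm, ENNReal.ofReal_eq_zero] at hx; linarith
    · exact h0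
    · rw [ENNReal.ofReal_of_nonpos (by linarith : -g x ≤ 0), ENNReal.ofReal_eq_zero] at hx; linarith
  · exact (hg.lintegral_lt_top).ne

/-- A function all of whose moments along the linear functionals of a bounded injective map
vanish is zero. -/
theorem ae_eq_zero_of_moments {X E : Type*} [MeasurableSpace X] [NormedAddCommGroup E]
    [NormedSpace ℝ E] [MeasurableSpace E] [BorelSpace E] [SecondCountableTopology E]
    [CompleteSpace E] {μ : Measure X} {q : X → E} (hq : Measurable q) {r : E → X}
    (hr : Measurable r) (hrq : ∀ᵐ x ∂μ, r (q x) = x) {C : ℝ} (hC : ∀ᵐ x ∂μ, ‖q x‖ ≤ C)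
    {G : X → ℂ} (hG : Integrable G μ)
    (h : ∀ (L : StrongDual ℝ E) (n : ℕ), ∫ x, ((L (q x) : ℝ) : ℂ) ^ n * G x ∂μ = 0) :
    G =ᵐ[μ] 0 := by
  have hbd : ∀ L : StrongDual ℝ E, ∀ᵐ x ∂μ, |L (q x)| ≤ ‖L‖ * C := by
    intro L
    filter_upwards [hC] with x hx
    exact (L.le_opNorm (q x)).trans (by gcongr)
  -- Boundedness of q allows the exponential series to be integrated term by term, so vanishing
  -- moments give a vanishing Fourier transform.
  have hexp : ∀ L : StrongDual ℝ E, ∫ x, Complex.exp (L (q x) * Complex.I) * G x ∂μ = 0 := by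
    intro L
    let F : ℕ → X → ℂ := fun n x => (Complex.I ^ n / (n.factorial : ℂ)) *
      (((L (q x) : ℝ) : ℂ) ^ n * G x)
    have hFi : ∀ n, Integrable (F n) μ := by
      intro n
      refine Integrable.const_mul ?_ _
      refine Integrable.bdd_mul (c := (‖L‖ * C) ^ n) hG (by fun_prop) ?_
      filter_upwards [hbd L] with x hx
      rw [norm_pow, Complex.norm_real, Real.norm_eq_abs]
      gcongr
    have hFs : Summable fun n => ∫ x, ‖F n x‖ ∂μ := by
      refine Summable.of_nonneg_of_le (fun n => by positivity) (fun n => ?_)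
        ((Real.summable_pow_div_factorial (‖L‖ * C)).mul_right (∫ x, ‖G x‖ ∂μ))
      rw [← integral_const_mul]
      refine integral_mono_ae (hFi n).norm (hG.norm.const_mul _) ?_
      filter_upwards [hbd L] with x hx
      simp only [F, norm_mul, norm_div, norm_pow, Complex.norm_I, one_pow, Complex.norm_real,
        Complex.norm_natCast, Real.norm_eq_abs]
      rw [one_div, ← mul_assoc, ← div_eq_inv_mul]
      gcongr
    have hs := hasSum_integral_of_summable_integral_norm hFi hFs
    have hz : ∀ n, ∫ x, F n x ∂μ = 0 := fun n => by
      simp only [F]; rw [integral_const_mul, h L n, mul_zero]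
    simp only [hz] at hs
    rw [← hs.unique hasSum_zero]
    refine integral_congr_ae (Filter.Eventually.of_forall fun x => ?_)
    simp only [F]
    have he := (NormedSpace.expSeries_div_hasSum_exp ((L (q x) : ℂ) * Complex.I)).mul_right (G x)
    rw [← Complex.exp_eq_exp_ℂ] at he
    rw [← he.tsum_eq]
    congr 1
    funext n
    rw [mul_pow]; ring
  -- Conjugating the identity for -L puts the conjugate of G on the same footing; sums and
  -- differences then isolate the real and imaginary parts.
  have hconj : ∀ L : StrongDual ℝ E, ∫ x, Complex.exp (L (q x) * Complex.I) * conj (G x) ∂μ = 0 := by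
    intro L
    have h1 := congrArg conj (hexp (-L))
    rw [map_zero, ← integral_conj] at h1
    rw [← h1]
    refine integral_congr_ae (Filter.Eventually.of_forall fun x => ?_)
    simp only [map_mul, map_neg, ← Complex.exp_conj, Complex.conj_ofReal, Complex.conj_I, neg_apply,
      Complex.ofReal_neg, neg_mul_neg]
  have hi : ∀ L : StrongDual ℝ E,
      Integrable (fun x => Complex.exp (L (q x) * Complex.I) * G x) μ := fun L =>
    Integrable.bdd_mul (c := 1) hG (by fun_prop)
      (Filter.Eventually.of_forall fun x => by rw [Complex.norm_exp_ofReal_mul_I])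
  have hGc : Integrable (fun x => conj (G x)) μ :=
    (ContinuousLinearMap.integrable_comp (Complex.conjCLE.toContinuousLinearMap) hG)
  have hi' : ∀ L : StrongDual ℝ E,
      Integrable (fun x => Complex.exp (L (q x) * Complex.I) * conj (G x)) μ := fun L =>
    Integrable.bdd_mul (c := 1) hGc (by fun_prop)
      (Filter.Eventually.of_forall fun x => by rw [Complex.norm_exp_ofReal_mul_I])
  have hre : (fun x => (G x).re) =ᵐ[μ] 0 := by
    refine ae_eq_zero_of_charFun_real hq hr hrq hG.re fun L => ?_
    have h2 := integral_add (hi L) (hi' L)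
    rw [hexp, hconj, add_zero] at h2
    have h3 : ∫ x, (2 : ℂ) * (Complex.exp (L (q x) * Complex.I) * ((G x).re : ℂ)) ∂μ = 0 := by
      rw [← h2]
      refine integral_congr_ae (Filter.Eventually.of_forall fun x => ?_)
      simp only [Complex.re_eq_add_conj]
      ring
    rw [integral_const_mul] at h3
    simpa using h3
  have him : (fun x => (G x).im) =ᵐ[μ] 0 := by
    refine ae_eq_zero_of_charFun_real hq hr hrq hG.im fun L => ?_
    have h2 := integral_sub (hi L) (hi' L)
    rw [hexp, hconj, sub_zero] at h2
    have h3 : ∫ x, (2 * Complex.I : ℂ) * (Complex.exp (L (q x) * Complex.I) * ((G x).im : ℂ)) ∂μ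
        = 0 := by
      rw [← h2]
      refine integral_congr_ae (Filter.Eventually.of_forall fun x => ?_)
      simp only [Complex.im_eq_sub_conj]
      field_simp
    rw [integral_const_mul] at h3
    simpa using h3
  filter_upwards [hre, him] with x h1 h2
  exact Complex.ext h1 h2

end GeneralMeasure
end XrayDisk

/-! ### Geometry of the disk: the map Φ, its Jacobian, and foliation by parallel chords. -/

namespace XrayDisk
noncomputable section DiskGeometry

variable {κ R : ℝ}

theorem abs_mul_norm_sq_lt (hκ : R ^ 2 * |κ| < 1) {z : ℂ} (hz : ‖z‖ ≤ R) :
    |κ * ‖z‖ ^ 2| < 1 := by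
  have hz2 : ‖z‖ ^ 2 ≤ R ^ 2 := pow_le_pow_left₀ (norm_nonneg z) hz 2
  rw [abs_mul, abs_of_nonneg (sq_nonneg ‖z‖)]
  nlinarith [abs_nonneg κ]

theorem one_sub_norm_pos (hκ : R ^ 2 * |κ| < 1) {z : ℂ} (hz : ‖z‖ ≤ R) :
    0 < 1 - κ * ‖z‖ ^ 2 := by
  linarith [(abs_lt.1 (abs_mul_norm_sq_lt hκ hz)).2]

theorem one_add_norm_pos (hκ : R ^ 2 * |κ| < 1) {z : ℂ} (hz : ‖z‖ ≤ R) :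
    0 < 1 + κ * ‖z‖ ^ 2 := by
  linarith [(abs_lt.1 (abs_mul_norm_sq_lt hκ hz)).1]

theorem one_sub_pos (hκ : R ^ 2 * |κ| < 1) : 0 < 1 - κ * R ^ 2 := by
  nlinarith [le_abs_self κ, sq_nonneg R]

theorem one_add_pos (hκ : R ^ 2 * |κ| < 1) : 0 < 1 + κ * R ^ 2 := by
  nlinarith [neg_abs_le κ, sq_nonneg R]

theorem weight_pos (hκ : R ^ 2 * |κ| < 1) {z : ℂ} (hz : ‖z‖ ≤ R) : 0 < weight κ z :=
  div_pos (one_add_norm_pos hκ hz) (one_sub_norm_pos hκ hz)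

/-- The expression is affine in ‖ζ‖², with the positive values (1 - κR²)² at the centre and (1 +
κR²)² on the unit circle. -/
theorem PhiInv_disc_pos (hκ : R ^ 2 * |κ| < 1) {ζ : ℂ} (hζ : ‖ζ‖ ≤ 1) :
    0 < (1 - κ * R ^ 2) ^ 2 + 4 * (κ * R ^ 2) * ‖ζ‖ ^ 2 := by
  have h1 := one_sub_pos hκ
  have h2 := one_add_pos hκ
  have h3 : ‖ζ‖ ^ 2 ≤ 1 := pow_le_one₀ (norm_nonneg _) hζ
  rcases le_total 0 (κ * R ^ 2) with h | h
  · positivity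
  · nlinarith [sq_nonneg ‖ζ‖, mul_nonneg (neg_nonneg.2 h) (sub_nonneg.2 h3),
      mul_pos h2 h2]

theorem norm_PhiInv_eq (hR : 0 < R) (hκ : R ^ 2 * |κ| < 1) (ζ : ℂ) :
    ‖PhiInv κ R ζ‖ = 2 * R / ((1 - κ * R ^ 2)
      + Real.sqrt ((1 - κ * R ^ 2) ^ 2 + 4 * (κ * R ^ 2) * ‖ζ‖ ^ 2)) * ‖ζ‖ := by
  have := one_sub_pos hκ
  rw [PhiInv, norm_mul, Complex.norm_real, Real.norm_of_nonneg (by positivity)]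

theorem norm_PhiInv_le (hR : 0 < R) (hκ : R ^ 2 * |κ| < 1) {ζ : ℂ} (hζ : ‖ζ‖ ≤ 1) :
    ‖PhiInv κ R ζ‖ ≤ R := by
  have h1 := one_sub_pos hκ
  have h2 := one_add_pos hκ
  have h3 : ‖ζ‖ ^ 2 ≤ 1 := pow_le_one₀ (norm_nonneg _) hζ
  rw [norm_PhiInv_eq hR hκ]
  set S := Real.sqrt ((1 - κ * R ^ 2) ^ 2 + 4 * (κ * R ^ 2) * ‖ζ‖ ^ 2) with hS
  have hS0 : 0 ≤ S := Real.sqrt_nonneg _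
  -- This says that the denominator in `PhiInv` is at least 2‖ζ‖, which is the bound wanted.
  have hSS : 2 * ‖ζ‖ - (1 - κ * R ^ 2) ≤ S := by
    apply Real.le_sqrt_of_sq_le
    nlinarith [norm_nonneg ζ, mul_nonneg (norm_nonneg ζ) (sub_nonneg.2 hζ),
      mul_nonneg h2.le (mul_nonneg (norm_nonneg ζ) (sub_nonneg.2 hζ)),
      mul_nonneg h1.le (mul_nonneg (norm_nonneg ζ) (sub_nonneg.2 hζ))]
  rw [div_mul_eq_mul_div, div_le_iff₀ (by positivity)]
  nlinarith

/-- In the radial variable r = |z| the equation Φ(z) = ζ reads κR‖ζ‖ r² + (1 - κR²) r - R‖ζ‖ = 0;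
`PhiInv` takes the root that stays finite at κ = 0, in rationalized form. -/
theorem Phi_PhiInv (hR : 0 < R) (hκ : R ^ 2 * |κ| < 1) {ζ : ℂ} (hζ : ‖ζ‖ ≤ 1) :
    Phi κ R (PhiInv κ R ζ) = ζ := by
  have hd := one_sub_norm_pos hκ (norm_PhiInv_le hR hκ hζ)
  have h1 := one_sub_pos hκ
  rw [norm_PhiInv_eq hR hκ] at hd
  rw [Phi, norm_PhiInv_eq hR hκ, PhiInv, ← mul_assoc, ← Complex.ofReal_mul]
  have hSS : Real.sqrt ((1 - κ * R ^ 2) ^ 2 + 4 * (κ * R ^ 2) * ‖ζ‖ ^ 2) ^ 2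
      = (1 - κ * R ^ 2) ^ 2 + 4 * (κ * R ^ 2) * ‖ζ‖ ^ 2 :=
    Real.sq_sqrt (PhiInv_disc_pos hκ hζ).le
  set S := Real.sqrt ((1 - κ * R ^ 2) ^ 2 + 4 * (κ * R ^ 2) * ‖ζ‖ ^ 2) with hS
  have hS0 : 0 ≤ S := Real.sqrt_nonneg _
  set D := (1 - κ * R ^ 2) + S with hD
  have hDpos : 0 < D := by positivity
  have e : 1 - κ * (2 * R / D * ‖ζ‖) ^ 2 = 2 * (1 - κ * R ^ 2) / D := by
    rw [eq_div_iff hDpos.ne']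
    field_simp
    rw [hD]
    linear_combination hSS
  rw [e]
  have : (1 - κ * R ^ 2) / (2 * (1 - κ * R ^ 2) / D) / R * (2 * R / D) = 1 := by
    have h1' := h1.ne'
    generalize 1 - κ * R ^ 2 = l at h1'
    field_simp
  rw [this]
  simp

theorem norm_Phi_eq (hR : 0 < R) (hκ : R ^ 2 * |κ| < 1) {z : ℂ} (hz : ‖z‖ ≤ R) :
    ‖Phi κ R z‖ = (1 - κ * R ^ 2) / (1 - κ * ‖z‖ ^ 2) / R * ‖z‖ := by
  have := one_sub_pos hκ
  have := one_sub_norm_pos hκ hz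
  rw [Phi, norm_mul, Complex.norm_real, Real.norm_of_nonneg (by positivity)]

theorem norm_Phi_le (hR : 0 < R) (hκ : R ^ 2 * |κ| < 1) {z : ℂ} (hz : ‖z‖ ≤ R) :
    ‖Phi κ R z‖ ≤ 1 := by
  have h1 := one_sub_pos hκ
  have h2 := one_sub_norm_pos hκ hz
  have h3 := abs_lt.1 (show |κ * R * ‖z‖| < 1 by
    rw [abs_mul, abs_mul, abs_of_pos hR, abs_of_nonneg (norm_nonneg z)]
    nlinarith [abs_nonneg κ, mul_nonneg (abs_nonneg κ) hR.le])
  rw [norm_Phi_eq hR hκ hz, div_div, div_mul_eq_mul_div, div_le_one (by positivity)]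
  -- The factorization used is R(1 - κ|z|²) - (1 - κR²)|z| = (R - |z|)(1 + κR|z|).
  nlinarith [mul_nonneg (sub_nonneg.2 hz) (by linarith : 0 ≤ 1 + κ * R * ‖z‖)]

theorem Phi_image (hR : 0 < R) (hκ : R ^ 2 * |κ| < 1) :
    Phi κ R '' Metric.closedBall 0 R = Metric.closedBall 0 1 := by
  ext ζ
  simp only [mem_image, mem_closedBall_zero_iff]
  constructor
  · rintro ⟨z, hz, rfl⟩
    exact norm_Phi_le hR hκ hz
  · intro hζ
    exact ⟨_, norm_PhiInv_le hR hκ hζ, Phi_PhiInv hR hκ hζ⟩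

theorem measurable_Phi (κ R : ℝ) : Measurable (Phi κ R) := by
  unfold Phi
  fun_prop

theorem measurable_PhiInv (κ R : ℝ) : Measurable (PhiInv κ R) := by
  unfold PhiInv
  fun_prop

theorem measurable_weight (κ : ℝ) : Measurable (weight κ) := by
  unfold weight
  fun_prop

/-- The constant Jacobian factor of `Phi` with respect to the measure `w³ dVol`. -/
def jacConst (κ R : ℝ) : ℝ := (R / (1 - κ * R ^ 2)) ^ 2

theorem jacConst_pos (hR : 0 < R) (hκ : R ^ 2 * |κ| < 1) : 0 < jacConst κ R := by
  have := one_sub_pos hκ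
  unfold jacConst
  positivity

/-- The map is a on the orthogonal complement of z and a + b‖z‖² along z; the derivative of Φ has
this shape because Φ is radial. -/
theorem det_rank_one_perturbation (a b : ℝ) (z : ℂ) :
    (a • ContinuousLinearMap.id ℝ ℂ + (b • innerSL ℝ z).smulRight z).det
      = a * (a + b * ‖z‖ ^ 2) := by
  rw [ContinuousLinearMap.det, ← LinearMap.det_toMatrix Complex.basisOneI, Matrix.det_fin_two]
  simp only [LinearMap.toMatrix_apply, Complex.coe_basisOneI_repr, Complex.coe_basisOneI]
  simp [← Complex.normSq_eq_norm_sq, Complex.normSq_apply, Complex.inner]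
  ring

theorem hasFDerivAt_Phi (hκ : R ^ 2 * |κ| < 1) {z : ℂ} (hz : ‖z‖ ≤ R) :
    HasFDerivAt (Phi κ R)
      (((1 - κ * R ^ 2) / (1 - κ * ‖z‖ ^ 2) / R) • ContinuousLinearMap.id ℝ ℂ +
        ((2 * κ * (1 - κ * R ^ 2) / (1 - κ * ‖z‖ ^ 2) ^ 2 / R) • innerSL ℝ z).smulRight z) z := by
  have h0 := (one_sub_norm_pos hκ hz).ne'
  have h1 : HasFDerivAt (fun z : ℂ => ‖z‖ ^ 2) (2 • innerSL ℝ z) z := (hasStrictFDerivAt_norm_sq z).hasFDerivAt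
  have h2 : HasDerivAt (fun t : ℝ => (1 - κ * R ^ 2) / (1 - κ * t) / R)
      (κ * (1 - κ * R ^ 2) / (1 - κ * ‖z‖ ^ 2) ^ 2 / R) (‖z‖ ^ 2) := by
    have h3 : HasDerivAt (fun t : ℝ => 1 - κ * t) (-κ) (‖z‖ ^ 2) := by
      simpa using ((hasDerivAt_id (‖z‖ ^ 2)).const_mul κ).const_sub 1
    refine (((h3.inv h0).const_mul (1 - κ * R ^ 2)).div_const R).congr_deriv ?_
    ring
  have h4 := (h2.comp_hasFDerivAt z h1).smul (hasFDerivAt_id (𝕜 := ℝ) z)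
  have he : Phi κ R = ((fun t : ℝ => (1 - κ * R ^ 2) / (1 - κ * t) / R) ∘ fun z : ℂ => ‖z‖ ^ 2) •
      (id : ℂ → ℂ) := by
    funext z
    simp [Phi]
  rw [he]
  refine h4.congr_fderiv ?_
  ext v
  simp only [Function.comp_apply, id_eq, smul_apply, add_apply,
    ContinuousLinearMap.smulRight_apply, ContinuousLinearMap.coe_id', innerSL_apply_apply,
    smul_eq_mul, nsmul_eq_mul]
  congr 2
  push_cast
  ring

/-- The Jacobian of Φ is ((1 - κR²)/R)² (1 + κ|z|²)/(1 - κ|z|²)³, which is a constant times w³ times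
the density of dVol. One factor w belongs to w dVol; the other two make h ↦ w · (h ∘ Φ) an isometry
up to a constant from L² of the unit disk to L²(M, w dVol). -/
theorem map_Phi (hR : 0 < R) (hκ : R ^ 2 * |κ| < 1) :
    Measure.map (Phi κ R) ((wdVol κ R).withDensity
      fun z => ENNReal.ofReal (weight κ z ^ 2 / jacConst κ R))
      = volume.restrict (Metric.closedBall 0 1) := by
  have hinj : InjOn (Phi κ R) (Metric.closedBall 0 R) := by
    intro z hz w hw h
    rw [mem_closedBall_zero_iff] at hz hw
    rw [← PhiInv_Phi hR hκ hz, h, PhiInv_Phi hR hκ hw]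
  have h := map_withDensity_abs_det_fderiv_eq_addHaar (volume : Measure ℂ)
    (s := Metric.closedBall (0 : ℂ) R) (f := Phi κ R)
    (Metric.isClosed_closedBall.measurableSet.nullMeasurableSet)
    (fun z hz => (hasFDerivAt_Phi hκ (mem_closedBall_zero_iff.1 hz)).hasFDerivWithinAt) hinj
  rw [Phi_image hR hκ] at h
  rw [← h]
  congr 1
  have hm := measurable_weight κ
  have hm1 : Measurable fun z : ℂ => ENNReal.ofReal (((1 + κ * ‖z‖ ^ 2) ^ 2)⁻¹) := by fun_prop
  have hm2 : Measurable fun z : ℂ => ENNReal.ofReal (weight κ z) := by fun_prop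
  have hm3 : Measurable fun z : ℂ => ENNReal.ofReal (weight κ z ^ 2 / jacConst κ R) := by fun_prop
  rw [wdVol, dVol, ← withDensity_mul _ hm1 hm2, ← withDensity_mul _ (hm1.mul hm2) hm3]
  refine withDensity_congr_ae ?_
  filter_upwards [ae_restrict_mem Metric.isClosed_closedBall.measurableSet] with z hz
  rw [mem_closedBall_zero_iff] at hz
  have h1 := one_sub_norm_pos hκ hz
  have h2 := one_add_norm_pos hκ hz
  have h3 := one_sub_pos hκ
  have h4 := jacConst_pos hR hκ
  have h5 := weight_pos hκ hz
  simp only [Pi.mul_apply]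
  rw [det_rank_one_perturbation, ← ENNReal.ofReal_mul (by positivity),
    ← ENNReal.ofReal_mul (by positivity)]
  congr 1
  have e : (1 - κ * R ^ 2) / (1 - κ * ‖z‖ ^ 2) / R * ((1 - κ * R ^ 2) / (1 - κ * ‖z‖ ^ 2) / R +
      2 * κ * (1 - κ * R ^ 2) / (1 - κ * ‖z‖ ^ 2) ^ 2 / R * ‖z‖ ^ 2)
      = ((1 - κ * R ^ 2) / R) ^ 2 * (1 + κ * ‖z‖ ^ 2) / (1 - κ * ‖z‖ ^ 2) ^ 3 := by
    field_simp
    ring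
  rw [e, abs_of_pos (by positivity), weight, jacConst]
  field_simp

theorem ae_norm_le_wdVol (κ R : ℝ) : ∀ᵐ z ∂(wdVol κ R), ‖z‖ ≤ R := by
  have h : ∀ᵐ z ∂(volume.restrict (Metric.closedBall (0 : ℂ) R)), ‖z‖ ≤ R := by
    filter_upwards [ae_restrict_mem Metric.isClosed_closedBall.measurableSet] with z hz
    exact mem_closedBall_zero_iff.1 hz
  exact (withDensity_absolutelyContinuous _ _).ae_le
    ((withDensity_absolutelyContinuous _ _).ae_le h)

theorem lintegral_disk (hR : 0 < R) (hκ : R ^ 2 * |κ| < 1) {F : ℂ → ℝ≥0∞} (hF : Measurable F) :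
    ∫⁻ ζ in Metric.closedBall 0 1, F ζ
      = ∫⁻ z, ENNReal.ofReal (weight κ z ^ 2 / jacConst κ R) * F (Phi κ R z) ∂(wdVol κ R) := by
  have hm := measurable_weight κ
  rw [← map_Phi hR hκ, lintegral_map hF (measurable_Phi κ R)]
  exact lintegral_withDensity_eq_lintegral_mul _ (by fun_prop) (hF.comp (measurable_Phi κ R))

theorem integral_disk (hR : 0 < R) (hκ : R ^ 2 * |κ| < 1) {F : ℂ → ℂ}
    (hF : AEStronglyMeasurable F (volume.restrict (Metric.closedBall 0 1))) :
    ∫ ζ in Metric.closedBall 0 1, F ζ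
      = ∫ z, ((weight κ z ^ 2 / jacConst κ R : ℝ) : ℂ) * F (Phi κ R z) ∂(wdVol κ R) := by
  have hm := measurable_weight κ
  have hF' := hF
  have h4 := jacConst_pos hR hκ
  rw [← map_Phi hR hκ] at hF' ⊢
  rw [integral_map (measurable_Phi κ R).aemeasurable hF',
    integral_withDensity_eq_integral_toReal_smul (by fun_prop) (by simp)]
  refine integral_congr_ae (Filter.Eventually.of_forall fun z => ?_)
  simp only [ENNReal.toReal_ofReal (div_nonneg (sq_nonneg (weight κ z)) h4.le), Complex.real_smul]

/-- The point at position `y` of the chord of the unit disk at signed distance `sin σ` from the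
centre, in the direction of `η`. -/
def chordPt (η : ℂ) (σ y : ℝ) : ℂ := η * (y - Real.sin σ * Complex.I)

theorem continuous_chordPt : Continuous fun p : ℂ × ℝ × ℝ => chordPt p.1 p.2.1 p.2.2 := by
  unfold chordPt
  fun_prop

theorem norm_chordPt_le {η : ℂ} (hη : ‖η‖ = 1) {σ y : ℝ} (hy : |y| ≤ Real.cos σ) :
    ‖chordPt η σ y‖ ≤ 1 := by
  rw [chordPt, norm_mul, hη, one_mul, ← sq_le_one_iff₀ (norm_nonneg _), ← Complex.normSq_eq_norm_sq,
    Complex.normSq_apply]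
  simp only [Complex.sub_re, Complex.ofReal_re, Complex.mul_re, Complex.I_re, mul_zero,
    Complex.ofReal_im, Complex.I_im, mul_one, sub_self, sub_zero, Complex.sub_im, Complex.mul_im,
    zero_sub, add_zero]
  have := sq_le_sq' (by linarith [neg_abs_le y, abs_nonneg y]) ((le_abs_self y).trans hy)
  nlinarith [Real.sin_sq_add_cos_sq σ]

/-- The parameter domain of the family of parallel chords of the unit disk. -/
def chordSet : Set ℂ := {p | p.re ∈ Icc (-(Real.pi / 2)) (Real.pi / 2) ∧ |p.im| ≤ Real.cos p.re}

theorem measurableSet_chordSet : MeasurableSet chordSet :=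
  (measurableSet_Icc.preimage Complex.measurable_re).inter
    (measurableSet_le (f := fun p : ℂ => |p.im|) (g := fun p : ℂ => Real.cos p.re)
      (by fun_prop) (by fun_prop))

theorem chordPt_image {η : ℂ} (hη : ‖η‖ = 1) :
    (fun p : ℂ => chordPt η p.re p.im) '' chordSet = Metric.closedBall 0 1 := by
  have hη0 : η ≠ 0 := by rw [← norm_ne_zero_iff, hη]; norm_num
  ext z
  simp only [mem_image, mem_closedBall_zero_iff]
  constructor
  · rintro ⟨p, hp, rfl⟩
    exact norm_chordPt_le hη hp.2
  · intro hz
    set u := z / η with hu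
    have hun : ‖u‖ ≤ 1 := by rw [hu, norm_div, hη, div_one]; exact hz
    have hsq : u.re ^ 2 + u.im ^ 2 ≤ 1 := by
      have : ‖u‖ ^ 2 ≤ 1 := pow_le_one₀ (norm_nonneg _) hun
      rw [← Complex.normSq_eq_norm_sq, Complex.normSq_apply] at this
      nlinarith
    refine ⟨⟨Real.arcsin (-u.im), u.re⟩, ⟨Real.arcsin_mem_Icc _, ?_⟩, ?_⟩
    · simp only
      rw [Real.cos_arcsin]
      apply Real.abs_le_sqrt
      nlinarith
    · simp only [chordPt]
      rw [Real.sin_arcsin (by nlinarith [sq_nonneg u.re]) (by nlinarith [sq_nonneg u.re])]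
      have : ((u.re : ℂ) - ((-u.im : ℝ) : ℂ) * Complex.I) = u := by
        conv_rhs => rw [← Complex.re_add_im u]
        push_cast; ring
      rw [this, hu, mul_div_cancel₀ _ hη0]

theorem chordPt_injOn {η : ℂ} (hη : ‖η‖ = 1) :
    InjOn (fun p : ℂ => chordPt η p.re p.im) chordSet := by
  have hη0 : η ≠ 0 := by rw [← norm_ne_zero_iff, hη]; norm_num
  intro p hp q hq h
  have h1 := mul_left_cancel₀ hη0 h
  have h2 := congrArg Complex.re h1
  have h3 := congrArg Complex.im h1
  simp at h2 h3
  exact Complex.ext (Real.injOn_sin hp.1 hq.1 (by exact_mod_cast h3)) h2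

theorem hasFDerivAt_chordPt (η p : ℂ) :
    HasFDerivAt (fun p : ℂ => chordPt η p.re p.im)
      (Complex.imCLM.smulRight η - (Real.cos p.re • Complex.reCLM).smulRight (η * Complex.I)) p := by
  have h1 : HasFDerivAt (fun p : ℂ => p.im) Complex.imCLM p := Complex.imCLM.hasFDerivAt
  have h2 : HasFDerivAt (fun p : ℂ => Real.sin p.re) (Real.cos p.re • Complex.reCLM) p :=
    (Real.hasDerivAt_sin p.re).comp_hasFDerivAt p Complex.reCLM.hasFDerivAt
  have h3 := (h1.smul_const η).sub (h2.smul_const (η * Complex.I))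
  refine h3.congr_of_eventuallyEq (Filter.Eventually.of_forall fun p => ?_)
  simp only [chordPt, Pi.sub_apply, Complex.real_smul]
  ring

theorem det_chordPt {η : ℂ} (hη : ‖η‖ = 1) (c : ℝ) :
    (Complex.imCLM.smulRight η - (c • Complex.reCLM).smulRight (η * Complex.I)).det = c := by
  rw [ContinuousLinearMap.det, ← LinearMap.det_toMatrix Complex.basisOneI, Matrix.det_fin_two]
  have h : η.re * η.re + η.im * η.im = 1 := by
    rw [← Complex.normSq_apply, Complex.normSq_eq_norm_sq, hη, one_pow]
  simp only [LinearMap.toMatrix_apply, Complex.coe_basisOneI_repr, Complex.coe_basisOneI]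
  simp
  linear_combination c * h

theorem cos_re_nonneg {p : ℂ} (hp : p ∈ chordSet) : 0 ≤ Real.cos p.re :=
  (abs_nonneg _).trans hp.2

/-- For a fixed direction the chords at signed distance sin σ sweep out the disk once, with Jacobian
cos σ. The pair (σ, y) is coded as the complex number σ + iy so that the change of variables takes
place within ℂ. -/
theorem map_chordPt {η : ℂ} (hη : ‖η‖ = 1) :
    Measure.map (fun p : ℂ => chordPt η p.re p.im)
      ((volume.restrict chordSet).withDensity fun p => ENNReal.ofReal (Real.cos p.re))
      = volume.restrict (Metric.closedBall 0 1) := by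
  have h := map_withDensity_abs_det_fderiv_eq_addHaar (volume : Measure ℂ)
    (measurableSet_chordSet.nullMeasurableSet)
    (fun p _ => (hasFDerivAt_chordPt η p).hasFDerivWithinAt) (chordPt_injOn hη)
  rw [chordPt_image hη] at h
  rw [← h]
  congr 1
  refine withDensity_congr_ae ?_
  filter_upwards [ae_restrict_mem measurableSet_chordSet] with p hp
  rw [det_chordPt hη, abs_of_nonneg (cos_re_nonneg hp)]

theorem lintegral_chord {η : ℂ} (hη : ‖η‖ = 1) {F : ℂ → ℝ≥0∞} (hF : Measurable F) :
    ∫⁻ z in Metric.closedBall 0 1, F z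
      = ∫⁻ σ in Ioo (-(Real.pi / 2)) (Real.pi / 2), ENNReal.ofReal (Real.cos σ) *
          ∫⁻ y in Icc (-Real.cos σ) (Real.cos σ), F (chordPt η σ y) := by
  have hc : Measurable fun p : ℂ => chordPt η p.re p.im := by unfold chordPt; fun_prop
  have hc' : Measurable fun p : ℝ × ℝ => chordPt η p.1 p.2 := by unfold chordPt; fun_prop
  have e1 : ∫⁻ z in Metric.closedBall 0 1, F z = ∫⁻ p in chordSet,
      ENNReal.ofReal (Real.cos p.re) * F (chordPt η p.re p.im) := by
    rw [← map_chordPt hη, lintegral_map hF hc]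
    exact lintegral_withDensity_eq_lintegral_mul _ (by fun_prop) (hF.comp hc)
  rw [e1, ← lintegral_indicator measurableSet_chordSet,
    ← Complex.volume_preserving_equiv_real_prod.symm.lintegral_comp_emb
      (MeasurableEquiv.measurableEmbedding _), Measure.volume_eq_prod, lintegral_prod,
    Measure.restrict_congr_set Ioo_ae_eq_Icc, ← lintegral_indicator measurableSet_Icc]
  · refine lintegral_congr fun σ => ?_
    have hσm : Measurable fun y : ℝ => F (chordPt η σ y) :=
      hF.comp (by unfold chordPt; fun_prop)
    by_cases hσ : σ ∈ Icc (-(Real.pi / 2)) (Real.pi / 2)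
    · rw [indicator_of_mem hσ, ← lintegral_const_mul _ hσm,
        ← lintegral_indicator measurableSet_Icc]
      refine lintegral_congr fun y => ?_
      by_cases hy : y ∈ Icc (-Real.cos σ) (Real.cos σ)
      · rw [indicator_of_mem hy, indicator_of_mem]
        · simp
        · exact ⟨by simpa using hσ, by simpa [abs_le] using hy⟩
      · rw [indicator_of_notMem hy, indicator_of_notMem]
        intro h
        exact hy (by simpa [abs_le] using h.2)
    · rw [indicator_of_notMem hσ]
      convert lintegral_zero using 3 with y
      rw [indicator_of_notMem]
      intro h
      exact hσ (by simpa using h.1)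
  · have h : Measurable (chordSet.indicator fun p : ℂ =>
        ENNReal.ofReal (Real.cos p.re) * F (chordPt η p.re p.im)) :=
      Measurable.indicator (Measurable.mul (by fun_prop) (hF.comp hc)) measurableSet_chordSet
    exact (h.comp (MeasurableEquiv.measurable _)).aemeasurable

theorem integral_chord {η : ℂ} (hη : ‖η‖ = 1) {F : ℂ → ℂ} (hF : Continuous F) :
    ∫ z in Metric.closedBall 0 1, F z
      = ∫ σ in (-(Real.pi / 2))..(Real.pi / 2), (Real.cos σ : ℂ) *
          ∫ y in (-Real.cos σ)..(Real.cos σ), F (chordPt η σ y) := by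
  have hpi := Real.pi_pos
  have hc : Continuous fun p : ℂ => chordPt η p.re p.im := by unfold chordPt; fun_prop
  have hi : IntegrableOn (fun p : ℂ => (Real.cos p.re : ℂ) * F (chordPt η p.re p.im)) chordSet := by
    refine IntegrableOn.mono_set (t := Icc (-(Real.pi / 2)) (Real.pi / 2) ×ℂ Icc (-1) 1) ?_ ?_
    · refine ContinuousOn.integrableOn_compact (isCompact_Icc.reProdIm isCompact_Icc) ?_
      exact Continuous.continuousOn (Continuous.mul (by fun_prop) (hF.comp hc))
    · intro p hp
      exact Complex.mem_reProdIm.2 ⟨hp.1, abs_le.1 (hp.2.trans (Real.cos_le_one _))⟩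
  rw [← map_chordPt hη, integral_map hc.aemeasurable hF.aestronglyMeasurable,
    integral_withDensity_eq_integral_toReal_smul (by fun_prop) (by simp)]
  have e1 : ∫ p in chordSet, (ENNReal.ofReal (Real.cos p.re)).toReal • F (chordPt η p.re p.im)
      = ∫ p in chordSet, (Real.cos p.re : ℂ) * F (chordPt η p.re p.im) := by
    refine setIntegral_congr_fun measurableSet_chordSet fun p hp => ?_
    simp only [ENNReal.toReal_ofReal (cos_re_nonneg hp), Complex.real_smul]
  rw [e1, ← integral_indicator measurableSet_chordSet,
    ← Complex.volume_preserving_equiv_real_prod.symm.integral_comp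
      (MeasurableEquiv.measurableEmbedding _), Measure.volume_eq_prod, integral_prod,
    intervalIntegral.integral_of_le (by linarith), ← integral_Icc_eq_integral_Ioc,
    ← integral_indicator measurableSet_Icc]
  · refine integral_congr_ae (Filter.Eventually.of_forall fun σ => ?_)
    by_cases hσ : σ ∈ Icc (-(Real.pi / 2)) (Real.pi / 2)
    · have hcos := Real.cos_nonneg_of_mem_Icc hσ
      simp only
      rw [indicator_of_mem hσ, ← intervalIntegral.integral_const_mul,
        intervalIntegral.integral_of_le (by linarith), ← integral_Icc_eq_integral_Ioc,
        ← integral_indicator measurableSet_Icc]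
      refine integral_congr_ae (Filter.Eventually.of_forall fun y => ?_)
      simp only
      by_cases hy : y ∈ Icc (-Real.cos σ) (Real.cos σ)
      · rw [indicator_of_mem hy, indicator_of_mem]
        · simp
        · exact ⟨by simpa using hσ, by simpa [abs_le] using hy⟩
      · rw [indicator_of_notMem hy, indicator_of_notMem]
        intro h
        exact hy (by simpa [abs_le] using h.2)
    · simp only
      rw [indicator_of_notMem hσ]
      convert integral_zero ℝ ℂ using 3 with y
      rw [indicator_of_notMem]
      intro h
      exact hσ (by simpa using h.1)
  · rw [← Measure.volume_eq_prod]
    exact (Complex.volume_preserving_equiv_real_prod.symm.integrable_comp_emb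
      (MeasurableEquiv.measurableEmbedding _)).2 (hi.integrable_indicator measurableSet_chordSet)

end DiskGeometry
end XrayDisk

/-! ### Angular functions on the boundary and the vector field behind T. -/

namespace XrayDisk
noncomputable section BoundaryAngles

variable {κ R : ℝ}

/-- The denominator `cos² a + l² sin² a`. -/
def angDen (l a : ℝ) : ℝ := Real.cos a ^ 2 + l ^ 2 * Real.sin a ^ 2

/-- The smooth extension to the circle of the derivative of `a ↦ arctan (l tan a)`. -/
def angDeriv (l a : ℝ) : ℝ := l / angDen l a

/-- The smooth extension to the circle of `a ↦ exp (i arctan (l tan a))`. -/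
def angExp (l a : ℝ) : ℂ :=
  ((Real.cos a : ℂ) + ((l * Real.sin a : ℝ) : ℂ) * Complex.I) / (Real.sqrt (angDen l a) : ℂ)

variable {l : ℝ}

theorem angDen_pos (hl : 0 < l) (a : ℝ) : 0 < angDen l a := by
  unfold angDen
  rcases eq_or_ne (Real.cos a) 0 with h | h
  · have : Real.sin a ^ 2 = 1 := by nlinarith [Real.sin_sq_add_cos_sq a]
    rw [h, this]; positivity
  · positivity

theorem angDeriv_pos (hl : 0 < l) (a : ℝ) : 0 < angDeriv l a := div_pos hl (angDen_pos hl a)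

theorem angDen_add_pi (l a : ℝ) : angDen l (a + Real.pi) = angDen l a := by
  simp [angDen, Real.cos_add_pi, Real.sin_add_pi]

theorem angDeriv_add_pi (l a : ℝ) : angDeriv l (a + Real.pi) = angDeriv l a := by
  simp [angDeriv, angDen_add_pi]

theorem angExp_add_pi (l a : ℝ) : angExp l (a + Real.pi) = -angExp l a := by
  simp only [angExp, angDen_add_pi, Real.cos_add_pi, Real.sin_add_pi]
  push_cast
  ring

theorem angDen_neg (l a : ℝ) : angDen l (-a) = angDen l a := by simp [angDen]

theorem angDeriv_neg (l a : ℝ) : angDeriv l (-a) = angDeriv l a := by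
  simp [angDeriv, angDen_neg]

theorem conj_angExp (l a : ℝ) : conj (angExp l a) = angExp l (-a) := by
  simp only [angExp, angDen_neg, map_div₀, map_add, map_mul, Complex.conj_ofReal, Complex.conj_I,
    Real.cos_neg, Real.sin_neg]
  push_cast
  ring

theorem norm_angExp (hl : 0 < l) (a : ℝ) : ‖angExp l a‖ = 1 := by
  have h := angDen_pos hl a
  have e : ‖(Real.cos a : ℂ) + ((l * Real.sin a : ℝ) : ℂ) * Complex.I‖ = Real.sqrt (angDen l a) := by
    rw [Complex.norm_add_mul_I, angDen, mul_pow]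
  rw [angExp, norm_div, e, Complex.norm_real, Real.norm_of_nonneg (Real.sqrt_nonneg _),
    div_self (Real.sqrt_pos.2 h).ne']

theorem angExp_ne_zero (hl : 0 < l) (a : ℝ) : angExp l a ≠ 0 := by
  rw [← norm_ne_zero_iff, norm_angExp hl]; norm_num

theorem angExp_neg (hl : 0 < l) (a : ℝ) : angExp l (-a) = (angExp l a)⁻¹ := by
  rw [← conj_angExp, Complex.inv_def, Complex.normSq_eq_norm_sq, norm_angExp hl]
  simp

theorem contDiff_angDen (l : ℝ) : ContDiff ℝ ∞ (angDen l) := by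
  unfold angDen
  fun_prop

theorem contDiff_angDeriv (hl : 0 < l) : ContDiff ℝ ∞ (angDeriv l) :=
  contDiff_const.div (contDiff_angDen l) fun a => (angDen_pos hl a).ne'

theorem contDiff_sqrt_angDeriv (hl : 0 < l) : ContDiff ℝ ∞ fun a => Real.sqrt (angDeriv l a) :=
  (contDiff_angDeriv hl).sqrt fun a => (angDeriv_pos hl a).ne'

theorem contDiff_angExp (hl : 0 < l) : ContDiff ℝ ∞ (angExp l) := by
  have h1 : ContDiff ℝ ∞ fun a => ((Real.sqrt (angDen l a) : ℝ) : ℂ) :=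
    Complex.ofRealCLM.contDiff.comp ((contDiff_angDen l).sqrt fun a => (angDen_pos hl a).ne')
  have h2 : ContDiff ℝ ∞ fun a : ℝ => ((Real.cos a : ℝ) : ℂ) :=
    Complex.ofRealCLM.contDiff.comp Real.contDiff_cos
  have h3 : ContDiff ℝ ∞ fun a : ℝ => ((l * Real.sin a : ℝ) : ℂ) :=
    Complex.ofRealCLM.contDiff.comp (contDiff_const.mul Real.contDiff_sin)
  unfold angExp
  simp only [div_eq_mul_inv]
  refine (h2.add (h3.mul contDiff_const)).mul (h1.inv fun a => ?_)
  exact_mod_cast (Real.sqrt_pos.2 (angDen_pos hl a)).ne'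

theorem contDiff_angExp_zpow (hl : 0 < l) (b : ℤ) : ContDiff ℝ ∞ fun a => angExp l a ^ b := by
  cases b with
  | ofNat n => simpa using (contDiff_angExp hl).pow n
  | negSucc n =>
    simp only [zpow_negSucc]
    exact ((contDiff_angExp hl).pow (n + 1)).inv fun a => pow_ne_zero _ (angExp_ne_zero hl a)

/-- This is the logarithmic derivative of e^{i arctan(l tan a)}, proved on the extension in sin and
cos so that it also covers odd multiples of π/2, where tan has its poles. -/
theorem hasDerivAt_angExp (hl : 0 < l) (a : ℝ) :
    HasDerivAt (angExp l) (Complex.I * angDeriv l a * angExp l a) a := by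
  have hd := angDen_pos hl a
  have h0 : HasDerivAt (angDen l) (2 * (l ^ 2 - 1) * Real.sin a * Real.cos a) a := by
    unfold angDen
    refine (((Real.hasDerivAt_cos a).pow 2).add (((Real.hasDerivAt_sin a).pow 2).const_mul _)).congr_deriv ?_
    push_cast; ring
  have h1 := (h0.sqrt hd.ne').ofReal_comp
  have h2 := (Real.hasDerivAt_cos a).ofReal_comp
  have h3 := (((Real.hasDerivAt_sin a).const_mul l).ofReal_comp).mul_const Complex.I
  have hs0 : Real.sqrt (angDen l a) ≠ 0 := (Real.sqrt_pos.2 hd).ne'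
  have hs1 : ((Real.sqrt (angDen l a) : ℝ) : ℂ) ≠ 0 := by exact_mod_cast hs0
  refine ((h2.fun_add h3).fun_div h1 hs1).congr_deriv ?_
  have hsq : ((Real.sqrt (angDen l a) : ℝ) : ℂ) ^ 2
      = (Real.cos a : ℂ) ^ 2 + (l : ℂ) ^ 2 * (Real.sin a : ℂ) ^ 2 := by
    rw [← Complex.ofReal_pow, Real.sq_sqrt hd.le, angDen]; push_cast; ring
  have hden : ((angDen l a : ℝ) : ℂ) = ((Real.sqrt (angDen l a) : ℝ) : ℂ) ^ 2 := by
    rw [← Complex.ofReal_pow, Real.sq_sqrt hd.le]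
  have htrig : (Real.sin a : ℂ) ^ 2 + (Real.cos a : ℂ) ^ 2 = 1 := by
    exact_mod_cast Real.sin_sq_add_cos_sq a
  simp only [angDeriv, angExp]
  push_cast [hden]
  push_cast at hsq htrig
  set S : ℂ := ((Real.sqrt (angDen l a) : ℝ) : ℂ)
  set s : ℂ := Complex.sin a
  set c : ℂ := Complex.cos a
  field_simp
  rw [hsq]
  linear_combination (l * Complex.I * c - s * l ^ 2) * htrig - s * l ^ 2 * Complex.I_sq

theorem hasDerivAt_angExp_zpow (hl : 0 < l) (b : ℤ) (a : ℝ) :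
    HasDerivAt (fun a => angExp l a ^ b)
      (Complex.I * b * angDeriv l a * angExp l a ^ b) a := by
  have h := angExp_ne_zero hl a
  refine ((hasDerivAt_zpow b (angExp l a) (Or.inl h)).comp_of_eq a (hasDerivAt_angExp hl a) rfl
    |>.congr_deriv ?_)
  rw [zpow_sub_one₀ h]
  field_simp

theorem angExp_eq_exp (hl : 0 < l) {a : ℝ} (ha : |a| < Real.pi / 2) :
    angExp l a = Complex.exp ((Real.arctan (l * Real.tan a) : ℝ) * Complex.I) := by
  have hc : 0 < Real.cos a := Real.cos_pos_of_mem_Ioo (abs_lt.1 ha)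
  have hs : Real.sqrt (angDen l a) = Real.cos a * Real.sqrt (1 + (l * Real.tan a) ^ 2) := by
    nth_rewrite 1 [← Real.sqrt_sq hc.le]
    rw [← Real.sqrt_mul (sq_nonneg _)]
    congr 1
    rw [angDen, Real.tan_eq_sin_div_cos]
    field_simp
  have h0 : 0 < Real.sqrt (1 + (l * Real.tan a) ^ 2) := by positivity
  rw [Complex.exp_mul_I, ← Complex.ofReal_cos, ← Complex.ofReal_sin, Real.cos_arctan,
    Real.sin_arctan, angExp, hs]
  have h0' : ((Real.sqrt (1 + (l * Real.tan a) ^ 2) : ℝ) : ℂ) ≠ 0 := by exact_mod_cast h0.ne'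
  have hc' : ((Real.cos a : ℝ) : ℂ) ≠ 0 := by exact_mod_cast hc.ne'
  have ht : Real.sin a = Real.tan a * Real.cos a := (Real.tan_mul_cos hc.ne').symm
  rw [ht]
  push_cast
  push_cast at hc'
  field_simp

theorem hasDerivAt_arctan_tan (hl : 0 < l) {a : ℝ} (ha : |a| < Real.pi / 2) :
    HasDerivAt (fun a => Real.arctan (l * Real.tan a)) (angDeriv l a) a := by
  have hc : 0 < Real.cos a := Real.cos_pos_of_mem_Ioo (abs_lt.1 ha)
  refine (((Real.hasDerivAt_tan hc.ne').const_mul l).arctan).congr_deriv ?_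
  have h := angDen_pos hl a
  rw [angDeriv, Real.tan_eq_sin_div_cos]
  unfold angDen at h ⊢
  field_simp

/-- The ratio `(1 - κ R²) / (1 + κ R²)`. -/
def lamC (κ R : ℝ) : ℝ := (1 - κ * R ^ 2) / (1 + κ * R ^ 2)

theorem lamC_pos (hκ : R ^ 2 * |κ| < 1) : 0 < lamC κ R :=
  div_pos (one_sub_pos hκ) (one_add_pos hκ)

theorem hasDerivAt_scat (hκ : R ^ 2 * |κ| < 1) {a : ℝ} (ha : |a| < Real.pi / 2) :
    HasDerivAt (scat κ R) (angDeriv (lamC κ R) a) a :=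
  hasDerivAt_arctan_tan (lamC_pos hκ) ha

theorem exp_scat (hκ : R ^ 2 * |κ| < 1) {a : ℝ} (ha : |a| < Real.pi / 2) :
    Complex.exp (scat κ R a * Complex.I) = angExp (lamC κ R) a :=
  (angExp_eq_exp (lamC_pos hκ) ha).symm

theorem eventually_abs_lt {a c : ℝ} (ha : |a| < c) : ∀ᶠ y in nhds a, |y| < c :=
  continuous_abs.continuousAt.eventually_lt continuousAt_const ha

theorem toCircle_coe (t : ℝ) : (AddCircle.toCircle (t : S1) : ℂ) = Complex.exp (t * Complex.I) := by
  rw [AddCircle.toCircle_apply_mk, Circle.coe_exp]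
  congr 2
  have := Real.pi_ne_zero
  push_cast
  field_simp

/-- Smooth functions on the torus that are odd under the shift by `π` in the second variable. -/
structure OddSmooth (k : ℝ × ℝ → ℂ) : Prop where
  smooth : ContDiff ℝ ∞ k
  periodic : ∀ x y, k (x + 2 * Real.pi, y) = k (x, y)
  odd : ∀ x y, k (x, y + Real.pi) = -k (x, y)

/-- The vector field `∂_x - (1 / p) ∂_y`, with `p` the function `angDeriv l`. -/
def flowDeriv (l : ℝ) (k : ℝ × ℝ → ℂ) (q : ℝ × ℝ) : ℂ :=
  fderiv ℝ k q (1, 0) - (1 / angDeriv l q.2 : ℂ) * fderiv ℝ k q (0, 1)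

theorem OddSmooth.hasDerivAt_fst {k : ℝ × ℝ → ℂ} (hk : OddSmooth k) (x y : ℝ) :
    HasDerivAt (fun t => k (t, y)) (fderiv ℝ k (x, y) (1, 0)) x :=
  ((hk.smooth.differentiable (by simp) (x, y)).hasFDerivAt).comp_hasDerivAt x
    ((hasDerivAt_id x).prodMk (hasDerivAt_const x y))

theorem OddSmooth.hasDerivAt_snd {k : ℝ × ℝ → ℂ} (hk : OddSmooth k) (x y : ℝ) :
    HasDerivAt (fun t => k (x, t)) (fderiv ℝ k (x, y) (0, 1)) y :=
  ((hk.smooth.differentiable (by simp) (x, y)).hasFDerivAt).comp_hasDerivAt y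
    ((hasDerivAt_const y x).prodMk (hasDerivAt_id y))

theorem OddSmooth.contDiff_fderiv {k : ℝ × ℝ → ℂ} (hk : OddSmooth k) (v : ℝ × ℝ) :
    ContDiff ℝ ∞ fun q => fderiv ℝ k q v :=
  (hk.smooth.fderiv_right (m := ∞) (by simp)).clm_apply contDiff_const

/-- The coefficient 1/p is smooth with period π, so the vector field keeps both the periodicity and
the sign change; this is what allows T to be iterated. -/
theorem OddSmooth.flowDeriv (hl : 0 < l) {k : ℝ × ℝ → ℂ} (hk : OddSmooth k) :
    OddSmooth (flowDeriv l k) := by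
  have hp : ∀ q v, fderiv ℝ k (q + (2 * Real.pi, 0)) v = fderiv ℝ k q v := by
    intro q v
    rw [← fderiv_comp_add_right]
    congr 2
    funext q
    rw [← hk.periodic q.1 q.2]
    congr 1
    ext <;> simp
  have ho : ∀ q v, fderiv ℝ k (q + (0, Real.pi)) v = -fderiv ℝ k q v := by
    intro q v
    rw [← fderiv_comp_add_right, ← neg_apply, ← fderiv_fun_neg]
    congr 2
    funext q
    rw [← hk.odd q.1 q.2]
    congr 1
    ext <;> simp
  refine ⟨?_, ?_, ?_⟩
  · have h1 : ContDiff ℝ ∞ fun q : ℝ × ℝ => ((1 / angDeriv l q.2 : ℝ) : ℂ) :=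
      Complex.ofRealCLM.contDiff.comp ((contDiff_const.div (contDiff_angDeriv hl)
        fun a => (angDeriv_pos hl a).ne').comp contDiff_snd)
    push_cast at h1
    exact (hk.contDiff_fderiv _).sub (h1.mul (hk.contDiff_fderiv _))
  · intro x y
    have h1 := hp (x, y)
    simp only [Prod.mk_add_mk, add_zero] at h1
    simp only [XrayDisk.flowDeriv, h1]
  · intro x y
    have h1 := ho (x, y)
    simp only [Prod.mk_add_mk, add_zero] at h1
    simp only [XrayDisk.flowDeriv, h1, angDeriv_add_pi]
    ring

/-- `T` acts on `√p · k` as `√p · (∂_x - (1 / p) ∂_y) k`. -/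
theorem Tfun_eq (hκ : R ^ 2 * |κ| < 1) {v : S1 × ℝ → ℂ} {k : ℝ × ℝ → ℂ} (hk : OddSmooth k)
    (h : ∀ x y : ℝ, |y| < Real.pi / 2 →
      v ((x : S1), y) = (Real.sqrt (angDeriv (lamC κ R) y) : ℂ) * k (x, y))
    (x y : ℝ) (hy : |y| < Real.pi / 2) :
    Tfun κ R v ((x : S1), y)
      = (Real.sqrt (angDeriv (lamC κ R) y) : ℂ) * flowDeriv (lamC κ R) k (x, y) := by
  have hl := lamC_pos hκ
  have hs : ∀ y, |y| < Real.pi / 2 → deriv (scat κ R) y = angDeriv (lamC κ R) y := fun y hy =>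
    (hasDerivAt_scat hκ hy).deriv
  have hq : ∀ y, ((Real.sqrt (angDeriv (lamC κ R) y) : ℝ) : ℂ) ≠ 0 := fun y => by
    exact_mod_cast (Real.sqrt_pos.2 (angDeriv_pos hl y)).ne'
  have e1 : deriv (fun t : ℝ => v ((x : S1) + (t : S1), y) /
      (Real.sqrt (deriv (scat κ R) y) : ℂ)) 0 = fderiv ℝ k (x, y) (1, 0) := by
    have : (fun t : ℝ => v ((x : S1) + (t : S1), y) / (Real.sqrt (deriv (scat κ R) y) : ℂ))
        = fun t => k (x + t, y) := by
      funext t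
      rw [← AddCircle.coe_add, h _ _ hy, hs y hy, mul_div_cancel_left₀ _ (hq y)]
    rw [this]
    have h2 := hk.hasDerivAt_fst (x + 0) y
    rw [(h2.comp_const_add x 0).deriv, add_zero]
  have e2 : deriv (fun a : ℝ => v ((x : S1), a) / (Real.sqrt (deriv (scat κ R) a) : ℂ)) y
      = fderiv ℝ k (x, y) (0, 1) := by
    rw [← (hk.hasDerivAt_snd x y).deriv]
    -- The factorization of v is available only for |α| < π/2, an open condition, which is enough
    -- for a derivative.
    apply Filter.EventuallyEq.deriv_eq
    filter_upwards [eventually_abs_lt hy] with a ha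
    rw [h _ _ ha, hs a ha, mul_div_cancel_left₀ _ (hq a)]
  simp only [Tfun, flowDeriv]
  rw [e1, e2, hs y hy]

/-- The functions `e^{iax} E(y)^b`. -/
def torusMode (l : ℝ) (a b : ℤ) (q : ℝ × ℝ) : ℂ :=
  Complex.exp (q.1 * Complex.I) ^ a * angExp l q.2 ^ b

theorem contDiff_exp_zpow (a : ℤ) :
    ContDiff ℝ ∞ fun x : ℝ => Complex.exp (x * Complex.I) ^ a := by
  have : (fun x : ℝ => Complex.exp (x * Complex.I) ^ a)
      = fun x : ℝ => Complex.exp (a * ((x : ℂ) * Complex.I)) := by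
    funext x; rw [Complex.exp_int_mul]
  rw [this]
  exact ((contDiff_const.mul (Complex.ofRealCLM.contDiff.mul contDiff_const))).cexp

theorem hasDerivAt_exp_zpow (a : ℤ) (x : ℝ) :
    HasDerivAt (fun x : ℝ => Complex.exp (x * Complex.I) ^ a)
      (Complex.I * a * Complex.exp (x * Complex.I) ^ a) x := by
  have : (fun x : ℝ => Complex.exp (x * Complex.I) ^ a)
      = fun x : ℝ => Complex.exp (a * ((x : ℂ) * Complex.I)) := by
    funext x; rw [Complex.exp_int_mul]
  rw [this, ← Complex.exp_int_mul]
  refine (((Complex.ofRealCLM.hasDerivAt (x := x)).mul_const Complex.I).const_mul (a : ℂ)).cexp.congr_deriv ?_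
  simp
  ring

theorem exp_add_two_pi_zpow (a : ℤ) (x : ℝ) :
    Complex.exp (((x + 2 * Real.pi : ℝ) : ℂ) * Complex.I) ^ a = Complex.exp (x * Complex.I) ^ a := by
  congr 1
  push_cast
  rw [add_mul, Complex.exp_add, Complex.exp_two_pi_mul_I, mul_one]

theorem contDiff_torusMode (hl : 0 < l) (a b : ℤ) : ContDiff ℝ ∞ (torusMode l a b) :=
  ((contDiff_exp_zpow a).comp contDiff_fst).mul ((contDiff_angExp_zpow hl b).comp contDiff_snd)

theorem angExp_add_pi_zpow {b : ℤ} (hb : Odd b) (y : ℝ) :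
    angExp l (y + Real.pi) ^ b = -angExp l y ^ b := by
  rw [angExp_add_pi, hb.neg_zpow]

theorem oddSmooth_torusMode (hl : 0 < l) (a : ℤ) {b : ℤ} (hb : Odd b) :
    OddSmooth (torusMode l a b) := by
  refine ⟨contDiff_torusMode hl a b, fun x y => ?_, fun x y => ?_⟩
  · simp only [torusMode, exp_add_two_pi_zpow]
  · simp only [torusMode, angExp_add_pi_zpow hb]
    ring

theorem flowDeriv_torusMode (hl : 0 < l) (a : ℤ) {b : ℤ} (hb : Odd b) (q : ℝ × ℝ) :
    flowDeriv l (torusMode l a b) q = Complex.I * (a - b) * torusMode l a b q := by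
  have hk := oddSmooth_torusMode hl a hb
  have h1 := (hk.hasDerivAt_fst q.1 q.2).unique ((hasDerivAt_exp_zpow a q.1).mul_const (angExp l q.2 ^ b))
  have h2 := (hk.hasDerivAt_snd q.1 q.2).unique
    ((hasDerivAt_angExp_zpow hl b q.2).const_mul (Complex.exp (q.1 * Complex.I) ^ a))
  have hp : (angDeriv l q.2 : ℂ) ≠ 0 := by exact_mod_cast (angDeriv_pos hl q.2).ne'
  simp only [Prod.mk.eta] at h1 h2
  simp only [flowDeriv, h1, h2, torusMode]
  field_simp

/-- Integration by parts for `∂_x - (1 / p) ∂_y` against a mode. -/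
theorem integral_flowDeriv (hl : 0 < l) (a : ℤ) {b : ℤ} (hb : Odd b) {k : ℝ × ℝ → ℂ}
    (hk : OddSmooth k) :
    ∫ x in (0 : ℝ)..2 * Real.pi, ∫ y in (-(Real.pi / 2))..(Real.pi / 2),
        (angDeriv l y : ℂ) * torusMode l (-a) (-b) (x, y) * flowDeriv l k (x, y)
      = Complex.I * (a - b) * ∫ x in (0 : ℝ)..2 * Real.pi, ∫ y in (-(Real.pi / 2))..(Real.pi / 2),
        (angDeriv l y : ℂ) * torusMode l (-a) (-b) (x, y) * k (x, y) := by
  have hb' : Odd (-b) := hb.neg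
  have hm := oddSmooth_torusMode hl (-a) hb'
  have hmc := hm.smooth.continuous
  have hkc := hk.smooth.continuous
  have hk1 := (hk.contDiff_fderiv (1, 0)).continuous
  have hk2 := (hk.contDiff_fderiv (0, 1)).continuous
  have hpr : Continuous (angDeriv l) := (contDiff_angDeriv hl).continuous
  have hpne : ∀ y, (angDeriv l y : ℂ) ≠ 0 := fun y => by exact_mod_cast (angDeriv_pos hl y).ne'
  -- The boundary terms in the first variable cancel by 2π-periodicity.
  have hX : ∀ y : ℝ, ∫ x in (0 : ℝ)..2 * Real.pi, torusMode l (-a) (-b) (x, y) * fderiv ℝ k (x, y) (1, 0)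
      = Complex.I * a * ∫ x in (0 : ℝ)..2 * Real.pi, torusMode l (-a) (-b) (x, y) * k (x, y) := by
    intro y
    have hd : ∀ x, HasDerivAt (fun x => torusMode l (-a) (-b) (x, y))
        (-(Complex.I * a) * torusMode l (-a) (-b) (x, y)) x := by
      intro x
      refine ((hasDerivAt_exp_zpow (-a) x).mul_const (angExp l y ^ (-b))).congr_deriv ?_
      simp only [torusMode]; push_cast; ring
    rw [intervalIntegral.integral_mul_deriv_eq_deriv_mul (fun x _ => hd x)
      (fun x _ => hk.hasDerivAt_fst x y) (Continuous.intervalIntegrable (by fun_prop) _ _)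
      (Continuous.intervalIntegrable (by fun_prop) _ _)]
    have e1 := hm.periodic 0 y
    have e2 := hk.periodic 0 y
    rw [zero_add] at e1 e2
    rw [e1, e2, sub_self, zero_sub, ← intervalIntegral.integral_const_mul,
      ← intervalIntegral.integral_neg]
    congr 1
    funext x
    ring
  -- The mode and k both change sign under y ↦ y + π, so their product takes equal values at ±π/2
  -- and the boundary terms cancel. The weight p in the integral has been used up against the
  -- coefficient 1/p.
  have hY : ∀ x : ℝ, ∫ y in (-(Real.pi / 2))..(Real.pi / 2),
        torusMode l (-a) (-b) (x, y) * fderiv ℝ k (x, y) (0, 1)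
      = Complex.I * b * ∫ y in (-(Real.pi / 2))..(Real.pi / 2),
        (angDeriv l y : ℂ) * torusMode l (-a) (-b) (x, y) * k (x, y) := by
    intro x
    have hd : ∀ y, HasDerivAt (fun y => torusMode l (-a) (-b) (x, y))
        (-(Complex.I * b) * angDeriv l y * torusMode l (-a) (-b) (x, y)) y := by
      intro y
      refine ((hasDerivAt_angExp_zpow hl (-b) y).const_mul (Complex.exp (x * Complex.I) ^ (-a))).congr_deriv ?_
      simp only [torusMode]; push_cast; ring
    rw [intervalIntegral.integral_mul_deriv_eq_deriv_mul (fun y _ => hd y)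
      (fun y _ => hk.hasDerivAt_snd x y) (Continuous.intervalIntegrable (by fun_prop) _ _)
      (Continuous.intervalIntegrable (by fun_prop) _ _)]
    have e1 := hm.odd x (-(Real.pi / 2))
    have e2 := hk.odd x (-(Real.pi / 2))
    rw [show -(Real.pi / 2) + Real.pi = Real.pi / 2 by ring] at e1 e2
    rw [e1, e2, neg_mul_neg, sub_self, zero_sub, ← intervalIntegral.integral_const_mul,
      ← intervalIntegral.integral_neg]
    congr 1
    funext y
    ring
  have hsplit : ∀ x y, (angDeriv l y : ℂ) * torusMode l (-a) (-b) (x, y) * flowDeriv l k (x, y)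
      = (angDeriv l y : ℂ) * (torusMode l (-a) (-b) (x, y) * fderiv ℝ k (x, y) (1, 0))
        - torusMode l (-a) (-b) (x, y) * fderiv ℝ k (x, y) (0, 1) := by
    intro x y
    have := hpne y
    simp only [flowDeriv]
    field_simp
  simp only [hsplit]
  have hsub : ∀ x : ℝ, ∫ y in (-(Real.pi / 2))..(Real.pi / 2),
      ((angDeriv l y : ℂ) * (torusMode l (-a) (-b) (x, y) * fderiv ℝ k (x, y) (1, 0))
        - torusMode l (-a) (-b) (x, y) * fderiv ℝ k (x, y) (0, 1))
      = (∫ y in (-(Real.pi / 2))..(Real.pi / 2),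
        (angDeriv l y : ℂ) * (torusMode l (-a) (-b) (x, y) * fderiv ℝ k (x, y) (1, 0)))
        - Complex.I * b * ∫ y in (-(Real.pi / 2))..(Real.pi / 2),
        (angDeriv l y : ℂ) * torusMode l (-a) (-b) (x, y) * k (x, y) := by
    intro x
    rw [← hY, intervalIntegral.integral_sub (Continuous.intervalIntegrable (by fun_prop) _ _)
      (Continuous.intervalIntegrable (by fun_prop) _ _)]
  simp only [hsub]
  have hcont : ∀ g : ℝ × ℝ → ℂ, Continuous g →
      Continuous fun x => ∫ y in (-(Real.pi / 2))..(Real.pi / 2), g (x, y) := by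
    intro g hg
    exact intervalIntegral.continuous_parametric_intervalIntegral_of_continuous' (by fun_prop) _ _
  have hc1 := hcont (fun q => (angDeriv l q.2 : ℂ) * (torusMode l (-a) (-b) q * fderiv ℝ k q (1, 0)))
    (by fun_prop)
  have hc2 := hcont (fun q => (angDeriv l q.2 : ℂ) * torusMode l (-a) (-b) q * k q)
    (by fun_prop)
  rw [intervalIntegral.integral_sub (hc1.intervalIntegrable _ _)
    ((hc2.const_mul _).intervalIntegrable _ _), intervalIntegral.integral_const_mul]
  have hswap : ∀ g : ℝ × ℝ → ℂ, Continuous g →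
      ∫ x in (0 : ℝ)..2 * Real.pi, ∫ y in (-(Real.pi / 2))..(Real.pi / 2), g (x, y)
      = ∫ y in (-(Real.pi / 2))..(Real.pi / 2), ∫ x in (0 : ℝ)..2 * Real.pi, g (x, y) := by
    intro g hg
    refine intervalIntegral_intervalIntegral_swap (F := fun x y => g (x, y)) ?_
    exact (hg.continuousOn.integrableOn_compact (isCompact_uIcc.prod isCompact_uIcc)).mono_set
      (prod_mono uIoc_subset_uIcc uIoc_subset_uIcc)
  rw [hswap (fun q => (angDeriv l q.2 : ℂ) * (torusMode l (-a) (-b) q * fderiv ℝ k q (1, 0)))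
    (by fun_prop), hswap (fun q => (angDeriv l q.2 : ℂ) * torusMode l (-a) (-b) q * k q)
    (by fun_prop)]
  have e3 : ∀ y : ℝ, ∫ x in (0 : ℝ)..2 * Real.pi,
      (angDeriv l y : ℂ) * (torusMode l (-a) (-b) (x, y) * fderiv ℝ k (x, y) (1, 0))
      = Complex.I * a * ∫ x in (0 : ℝ)..2 * Real.pi,
      (angDeriv l y : ℂ) * torusMode l (-a) (-b) (x, y) * k (x, y) := by
    intro y
    rw [intervalIntegral.integral_const_mul, hX, mul_left_comm, ← intervalIntegral.integral_const_mul]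
    simp only [mul_assoc]
  simp only [e3]
  rw [intervalIntegral.integral_const_mul]
  ring

end BoundaryAngles
end XrayDisk

/-! ### The boundary L² space: lifts to the plane and Fourier modes. -/

namespace XrayDisk
noncomputable section BoundarySpace

variable {κ R : ℝ}

theorem inner_Lp_eq {X : Type*} [MeasurableSpace X] {μ : Measure X} {f g : Lp ℂ 2 μ} {F G : X → ℂ}
    (hf : f =ᵐ[μ] F) (hg : g =ᵐ[μ] G) : ⟪f, g⟫_ℂ = ∫ x, conj (F x) * G x ∂μ := by
  rw [L2.inner_def]
  refine integral_congr_ae ?_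
  filter_upwards [hf, hg] with x h1 h2
  rw [h1, h2, RCLike.inner_apply, mul_comm]

instance isFiniteMeasure_dSigma (κ R : ℝ) : IsFiniteMeasure (dSigma κ R) :=
  Measure.smul_finite _ ENNReal.ofReal_ne_top

theorem ae_abs_lt_dSigma (κ R : ℝ) : ∀ᵐ p ∂(dSigma κ R), |p.2| < Real.pi / 2 := by
  refine Measure.ae_smul_measure ?_ _
  have h : ∀ᵐ y ∂(volume.restrict (Ioo (-(Real.pi / 2)) (Real.pi / 2))), |y| < Real.pi / 2 := by
    filter_upwards [ae_restrict_mem measurableSet_Ioo] with y hy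
    exact abs_lt.2 hy
  exact Measure.quasiMeasurePreserving_snd.ae h

theorem isOpenQuotientMap_coe_prod :
    IsOpenQuotientMap (Prod.map ((↑) : ℝ → S1) (id : ℝ → ℝ)) :=
  QuotientAddGroup.isOpenQuotientMap_mk.prodMap IsOpenQuotientMap.id

theorem continuous_of_lift {F : S1 × ℝ → ℂ} (h : Continuous fun q : ℝ × ℝ => F ((q.1 : S1), q.2)) :
    Continuous F :=
  isOpenQuotientMap_coe_prod.isQuotientMap.continuous_iff.2 h

theorem integral_dSigma_of_continuous (hR : 0 < R) (hκ : R ^ 2 * |κ| < 1) {F : S1 × ℝ → ℂ}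
    (hF : Continuous F) :
    ∫ p, F p ∂(dSigma κ R) = ((R / (1 + κ * R ^ 2) : ℝ) : ℂ) *
      ∫ x in (0 : ℝ)..2 * Real.pi, ∫ y in (-(Real.pi / 2))..(Real.pi / 2), F ((x : S1), y) := by
  have h1 := one_add_pos hκ
  have hpi := Real.pi_pos
  have hi : Integrable F ((volume : Measure S1).prod
      (volume.restrict (Ioo (-(Real.pi / 2)) (Real.pi / 2)))) := by
    have e : (volume : Measure S1).prod (volume.restrict (Ioo (-(Real.pi / 2)) (Real.pi / 2)))
        = ((volume : Measure S1).prod (volume : Measure ℝ)).restrict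
          (univ ×ˢ Ioo (-(Real.pi / 2)) (Real.pi / 2)) := by
      rw [← Measure.prod_restrict, Measure.restrict_univ]
    rw [e]
    exact (hF.continuousOn.integrableOn_compact (isCompact_univ.prod isCompact_Icc)).mono_set
      (prod_mono le_rfl Ioo_subset_Icc_self)
  rw [dSigma, integral_smul_measure, ENNReal.toReal_ofReal (by positivity), integral_prod _ hi,
    Complex.real_smul]
  congr 1
  rw [← AddCircle.intervalIntegral_preimage (2 * Real.pi) 0, zero_add]
  congr 1
  funext x
  rw [intervalIntegral.integral_of_le (by linarith), ← integral_Ioc_eq_integral_Ioo]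

/-- Integrals over the inward boundary in terms of a lift to the plane. -/
theorem integral_dSigma (hR : 0 < R) (hκ : R ^ 2 * |κ| < 1) {F : S1 × ℝ → ℂ} {g : ℝ × ℝ → ℂ}
    (hg : Continuous g) (hper : ∀ x y, g (x + 2 * Real.pi, y) = g (x, y))
    (hFg : ∀ x y : ℝ, |y| < Real.pi / 2 → F ((x : S1), y) = g (x, y)) :
    ∫ p, F p ∂(dSigma κ R) = ((R / (1 + κ * R ^ 2) : ℝ) : ℂ) *
      ∫ x in (0 : ℝ)..2 * Real.pi, ∫ y in (-(Real.pi / 2))..(Real.pi / 2), g (x, y) := by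
  have hp : ∀ y, Function.Periodic (fun x => g (x, y)) (2 * Real.pi) := fun y x => hper x y
  let F' : S1 × ℝ → ℂ := fun p => (hp p.2).lift p.1
  have hF' : ∀ x y : ℝ, F' ((x : S1), y) = g (x, y) := fun x y => (hp y).lift_coe x
  have hcont : Continuous F' := continuous_of_lift (by simpa only [hF'] using hg)
  have e : ∫ p, F p ∂(dSigma κ R) = ∫ p, F' p ∂(dSigma κ R) := by
    refine integral_congr_ae ?_
    filter_upwards [ae_abs_lt_dSigma κ R] with p hp
    obtain ⟨b, y⟩ := p
    obtain ⟨x, rfl⟩ := QuotientAddGroup.mk_surjective b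
    exact (hFg x y hp).trans (hF' x y).symm
  rw [e, integral_dSigma_of_continuous hR hκ hcont]
  simp only [hF']

/-- The functions `√p(α) e^{iaβ} E(α)^b` on `∂₊SM`. -/
def bdryMode (κ R : ℝ) (a b : ℤ) (p : S1 × ℝ) : ℂ :=
  (Real.sqrt (angDeriv (lamC κ R) p.2) : ℂ) *
    ((AddCircle.toCircle p.1 : ℂ) ^ a * angExp (lamC κ R) p.2 ^ b)

theorem bdryMode_coe (a b : ℤ) (x y : ℝ) : bdryMode κ R a b ((x : S1), y)
    = (Real.sqrt (angDeriv (lamC κ R) y) : ℂ) * torusMode (lamC κ R) a b (x, y) := by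
  rw [bdryMode, torusMode, toCircle_coe]

theorem contDiff_bdryMode (hκ : R ^ 2 * |κ| < 1) (a b : ℤ) :
    ContDiff ℝ ∞ fun q : ℝ × ℝ => bdryMode κ R a b ((q.1 : S1), q.2) := by
  simp only [bdryMode_coe]
  exact (Complex.ofRealCLM.contDiff.comp
    ((contDiff_sqrt_angDeriv (lamC_pos hκ)).comp contDiff_snd)).mul
    (contDiff_torusMode (lamC_pos hκ) a b)

theorem continuous_bdryMode (hκ : R ^ 2 * |κ| < 1) (a b : ℤ) : Continuous (bdryMode κ R a b) :=
  continuous_of_lift (contDiff_bdryMode hκ a b).continuous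

theorem norm_bdryMode (hκ : R ^ 2 * |κ| < 1) (a b : ℤ) (p : S1 × ℝ) :
    ‖bdryMode κ R a b p‖ = Real.sqrt (angDeriv (lamC κ R) p.2) := by
  simp [bdryMode, Circle.norm_coe, norm_angExp (lamC_pos hκ), abs_of_nonneg (Real.sqrt_nonneg _)]

theorem exists_bound_sqrt_angDeriv {l : ℝ} (hl : 0 < l) :
    ∃ C, ∀ y, Real.sqrt (angDeriv l y) ≤ C := by
  have hc : Continuous fun y => Real.sqrt (angDeriv l y) := (contDiff_sqrt_angDeriv hl).continuous
  obtain ⟨C, hC⟩ := (isCompact_Icc (a := (0 : ℝ)) (b := 0 + Real.pi)).exists_bound_of_continuousOn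
    hc.continuousOn
  refine ⟨C, fun y => ?_⟩
  have hp : Function.Periodic (fun y => Real.sqrt (angDeriv l y)) Real.pi := fun y => by
    simp only [angDeriv_add_pi]
  obtain ⟨z, hz, he⟩ := hp.exists_mem_Ico Real.pi_pos y 0
  rw [he]
  exact (le_abs_self _).trans (hC z (Ico_subset_Icc_self hz))

theorem memLp_bdryMode (hκ : R ^ 2 * |κ| < 1) (a b : ℤ) :
    MemLp (bdryMode κ R a b) 2 (dSigma κ R) := by
  obtain ⟨C, hC⟩ := exists_bound_sqrt_angDeriv (lamC_pos hκ)
  refine MemLp.of_bound (continuous_bdryMode hκ a b).aestronglyMeasurable C ?_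
  exact Filter.Eventually.of_forall fun p => by rw [norm_bdryMode hκ]; exact hC _

theorem conj_angExp_zpow (hκ : R ^ 2 * |κ| < 1) (b : ℤ) (y : ℝ) :
    conj (angExp (lamC κ R) y ^ b) = angExp (lamC κ R) y ^ (-b) := by
  rw [map_zpow₀, conj_angExp, angExp_neg (lamC_pos hκ), inv_zpow', zpow_neg]

theorem conj_exp_zpow (a : ℤ) (x : ℝ) :
    conj (Complex.exp (x * Complex.I) ^ a) = Complex.exp (x * Complex.I) ^ (-a) := by
  rw [map_zpow₀, ← Complex.exp_conj, map_mul, Complex.conj_ofReal, Complex.conj_I, mul_neg,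
    Complex.exp_neg, inv_zpow', zpow_neg]

theorem conj_torusMode (hκ : R ^ 2 * |κ| < 1) (a b : ℤ) (q : ℝ × ℝ) :
    conj (torusMode (lamC κ R) a b q) = torusMode (lamC κ R) (-a) (-b) q := by
  rw [torusMode, torusMode, map_mul, conj_exp_zpow, conj_angExp_zpow hκ]

theorem sqrt_mul_sqrt_angDeriv (hκ : R ^ 2 * |κ| < 1) (y : ℝ) :
    ((Real.sqrt (angDeriv (lamC κ R) y) : ℝ) : ℂ) * ((Real.sqrt (angDeriv (lamC κ R) y) : ℝ) : ℂ)
      = (angDeriv (lamC κ R) y : ℂ) := by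
  rw [← Complex.ofReal_mul, Real.mul_self_sqrt (angDeriv_pos (lamC_pos hκ) y).le]

/-- Inner products with a mode in terms of lifts to the plane. -/
theorem inner_bdryMode (hR : 0 < R) (hκ : R ^ 2 * |κ| < 1) (a b : ℤ) {g : Lp ℂ 2 (dSigma κ R)}
    {G : S1 × ℝ → ℂ} {k : ℝ × ℝ → ℂ} (hg : g =ᵐ[dSigma κ R] G) (hk : Continuous k)
    (hper : ∀ x y, k (x + 2 * Real.pi, y) = k (x, y))
    (hGk : ∀ x y : ℝ, |y| < Real.pi / 2 →
      G ((x : S1), y) = (Real.sqrt (angDeriv (lamC κ R) y) : ℂ) * k (x, y)) :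
    ⟪(memLp_bdryMode hκ a b).toLp, g⟫_ℂ = ((R / (1 + κ * R ^ 2) : ℝ) : ℂ) *
      ∫ x in (0 : ℝ)..2 * Real.pi, ∫ y in (-(Real.pi / 2))..(Real.pi / 2),
        (angDeriv (lamC κ R) y : ℂ) * torusMode (lamC κ R) (-a) (-b) (x, y) * k (x, y) := by
  have hl := lamC_pos hκ
  have hpr : Continuous (angDeriv (lamC κ R)) := (contDiff_angDeriv hl).continuous
  have hmc := (contDiff_torusMode hl (-a) (-b)).continuous
  rw [inner_Lp_eq (memLp_bdryMode hκ a b).coeFn_toLp hg]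
  refine integral_dSigma hR hκ (g := fun q => (angDeriv (lamC κ R) q.2 : ℂ) *
    torusMode (lamC κ R) (-a) (-b) q * k q) (by fun_prop) ?_ ?_
  · intro x y
    simp only [hper, torusMode, exp_add_two_pi_zpow]
  · intro x y hy
    rw [hGk x y hy, bdryMode_coe, map_mul, conj_torusMode hκ, Complex.conj_ofReal,
      ← sqrt_mul_sqrt_angDeriv hκ]
    ring

/-- The modes are eigenvectors of the formal adjoint of `-T²` on its core. -/
theorem inner_bdryMode_core (hR : 0 < R) (hκ : R ^ 2 * |κ| < 1) (a : ℤ) {b : ℤ} (hb : Odd b)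
    {v : S1 × ℝ → ℂ} (hv : IsSmoothPlus κ R v) {f g : Lp ℂ 2 (dSigma κ R)}
    (hf : f =ᵐ[dSigma κ R] v) (hg : g =ᵐ[dSigma κ R] fun q => -Tfun κ R (Tfun κ R v) q) :
    ⟪(memLp_bdryMode hκ a b).toLp, g⟫_ℂ
      = ((a - b) ^ 2 : ℂ) * ⟪(memLp_bdryMode hκ a b).toLp, f⟫_ℂ := by
  have hl := lamC_pos hκ
  have hq : ∀ y, ((Real.sqrt (angDeriv (lamC κ R) y) : ℝ) : ℂ) ≠ 0 := fun y => by
    exact_mod_cast (Real.sqrt_pos.2 (angDeriv_pos hl y)).ne'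
  -- Dividing by √p removes the conjugation in T and leaves the bare vector field acting on a
  -- function that is still smooth and odd.
  let k : ℝ × ℝ → ℂ := fun q => v ((q.1 : S1), q.2) * ((Real.sqrt (angDeriv (lamC κ R) q.2) : ℝ) : ℂ)⁻¹
  have hk : OddSmooth k := by
    refine ⟨?_, ?_, ?_⟩
    · exact hv.smooth.mul ((Complex.ofRealCLM.contDiff.comp
        ((contDiff_sqrt_angDeriv hl).comp contDiff_snd)).inv fun q => hq q.2)
    · intro x y
      simp only [k, AddCircle.coe_add_period]
    · intro x y
      simp only [k, hv.odd, angDeriv_add_pi]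
      ring
  have hvk : ∀ x y : ℝ, |y| < Real.pi / 2 →
      v ((x : S1), y) = (Real.sqrt (angDeriv (lamC κ R) y) : ℂ) * k (x, y) := by
    intro x y _
    simp only [k]
    rw [mul_left_comm, mul_inv_cancel₀ (hq y), mul_one]
  have hT2 := Tfun_eq hκ (hk.flowDeriv hl) (Tfun_eq hκ hk hvk)
  have hk2 := (hk.flowDeriv hl).flowDeriv hl
  rw [inner_bdryMode hR hκ a b hf hk.smooth.continuous hk.periodic hvk,
    inner_bdryMode hR hκ a b hg (k := fun q => -flowDeriv (lamC κ R) (flowDeriv (lamC κ R) k) q)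
      hk2.smooth.continuous.neg (fun x y => by simp only [hk2.periodic])
      (fun x y hy => by simp only [hT2 x y hy, mul_neg])]
  simp only [mul_neg, intervalIntegral.integral_neg]
  rw [integral_flowDeriv hl a hb (hk.flowDeriv hl), integral_flowDeriv hl a hb hk]
  linear_combination (-((R / (1 + κ * R ^ 2) : ℝ) : ℂ) * (a - b) ^ 2 *
    ∫ x in (0 : ℝ)..2 * Real.pi, ∫ y in (-(Real.pi / 2))..(Real.pi / 2),
        (angDeriv (lamC κ R) y : ℂ) * torusMode (lamC κ R) (-a) (-b) (x, y) * k (x, y)) * Complex.I_sq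

theorem integral_exp_zpow (a : ℤ) :
    ∫ x in (0 : ℝ)..2 * Real.pi, Complex.exp (x * Complex.I) ^ a
      = if a = 0 then (2 * Real.pi : ℂ) else 0 := by
  split_ifs with h
  · simp [h]
  · have ha : (Complex.I * a : ℂ) ≠ 0 := mul_ne_zero Complex.I_ne_zero (by exact_mod_cast h)
    have hd : ∀ x : ℝ, HasDerivAt (fun x : ℝ => (Complex.I * a)⁻¹ * Complex.exp (x * Complex.I) ^ a)
        (Complex.exp (x * Complex.I) ^ a) x := fun x => by
      refine ((hasDerivAt_exp_zpow a x).const_mul _).congr_deriv ?_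
      field_simp
    rw [intervalIntegral.integral_eq_sub_of_hasDerivAt (fun x _ => hd x)
      ((contDiff_exp_zpow a).continuous.intervalIntegrable _ _)]
    have := exp_add_two_pi_zpow a 0
    rw [zero_add] at this
    rw [this, sub_self]

/-- For b ≠ 0 a primitive is E^b/(ib), and E changes sign between -π/2 and π/2, so an even power
takes equal end values. For b = 0 the primitive is 𝔰, known only inside the interval, with limits
±π/2 at its ends. -/
theorem integral_angExp_zpow (hκ : R ^ 2 * |κ| < 1) {b : ℤ} (hb : Even b) :
    ∫ y in (-(Real.pi / 2))..(Real.pi / 2), (angDeriv (lamC κ R) y : ℂ) * angExp (lamC κ R) y ^ b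
      = if b = 0 then (Real.pi : ℂ) else 0 := by
  have hl := lamC_pos hκ
  have hpi := Real.pi_pos
  have hpr : Continuous (angDeriv (lamC κ R)) := (contDiff_angDeriv hl).continuous
  split_ifs with h
  · subst h
    simp only [zpow_zero, mul_one]
    rw [intervalIntegral.integral_ofReal]
    congr 1
    have hcont : Continuous fun y => angExp (lamC κ R) y := (contDiff_angExp hl).continuous
    have hint : IntervalIntegrable (angDeriv (lamC κ R)) volume (-(Real.pi / 2)) (Real.pi / 2) :=
      hpr.intervalIntegrable _ _
    have ht1 : Filter.Tendsto (scat κ R) (nhdsWithin (-(Real.pi / 2)) (Ioi (-(Real.pi / 2))))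
        (nhds (-(Real.pi / 2))) := by
      refine (Real.tendsto_arctan_atBot.mono_right nhdsWithin_le_nhds).comp ?_
      exact (Real.tendsto_tan_neg_pi_div_two).const_mul_atBot hl
    have ht2 : Filter.Tendsto (scat κ R) (nhdsWithin (Real.pi / 2) (Iio (Real.pi / 2)))
        (nhds (Real.pi / 2)) := by
      refine (Real.tendsto_arctan_atTop.mono_right nhdsWithin_le_nhds).comp ?_
      exact (Real.tendsto_tan_pi_div_two).const_mul_atTop hl
    rw [intervalIntegral.integral_eq_sub_of_hasDerivAt_of_tendsto (f := scat κ R) (by linarith)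
      (fun y hy => hasDerivAt_scat hκ (abs_lt.2 hy)) hint ht1 ht2]
    ring
  · have hbne : (Complex.I * b : ℂ) ≠ 0 := mul_ne_zero Complex.I_ne_zero (by exact_mod_cast h)
    have hd : ∀ y : ℝ, HasDerivAt (fun y : ℝ => (Complex.I * b)⁻¹ * angExp (lamC κ R) y ^ b)
        ((angDeriv (lamC κ R) y : ℂ) * angExp (lamC κ R) y ^ b) y := fun y => by
      refine ((hasDerivAt_angExp_zpow hl b y).const_mul _).congr_deriv ?_
      field_simp
    have hcb := (contDiff_angExp_zpow hl b).continuous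
    rw [intervalIntegral.integral_eq_sub_of_hasDerivAt (fun x _ => hd x)
      (Continuous.intervalIntegrable (by fun_prop) _ _)]
    have := angExp_add_pi (lamC κ R) (-(Real.pi / 2))
    rw [show -(Real.pi / 2) + Real.pi = Real.pi / 2 by ring] at this
    rw [this, hb.neg_zpow, sub_self]

/-- Orthogonality of the modes. -/
theorem inner_bdryMode_bdryMode (hR : 0 < R) (hκ : R ^ 2 * |κ| < 1) (a a' : ℤ) {b b' : ℤ}
    (hb : Even (b' - b)) :
    ⟪(memLp_bdryMode hκ a b).toLp, (memLp_bdryMode hκ a' b').toLp⟫_ℂ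
      = if a = a' ∧ b = b' then ((R / (1 + κ * R ^ 2) * (2 * Real.pi ^ 2) : ℝ) : ℂ) else 0 := by
  have hl := lamC_pos hκ
  rw [inner_bdryMode hR hκ a b (memLp_bdryMode hκ a' b').coeFn_toLp
    (contDiff_torusMode hl a' b').continuous (fun x y => by simp only [torusMode, exp_add_two_pi_zpow])
    (fun x y _ => bdryMode_coe a' b' x y)]
  have e : ∀ x y : ℝ, (angDeriv (lamC κ R) y : ℂ) * torusMode (lamC κ R) (-a) (-b) (x, y) *
      torusMode (lamC κ R) a' b' (x, y) = Complex.exp (x * Complex.I) ^ (a' - a) *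
        ((angDeriv (lamC κ R) y : ℂ) * angExp (lamC κ R) y ^ (b' - b)) := by
    intro x y
    simp only [torusMode]
    rw [sub_eq_add_neg, sub_eq_add_neg, zpow_add₀ (Complex.exp_ne_zero _),
      zpow_add₀ (angExp_ne_zero hl y)]
    ring
  simp only [e]
  simp only [intervalIntegral.integral_const_mul, intervalIntegral.integral_mul_const]
  rw [integral_exp_zpow, integral_angExp_zpow hκ hb]
  by_cases h1 : a = a'
  · by_cases h2 : b = b'
    · subst h1 h2
      simp only [sub_self, if_true, and_self]
      push_cast
      ring
    · rw [if_neg (by omega : ¬ b' - b = 0), if_neg fun h : a = a' ∧ b = b' => h2 h.2, mul_zero, mul_zero]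
  · rw [if_neg (by omega : ¬ a' - a = 0), if_neg fun h : a = a' ∧ b = b' => h1 h.1, zero_mul, mul_zero]

end BoundarySpace
end XrayDisk

/-! ### The operator -T²: invariant modes, totality, spectrum. -/

namespace XrayDisk
noncomputable section BoundaryOperator

variable {κ R : ℝ}

theorem scat_neg (κ R a : ℝ) : scat κ R (-a) = -scat κ R a := by
  simp [scat, Real.tan_neg, Real.arctan_neg]

theorem toCircle_SA (hκ : R ^ 2 * |κ| < 1) (p : S1 × ℝ) (hp : |p.2| < Real.pi / 2) :
    (AddCircle.toCircle (SA κ R p).1 : ℂ)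
      = -((AddCircle.toCircle p.1 : ℂ) * angExp (lamC κ R) p.2 ^ 2) := by
  rw [SA, AddCircle.toCircle_add, Circle.coe_mul, toCircle_coe, ← exp_scat hκ hp, ← Complex.exp_nat_mul]
  push_cast
  rw [add_mul, Complex.exp_add, Complex.exp_pi_mul_I, mul_assoc 2]
  ring

/-- Under 𝒮_A the variable e^{iβ} becomes -e^{iβ}E² and E becomes E⁻¹; so the frequency b is
reflected about a, and the sign is (-1)^a. -/
theorem bdryMode_SA (hκ : R ^ 2 * |κ| < 1) (a b : ℤ) (p : S1 × ℝ) (hp : |p.2| < Real.pi / 2) :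
    bdryMode κ R a b (SA κ R p) = (-1) ^ a * bdryMode κ R a (2 * a - b) p := by
  have hl := lamC_pos hκ
  have hne := angExp_ne_zero hl p.2
  rw [bdryMode, toCircle_SA hκ p hp, bdryMode]
  have h2 : (SA κ R p).2 = -p.2 := rfl
  rw [h2, angDeriv_neg, angExp_neg hl, neg_eq_neg_one_mul, mul_zpow, mul_zpow, zpow_sub₀ hne,
    inv_zpow', zpow_neg, zpow_mul]
  simp only [zpow_ofNat]
  field_simp

/-- The functions `√p e^{iaβ} (E^{a+m} + (-1)^a E^{a-m})`, which are invariant under the antipodal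
scattering relation. -/
def plusMode (κ R : ℝ) (a m : ℤ) (p : S1 × ℝ) : ℂ :=
  bdryMode κ R a (a + m) p + (-1) ^ a * bdryMode κ R a (a - m) p

theorem neg_one_zpow_mul_self (a : ℤ) : ((-1 : ℂ) ^ a) * (-1) ^ a = 1 := by
  rw [← zpow_add₀ (by norm_num), Even.neg_one_zpow ⟨a, rfl⟩]

theorem plusMode_SA (hκ : R ^ 2 * |κ| < 1) (a m : ℤ) (p : S1 × ℝ) (hp : |p.2| < Real.pi / 2) :
    plusMode κ R a m (SA κ R p) = plusMode κ R a m p := by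
  rw [plusMode, bdryMode_SA hκ _ _ p hp, bdryMode_SA hκ _ _ p hp, plusMode,
    show 2 * a - (a + m) = a - m by ring, show 2 * a - (a - m) = a + m by ring, ← mul_assoc,
    neg_one_zpow_mul_self]
  ring

theorem memLp_plusMode (hκ : R ^ 2 * |κ| < 1) (a m : ℤ) :
    MemLp (plusMode κ R a m) 2 (dSigma κ R) :=
  (memLp_bdryMode hκ a (a + m)).add ((memLp_bdryMode hκ a (a - m)).const_mul _)

theorem mem_L2plus_of_invariant {u : Lp ℂ 2 (dSigma κ R)} {v : S1 × ℝ → ℂ}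
    (hu : u =ᵐ[dSigma κ R] v) (hv : ∀ᵐ p ∂(dSigma κ R), v (SA κ R p) = v p) : u ∈ L2plus κ R := by
  change (fun p => u (SA κ R p)) =ᵐ[dSigma κ R] u
  filter_upwards [hu, (measurePreserving_SA κ R).quasiMeasurePreserving.ae hu, hv] with p h1 h2 h3
  rw [h2, h3, h1]

/-- The class of `plusMode` in `L²₊`. -/
def plusLp (hκ : R ^ 2 * |κ| < 1) (a m : ℤ) : L2plus κ R :=
  ⟨(memLp_plusMode hκ a m).toLp, mem_L2plus_of_invariant (memLp_plusMode hκ a m).coeFn_toLp (by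
    filter_upwards [ae_abs_lt_dSigma κ R] with p hp
    exact plusMode_SA hκ a m p hp)⟩

theorem coe_plusLp (hκ : R ^ 2 * |κ| < 1) (a m : ℤ) :
    (plusLp hκ a m : Lp ℂ 2 (dSigma κ R)) = (memLp_bdryMode hκ a (a + m)).toLp +
      ((-1 : ℂ) ^ a) • (memLp_bdryMode hκ a (a - m)).toLp := by
  rw [← MemLp.toLp_const_smul, ← MemLp.toLp_add]
  rfl

theorem OddSmooth.add_const_mul {k k' : ℝ × ℝ → ℂ} (hk : OddSmooth k) (hk' : OddSmooth k') (c c' : ℂ) :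
    OddSmooth fun q => c * k q + c' * k' q := by
  refine ⟨(contDiff_const.mul hk.smooth).add (contDiff_const.mul hk'.smooth), fun x y => ?_,
    fun x y => ?_⟩
  · simp only [hk.periodic, hk'.periodic]
  · simp only [hk.odd, hk'.odd]; ring

theorem flowDeriv_add_const_mul {l : ℝ} {k k' : ℝ × ℝ → ℂ} (hk : OddSmooth k) (hk' : OddSmooth k')
    (c c' : ℂ) (q : ℝ × ℝ) :
    flowDeriv l (fun q => c * k q + c' * k' q) q = c * flowDeriv l k q + c' * flowDeriv l k' q := by
  have h1 := (hk.smooth.differentiable (by simp) q).hasFDerivAt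
  have h2 := (hk'.smooth.differentiable (by simp) q).hasFDerivAt
  have h := ((h1.const_mul c).fun_add (h2.const_mul c')).fderiv
  simp only [flowDeriv, h, add_apply, smul_apply, smul_eq_mul]
  ring

/-- The parity condition makes both exponents a ± m odd, which is oddness in the fibers, since E
changes sign under α ↦ α + π. -/
theorem isSmoothPlus_plusMode (hκ : R ^ 2 * |κ| < 1) {a m : ℤ} (ham : Odd (a + m)) :
    IsSmoothPlus κ R (plusMode κ R a m) := by
  have ham' : Odd (a - m) := by
    have : a - m = (a + m) - 2 * m := by ring
    rw [this]
    exact ham.sub_even (even_two_mul m)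
  have hodd : ∀ (b : ℤ), Odd b → ∀ (c : S1) (y : ℝ),
      bdryMode κ R a b (c, y + Real.pi) = -bdryMode κ R a b (c, y) := by
    intro b hb c y
    simp only [bdryMode, angDeriv_add_pi, angExp_add_pi_zpow hb]
    ring
  refine ⟨?_, ?_, ?_⟩
  · exact (contDiff_bdryMode hκ a (a + m)).add (contDiff_const.mul (contDiff_bdryMode hκ a (a - m)))
  · intro c y
    simp only [plusMode, hodd _ ham, hodd _ ham']
    ring
  · intro c y hy
    exact plusMode_SA hκ a m (c, y) hy

theorem Tfun_Tfun_plusMode (hκ : R ^ 2 * |κ| < 1) {a m : ℤ} (ham : Odd (a + m)) (p : S1 × ℝ)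
    (hp : |p.2| < Real.pi / 2) :
    -Tfun κ R (Tfun κ R (plusMode κ R a m)) p = (m : ℂ) ^ 2 * plusMode κ R a m p := by
  have hl := lamC_pos hκ
  have ham' : Odd (a - m) := by
    have : a - m = (a + m) - 2 * m := by ring
    rw [this]
    exact ham.sub_even (even_two_mul m)
  have h1 := oddSmooth_torusMode hl a ham
  have h2 := oddSmooth_torusMode hl a ham'
  have hk : ∀ c c' : ℂ, flowDeriv (lamC κ R) (fun q => c * torusMode (lamC κ R) a (a + m) q +
      c' * torusMode (lamC κ R) a (a - m) q) = fun q =>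
      (c * (-Complex.I * m)) * torusMode (lamC κ R) a (a + m) q +
      (c' * (Complex.I * m)) * torusMode (lamC κ R) a (a - m) q := by
    intro c c'
    funext q
    rw [flowDeriv_add_const_mul h1 h2, flowDeriv_torusMode hl a ham, flowDeriv_torusMode hl a ham']
    push_cast
    ring
  have hv : ∀ x y : ℝ, |y| < Real.pi / 2 → plusMode κ R a m ((x : S1), y)
      = (Real.sqrt (angDeriv (lamC κ R) y) : ℂ) * (fun q => 1 * torusMode (lamC κ R) a (a + m) q +
      (-1) ^ a * torusMode (lamC κ R) a (a - m) q) (x, y) := by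
    intro x y _
    simp only [plusMode, bdryMode_coe]
    ring
  have hT := Tfun_eq hκ (h1.add_const_mul h2 1 ((-1) ^ a)) hv
  rw [hk] at hT
  have hT2 := Tfun_eq hκ (h1.add_const_mul h2 _ _) hT
  rw [hk] at hT2
  obtain ⟨b, y⟩ := p
  obtain ⟨x, rfl⟩ := QuotientAddGroup.mk_surjective b
  rw [show (QuotientAddGroup.mk x : S1) = (x : S1) from rfl, hT2 x y hp, hv x y hp]
  linear_combination (-(Real.sqrt (angDeriv (lamC κ R) y) : ℂ) * m ^ 2 *
    (torusMode (lamC κ R) a (a + m) (x, y) + (-1) ^ a * torusMode (lamC κ R) a (a - m) (x, y))) *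
    Complex.I_sq

/-- The index set of the eigenfunctions of `-T²`. -/
abbrev PlusIndex : Type := {q : ℤ × ℤ // Odd (q.1 + q.2) ∧ q.2 ≠ 0}

theorem plusLp_mem_core (hκ : R ^ 2 * |κ| < 1) {a m : ℤ} (ham : Odd (a + m)) :
    ∃ v : S1 × ℝ → ℂ, IsSmoothPlus κ R v ∧
    (plusLp hκ a m : Lp ℂ 2 (dSigma κ R)) =ᵐ[dSigma κ R] v ∧
    (((((m : ℝ) ^ 2 : ℝ) : ℂ) • plusLp hκ a m : L2plus κ R) : Lp ℂ 2 (dSigma κ R)) =ᵐ[dSigma κ R]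
      fun q => -Tfun κ R (Tfun κ R v) q := by
  refine ⟨plusMode κ R a m, isSmoothPlus_plusMode hκ ham, (memLp_plusMode hκ a m).coeFn_toLp, ?_⟩
  rw [Submodule.coe_smul]
  filter_upwards [ae_abs_lt_dSigma κ R, (memLp_plusMode hκ a m).coeFn_toLp,
    Lp.coeFn_smul (((m : ℝ) ^ 2 : ℝ) : ℂ) (plusLp hκ a m : Lp ℂ 2 (dSigma κ R))] with p hp h1 h2
  rw [Tfun_Tfun_plusMode hκ ham p hp, h2, Pi.smul_apply, smul_eq_mul]
  have h3 : (plusLp hκ a m : Lp ℂ 2 (dSigma κ R)) p = plusMode κ R a m p := h1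
  rw [h3]
  push_cast
  rfl

theorem inner_plusLp (hκ : R ^ 2 * |κ| < 1) (a m : ℤ) (u : L2plus κ R) :
    ⟪plusLp hκ a m, u⟫_ℂ = ⟪(memLp_bdryMode hκ a (a + m)).toLp, (u : Lp ℂ 2 (dSigma κ R))⟫_ℂ
      + (-1) ^ a * ⟪(memLp_bdryMode hκ a (a - m)).toLp, (u : Lp ℂ 2 (dSigma κ R))⟫_ℂ := by
  rw [Submodule.coe_inner, coe_plusLp, inner_add_left, inner_smul_left, map_zpow₀]
  simp

theorem integral_comp_SA {F : S1 × ℝ → ℂ} (hF : AEStronglyMeasurable F (dSigma κ R)) :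
    ∫ p, F p ∂(dSigma κ R) = ∫ p, F (SA κ R p) ∂(dSigma κ R) := by
  have hmp := measurePreserving_SA κ R
  conv_lhs => rw [← hmp.map_eq]
  exact integral_map hmp.measurable.aemeasurable (by rw [hmp.map_eq]; exact hF)

/-- Change variables by 𝒮_A, which preserves the measure and fixes u, and reflect the mode with
`bdryMode_SA`. -/
theorem inner_bdryMode_reflect (hκ : R ^ 2 * |κ| < 1) (a b : ℤ) (u : L2plus κ R) :
    ⟪(memLp_bdryMode hκ a b).toLp, (u : Lp ℂ 2 (dSigma κ R))⟫_ℂ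
      = (-1) ^ a * ⟪(memLp_bdryMode hκ a (2 * a - b)).toLp, (u : Lp ℂ 2 (dSigma κ R))⟫_ℂ := by
  have hu : (fun p => (u : Lp ℂ 2 (dSigma κ R)) (SA κ R p)) =ᵐ[dSigma κ R]
    (u : Lp ℂ 2 (dSigma κ R)) := u.2
  rw [inner_Lp_eq (memLp_bdryMode hκ a b).coeFn_toLp (ae_eq_refl _),
    inner_Lp_eq (memLp_bdryMode hκ a (2 * a - b)).coeFn_toLp (ae_eq_refl _),
    ← integral_const_mul]
  have hsm : AEStronglyMeasurable (fun p => conj (bdryMode κ R a b p) *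
      (u : Lp ℂ 2 (dSigma κ R)) p) (dSigma κ R) :=
    (Complex.continuous_conj.comp (continuous_bdryMode hκ a b)).aestronglyMeasurable.mul
      (Lp.aestronglyMeasurable _)
  rw [integral_comp_SA hsm]
  refine integral_congr_ae ?_
  filter_upwards [hu, ae_abs_lt_dSigma κ R] with p h1 hp
  rw [h1, bdryMode_SA hκ a b p hp, map_mul, map_zpow₀]
  simp
  ring

/-- On the unit circle the conjugate of z is z⁻¹, so multiplication by a real linear functional of z
shifts Fourier frequencies by ±1. -/
theorem strongDual_complex_apply (L : StrongDual ℝ ℂ) (z : ℂ) :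
    ((L z : ℝ) : ℂ) = ((L 1 - L Complex.I * Complex.I) / 2) * z
      + ((L 1 + L Complex.I * Complex.I) / 2) * conj z := by
  have h : L z = z.re * L 1 + z.im * L Complex.I := by
    conv_lhs => rw [← Complex.re_add_im z]
    have : (z.re : ℂ) + z.im * Complex.I = z.re • (1 : ℂ) + z.im • Complex.I := by simp
    rw [this, map_add, map_smul, map_smul, smul_eq_mul, smul_eq_mul]
  rw [h]
  push_cast
  rw [Complex.re_eq_add_conj, Complex.im_eq_sub_conj]
  field_simp
  linear_combination ((L Complex.I : ℂ) * (z - conj z)) * Complex.I_sq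

/-- The modes with odd second frequency form a total family. -/
theorem eq_zero_of_inner_bdryMode (hκ : R ^ 2 * |κ| < 1) {u : Lp ℂ 2 (dSigma κ R)}
    (h : ∀ a b : ℤ, Odd b → ⟪(memLp_bdryMode hκ a b).toLp, u⟫_ℂ = 0) : u = 0 := by
  have hl := lamC_pos hκ
  let s : S1 × ℝ → ℂ := fun p => (Real.sqrt (angDeriv (lamC κ R) p.2) : ℂ)
  let z1 : S1 × ℝ → ℂ := fun p => (AddCircle.toCircle p.1 : ℂ)
  let z2 : S1 × ℝ → ℂ := fun p => angExp (lamC κ R) p.2 ^ 2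
  -- Multiplying u by √p E converts odd frequencies in E into even ones, so the hypothesis controls
  -- all integer powers of e^{iβ} and of E² against G.
  let G : S1 × ℝ → ℂ := fun p => bdryMode κ R 0 1 p * u p
  have hui : Integrable u (dSigma κ R) := (Lp.memLp u).integrable (by norm_num)
  have hc1 : Continuous z1 := continuous_of_lift (by
    simp only [z1, toCircle_coe]; fun_prop)
  have hEc := (contDiff_angExp hl).continuous
  have hc2 : Continuous z2 := by fun_prop
  have hn1 : ∀ p, ‖z1 p‖ = 1 := fun p => Circle.norm_coe _
  have hn2 : ∀ p, ‖z2 p‖ = 1 := fun p => by simp only [z2, norm_pow, norm_angExp hl, one_pow]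
  have hz1 : ∀ p, z1 p ≠ 0 := fun p => by rw [← norm_ne_zero_iff, hn1]; norm_num
  have hz2 : ∀ p, z2 p ≠ 0 := fun p => by rw [← norm_ne_zero_iff, hn2]; norm_num
  have hconj : ∀ z : ℂ, ‖z‖ = 1 → conj z = z⁻¹ := fun z hz => by
    rw [Complex.inv_def, Complex.normSq_eq_norm_sq, hz]; simp
  obtain ⟨C, hC⟩ := exists_bound_sqrt_angDeriv hl
  have hGi : Integrable G (dSigma κ R) :=
    Integrable.bdd_mul (c := C) hui (continuous_bdryMode hκ 0 1).aestronglyMeasurable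
      (Filter.Eventually.of_forall fun p => by rw [norm_bdryMode hκ]; exact hC _)
  let q : S1 × ℝ → ℂ × ℂ := fun p => (z1 p, z2 p)
  -- A left inverse of q almost everywhere: E² = e^{2i𝔰} with 2𝔰 in (-π, π), so its argument is 2𝔰
  -- exactly, and α is recovered from tan 𝔰.
  let r : ℂ × ℂ → S1 × ℝ := fun w =>
    ((w.1.arg : S1), Real.arctan (Real.tan (w.2.arg / 2) / lamC κ R))
  have hr : Measurable r := by
    have htan : Measurable Real.tan := by
      have h : Real.tan = fun x => Real.sin x / Real.cos x := by
        funext x; exact Real.tan_eq_sin_div_cos x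
      rw [h]
      exact Real.measurable_sin.div Real.measurable_cos
    refine Measurable.prodMk ?_ ?_
    · exact AddCircle.measurable_mk'.comp (Complex.measurable_arg.comp measurable_fst)
    · exact Real.measurable_arctan.comp ((htan.comp
        ((Complex.measurable_arg.comp measurable_snd).div_const 2)).div_const _)
  have hrq : ∀ᵐ p ∂(dSigma κ R), r (q p) = p := by
    filter_upwards [ae_abs_lt_dSigma κ R] with p hp
    obtain ⟨hp1, hp2⟩ := abs_lt.1 hp
    refine Prod.ext ?_ ?_
    · obtain ⟨b, y⟩ := p
      obtain ⟨x, rfl⟩ := QuotientAddGroup.mk_surjective b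
      change (((AddCircle.toCircle (x : S1) : ℂ).arg : ℝ) : S1) = (x : S1)
      rw [toCircle_coe, Complex.arg_exp_mul_I]
      rw [toIocMod, AddCircle.coe_sub, AddCircle.coe_zsmul, AddCircle.coe_period, smul_zero, sub_zero]
    · change Real.arctan (Real.tan ((angExp (lamC κ R) p.2 ^ 2).arg / 2) / lamC κ R) = p.2
      rw [← exp_scat hκ hp, ← Complex.exp_nat_mul]
      have h1 := Real.neg_pi_div_two_lt_arctan (lamC κ R * Real.tan p.2)
      have h2 := Real.arctan_lt_pi_div_two (lamC κ R * Real.tan p.2)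
      have h3 : (((2 : ℕ) : ℂ) * ((scat κ R p.2 : ℝ) * Complex.I))
          = ((2 * scat κ R p.2 : ℝ) : ℂ) * Complex.I := by push_cast; ring
      rw [h3, Complex.arg_exp_mul_I, (toIocMod_eq_self Real.two_pi_pos).2]
      · rw [mul_div_cancel_left₀ _ two_ne_zero]
        change Real.arctan (Real.tan (Real.arctan (lamC κ R * Real.tan p.2)) / lamC κ R) = p.2
        rw [Real.tan_arctan, mul_div_cancel_left₀ _ hl.ne', Real.arctan_tan hp1 hp2]
      · change _ < 2 * Real.arctan (lamC κ R * Real.tan p.2) ∧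
          2 * Real.arctan (lamC κ R * Real.tan p.2) ≤ _
        constructor <;> linarith
  have hmode : ∀ a j : ℤ, ∫ p, z1 p ^ a * z2 p ^ j * G p ∂(dSigma κ R) = 0 := by
    intro a j
    have h0 := h (-a) (-(2 * j + 1)) (Odd.neg ⟨j, rfl⟩)
    rw [inner_Lp_eq (memLp_bdryMode hκ _ _).coeFn_toLp (ae_eq_refl _)] at h0
    rw [← h0]
    refine integral_congr_ae (Filter.Eventually.of_forall fun p => ?_)
    have e2 : angExp (lamC κ R) p.2 ^ (2 * j + 1) = z2 p ^ j * angExp (lamC κ R) p.2 := by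
      rw [zpow_add_one₀ (angExp_ne_zero hl _), zpow_mul]
      rfl
    simp only [G, bdryMode, map_mul, map_zpow₀, Complex.conj_ofReal, zpow_zero, zpow_one, one_mul]
    rw [hconj _ (hn1 p), hconj _ (norm_angExp hl p.2), inv_zpow', neg_neg, inv_zpow', neg_neg, e2]
    ring
  have hint : ∀ (a j : ℤ) (g : S1 × ℝ → ℂ), Continuous g → (∃ D, ∀ p, ‖g p‖ ≤ D) →
      Integrable (fun p => g p * (z1 p ^ a * z2 p ^ j * G p)) (dSigma κ R) := by
    rintro a j g hg ⟨D, hD⟩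
    have hcz : Continuous fun p => g p * (z1 p ^ a * z2 p ^ j) :=
      hg.mul ((hc1.zpow₀ a fun p => Or.inl (hz1 p)).mul (hc2.zpow₀ j fun p => Or.inl (hz2 p)))
    refine (Integrable.bdd_mul (c := D) hGi hcz.aestronglyMeasurable
      (Filter.Eventually.of_forall fun p => ?_)).congr (Filter.Eventually.of_forall fun p => ?_)
    · simp only [norm_mul, norm_zpow, hn1, hn2, one_zpow, mul_one]
      exact hD p
    · simp only; ring
  -- The frequencies a, j are kept free in the induction on n, because each further factor L(q)
  -- shifts one of them by ±1.
  have hmom : ∀ (L : StrongDual ℝ (ℂ × ℂ)) (n : ℕ) (a j : ℤ),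
      ∫ p, ((L (q p) : ℝ) : ℂ) ^ n * (z1 p ^ a * z2 p ^ j * G p) ∂(dSigma κ R) = 0 := by
    intro L n
    let L1 : StrongDual ℝ ℂ := L.comp (ContinuousLinearMap.inl ℝ ℂ ℂ)
    let L2 : StrongDual ℝ ℂ := L.comp (ContinuousLinearMap.inr ℝ ℂ ℂ)
    have hL : ∀ p, ((L (q p) : ℝ) : ℂ)
        = ((L1 1 - L1 Complex.I * Complex.I) / 2) * z1 p
        + ((L1 1 + L1 Complex.I * Complex.I) / 2) * (z1 p)⁻¹
        + (((L2 1 - L2 Complex.I * Complex.I) / 2) * z2 p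
        + ((L2 1 + L2 Complex.I * Complex.I) / 2) * (z2 p)⁻¹) := by
      intro p
      rw [← hconj _ (hn1 p), ← hconj _ (hn2 p), ← strongDual_complex_apply,
        ← strongDual_complex_apply, ← Complex.ofReal_add]
      congr 1
      change L (z1 p, z2 p) = L (z1 p, 0) + L (0, z2 p)
      rw [← map_add]
      simp
    have hLc : Continuous fun p => ((L (q p) : ℝ) : ℂ) := by fun_prop
    have hLb : ∀ n : ℕ, ∃ D, ∀ p, ‖((L (q p) : ℝ) : ℂ) ^ n‖ ≤ D := by
      intro n
      refine ⟨‖L‖ ^ n, fun p => ?_⟩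
      rw [norm_pow, Complex.norm_real]
      have : ‖q p‖ ≤ 1 := by simp only [q, Prod.norm_mk, hn1, hn2, max_self, le_refl]
      gcongr
      exact (L.le_opNorm _).trans (mul_le_of_le_one_right (norm_nonneg _) this)
    induction n with
    | zero => intro a j; simpa using hmode a j
    | succ n ih =>
      intro a j
      have hi : ∀ (c : ℂ) (a j : ℤ), Integrable
          (fun p => c * (((L (q p) : ℝ) : ℂ) ^ n * (z1 p ^ a * z2 p ^ j * G p))) (dSigma κ R) :=
        fun c a j => (hint a j _ (hLc.pow n) (hLb n)).const_mul c
      have e : ∀ p, ((L (q p) : ℝ) : ℂ) ^ (n + 1) * (z1 p ^ a * z2 p ^ j * G p)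
          = ((L1 1 - L1 Complex.I * Complex.I) / 2) *
              (((L (q p) : ℝ) : ℂ) ^ n * (z1 p ^ (a + 1) * z2 p ^ j * G p))
            + ((L1 1 + L1 Complex.I * Complex.I) / 2) *
              (((L (q p) : ℝ) : ℂ) ^ n * (z1 p ^ (a - 1) * z2 p ^ j * G p))
            + (((L2 1 - L2 Complex.I * Complex.I) / 2) *
              (((L (q p) : ℝ) : ℂ) ^ n * (z1 p ^ a * z2 p ^ (j + 1) * G p))
            + ((L2 1 + L2 Complex.I * Complex.I) / 2) *
              (((L (q p) : ℝ) : ℂ) ^ n * (z1 p ^ a * z2 p ^ (j - 1) * G p))) := by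
        intro p
        rw [pow_succ, hL p, zpow_add_one₀ (hz1 p), zpow_sub_one₀ (hz1 p), zpow_add_one₀ (hz2 p),
          zpow_sub_one₀ (hz2 p)]
        ring
      simp only [e]
      rw [integral_add ((hi _ _ _).fun_add (hi _ _ _)) ((hi _ _ _).fun_add (hi _ _ _)),
        integral_add (hi _ _ _) (hi _ _ _), integral_add (hi _ _ _) (hi _ _ _)]
      simp only [integral_const_mul, ih, mul_zero, add_zero]
  have hG0 : G =ᵐ[dSigma κ R] 0 := by
    refine ae_eq_zero_of_moments (q := q) (hc1.prodMk hc2).measurable hr hrq (C := 1)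
      (Filter.Eventually.of_forall fun p => ?_) hGi fun L n => ?_
    · simp only [q, Prod.norm_mk, hn1, hn2, max_self, le_refl]
    · simpa using hmom L n 0 0
  refine Lp.ext ?_
  filter_upwards [hG0, Lp.coeFn_zero ℂ 2 (dSigma κ R)] with p h1 h2
  rw [h2]
  have h3 : bdryMode κ R 0 1 p ≠ 0 := by
    rw [← norm_ne_zero_iff, norm_bdryMode hκ]
    exact (Real.sqrt_pos.2 (angDeriv_pos hl p.2)).ne'
  exact (mul_eq_zero.1 h1).resolve_left h3

/-- For an invariant u the coefficients at b and 2a - b agree up to (-1)^a, so orthogonality to the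
symmetrized mode kills each of the two. When b = a, which is odd, the relation forces the
coefficient to equal its negative; hence m = 0 is not needed, and zero is not an eigenvalue. -/
theorem plusLp_total (hκ : R ^ 2 * |κ| < 1) :
    (Submodule.span ℂ (range fun i : PlusIndex => plusLp hκ i.1.1 i.1.2)).topologicalClosure = ⊤ := by
  refine total_of_forall_inner_eq_zero fun u hu => ?_
  have h : (u : Lp ℂ 2 (dSigma κ R)) = 0 := by
    refine eq_zero_of_inner_bdryMode hκ fun a b hb => ?_
    have hr := inner_bdryMode_reflect hκ a b u
    by_cases hab : b = a
    · subst hab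
      rw [hb.neg_one_zpow, show 2 * b - b = b by ring] at hr
      linear_combination (1 / 2) * hr
    · have h1 := hu ⟨(a, b - a), by simpa using hb, by simpa [sub_eq_zero] using hab⟩
      simp only [inner_plusLp] at h1
      rw [show a - (b - a) = 2 * a - b by ring, ← hr] at h1
      simp only [add_sub_cancel] at h1
      linear_combination (1 / 2) * h1
  exact_mod_cast h

theorem core_subset_diagGraph (hR : 0 < R) (hκ : R ^ 2 * |κ| < 1) :
    {p : L2plus κ R × L2plus κ R | ∃ v : S1 × ℝ → ℂ, IsSmoothPlus κ R v ∧
    (p.1 : Lp ℂ 2 (dSigma κ R)) =ᵐ[dSigma κ R] v ∧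
    (p.2 : Lp ℂ 2 (dSigma κ R)) =ᵐ[dSigma κ R] fun q => -Tfun κ R (Tfun κ R v) q}
      ⊆ diagGraph (fun i : PlusIndex => plusLp hκ i.1.1 i.1.2) fun i => (i.1.2 : ℝ) ^ 2 := by
  rintro p ⟨v, hv, h1, h2⟩ ⟨⟨a, m⟩, ham, -⟩
  simp only at ham
  have ham' : Odd (a - m) := by
    have : a - m = (a + m) - 2 * m := by ring
    rw [this]
    exact ham.sub_even (even_two_mul m)
  simp only [inner_plusLp]
  rw [inner_bdryMode_core hR hκ a ham hv h1 h2, inner_bdryMode_core hR hκ a ham' hv h1 h2]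
  push_cast
  ring

theorem isPositivePurePoint_opNegTsq (hR : 0 < R) (hκ : R ^ 2 * |κ| < 1) :
    IsPositivePurePoint (opNegTsq κ R) :=
  isPositivePurePoint_closureOfCore (plusLp_total hκ)
    (fun i => plusLp_mem_core hκ i.2.1) (core_subset_diagGraph hR hκ)
    fun i => by
      have : (i.1.2 : ℝ) ≠ 0 := by exact_mod_cast i.2.2
      positivity

theorem plusLp_mem_eigenspace (hκ : R ^ 2 * |κ| < 1) (hR : 0 < R) {a m : ℤ} (ham : Odd (a + m)) :
    plusLp hκ a m ∈ eigenspace (opNegTsq κ R) ((m : ℝ) ^ 2) := by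
  rw [mem_eigenspace, opNegTsq, closureOfCore_graph (plusLp_total hκ)
    (fun i => plusLp_mem_core hκ i.2.1) (core_subset_diagGraph hR hκ)]
  exact core_subset_diagGraph hR hκ (plusLp_mem_core hκ ham)

/-- For m ≠ 0 the exponents a + m and a - m are distinct, so the cross terms vanish and the two
remaining terms are equal. -/
theorem inner_plusLp_plusLp (hR : 0 < R) (hκ : R ^ 2 * |κ| < 1) (a a' : ℤ) {m : ℤ} (hm : m ≠ 0)
    (ham : Odd (a + m)) (ham' : Odd (a' + m)) :
    ⟪plusLp hκ a m, plusLp hκ a' m⟫_ℂ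
      = if a = a' then ((R / (1 + κ * R ^ 2) * (4 * Real.pi ^ 2) : ℝ) : ℂ) else 0 := by
  have hE : ∀ b b' : ℤ, Odd b → Odd b' → Even (b' - b) := fun b b' hb hb' => hb'.sub_odd hb
  have h1 : Odd (a - m) := by
    have : a - m = (a + m) - 2 * m := by ring
    rw [this]; exact ham.sub_even (even_two_mul m)
  have h2 : Odd (a' - m) := by
    have : a' - m = (a' + m) - 2 * m := by ring
    rw [this]; exact ham'.sub_even (even_two_mul m)
  rw [inner_plusLp, coe_plusLp, inner_add_right, inner_add_right, inner_smul_right, inner_smul_right,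
    inner_bdryMode_bdryMode hR hκ _ _ (hE _ _ ham ham'),
    inner_bdryMode_bdryMode hR hκ _ _ (hE _ _ ham h2),
    inner_bdryMode_bdryMode hR hκ _ _ (hE _ _ h1 ham'),
    inner_bdryMode_bdryMode hR hκ _ _ (hE _ _ h1 h2)]
  by_cases h : a = a'
  · subst h
    have e1 : ¬(a + m = a - m) := fun h => hm (by omega)
    have e2 : ¬(a - m = a + m) := fun h => hm (by omega)
    simp only [e1, e2, and_self, and_false, if_true, if_false]
    have := neg_one_zpow_mul_self a
    push_cast
    linear_combination ((R : ℂ) / (1 + κ * R ^ 2) * (2 * Real.pi ^ 2)) * this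
  · simp [h]

end BoundaryOperator
end XrayDisk

/-! ### The degenerate operator on the unit disk: Green's formula and Chebyshev ridges. -/

namespace XrayDisk
noncomputable section UnitDisk

/-- A function on the closed unit disk with continuous first and second derivatives. -/
structure DiskJet (h : ℂ → ℂ) (h1 : ℂ → ℂ →L[ℝ] ℂ) (h2 : ℂ → ℂ →L[ℝ] ℂ →L[ℝ] ℂ) : Prop where
  cont : ContinuousOn h (Metric.closedBall 0 1)
  cont_fst : ContinuousOn h1 (Metric.closedBall 0 1)
  cont_snd : ContinuousOn h2 (Metric.closedBall 0 1)
  deriv_fst : ∀ z, ‖z‖ < 1 → HasFDerivAt h (h1 z) z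
  deriv_snd : ∀ z, ‖z‖ < 1 → HasFDerivAt h1 (h2 z) z

variable {h e : ℂ → ℂ} {h1 e1 : ℂ → ℂ →L[ℝ] ℂ} {h2 e2 : ℂ → ℂ →L[ℝ] ℂ →L[ℝ] ℂ}

/-- The derivatives within the closed disk are continuous up to the boundary and are ordinary
derivatives inside. This is all the regularity that Green's formula requires. -/
theorem exists_diskJet (hh : ContDiffOn ℝ ∞ h (Metric.closedBall 0 1)) :
    ∃ h1 h2, DiskJet h h1 h2 := by
  have hu : UniqueDiffOn ℝ (Metric.closedBall (0 : ℂ) 1) :=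
    uniqueDiffOn_convex (convex_closedBall 0 1) (by
      rw [interior_closedBall _ one_ne_zero]; exact Metric.nonempty_ball.2 one_pos)
  have hmem : ∀ z : ℂ, ‖z‖ < 1 → Metric.closedBall (0 : ℂ) 1 ∈ nhds z := fun z hz =>
    Filter.mem_of_superset (Metric.isOpen_ball.mem_nhds (by simpa using hz)) Metric.ball_subset_closedBall
  have hc1 : ContDiffOn ℝ ∞ (fderivWithin ℝ h (Metric.closedBall 0 1)) (Metric.closedBall 0 1) :=
    hh.fderivWithin hu (by simp)
  have hc2 : ContDiffOn ℝ ∞ (fderivWithin ℝ (fderivWithin ℝ h (Metric.closedBall 0 1))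
    (Metric.closedBall 0 1)) (Metric.closedBall 0 1) := hc1.fderivWithin hu (by simp)
  refine ⟨_, _, hh.continuousOn, hc1.continuousOn, hc2.continuousOn, fun z hz => ?_, fun z hz => ?_⟩
  · exact ((hh.differentiableOn (by simp)) z (mem_of_mem_nhds (hmem z hz))).hasFDerivWithinAt.hasFDerivAt
      (hmem z hz)
  · exact ((hc1.differentiableOn (by simp)) z (mem_of_mem_nhds (hmem z hz))).hasFDerivWithinAt.hasFDerivAt
      (hmem z hz)

theorem DiskJet.congr (hh : DiskJet h h1 h2) (he : EqOn e h (Metric.closedBall 0 1)) :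
    DiskJet e h1 h2 where
  cont := hh.cont.congr he
  cont_fst := hh.cont_fst
  cont_snd := hh.cont_snd
  deriv_fst := fun z hz => (hh.deriv_fst z hz).congr_of_eventuallyEq
    ((he.mono Metric.ball_subset_closedBall).eventuallyEq_of_mem
      (Metric.isOpen_ball.mem_nhds (by simpa using hz)))
  deriv_snd := hh.deriv_snd

theorem norm_ofReal_mul_unit {c : ℂ} (hc : ‖c‖ = 1) (r : ℝ) : ‖(r : ℂ) * c‖ = |r| := by
  rw [norm_mul, hc, mul_one, Complex.norm_real, Real.norm_eq_abs]

theorem DiskJet.hasDerivAt_radial (hh : DiskJet h h1 h2) {c : ℂ} (hc : ‖c‖ = 1) {r : ℝ}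
    (hr : |r| < 1) : HasDerivAt (fun r : ℝ => h (r * c)) (h1 (r * c) c) r := by
  have h0 : HasDerivAt (fun r : ℝ => (r : ℂ) * c) (1 * c) r :=
    (Complex.ofRealCLM.hasDerivAt (x := r)).mul_const c
  rw [one_mul] at h0
  exact (hh.deriv_fst _ (by rwa [norm_ofReal_mul_unit hc])).comp_hasDerivAt r h0

theorem DiskJet.hasDerivAt_radial_fst (hh : DiskJet h h1 h2) {c : ℂ} (hc : ‖c‖ = 1) {r : ℝ}
    (hr : |r| < 1) (v : ℂ) :
    HasDerivAt (fun r : ℝ => h1 (r * c) v) (h2 (r * c) c v) r := by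
  have h0 : HasDerivAt (fun r : ℝ => (r : ℂ) * c) (1 * c) r :=
    (Complex.ofRealCLM.hasDerivAt (x := r)).mul_const c
  rw [one_mul] at h0
  have h3 := (hh.deriv_snd _ (by rwa [norm_ofReal_mul_unit hc])).comp_hasDerivAt r h0
  simpa using h3.clm_apply (hasDerivAt_const r v)

theorem hasDerivAt_exp_mul_I (t : ℝ) : HasDerivAt (fun t : ℝ => Complex.exp (t * Complex.I))
    (Complex.I * Complex.exp (t * Complex.I)) t := by
  have h := ((Complex.ofRealCLM.hasDerivAt (x := t)).mul_const Complex.I).cexp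
  refine h.congr_deriv ?_
  simp only [Complex.ofRealCLM_apply, Complex.ofReal_one]
  ring

theorem clm_ofReal_mul {E : Type*} [NormedAddCommGroup E] [NormedSpace ℝ E] (L : ℂ →L[ℝ] E)
    (r : ℝ) (v : ℂ) : L ((r : ℂ) * v) = r • L v := by
  rw [← Complex.real_smul, map_smul]

theorem DiskJet.hasDerivAt_angular (hh : DiskJet h h1 h2) {r : ℝ} (hr : |r| < 1) (t : ℝ) :
    HasDerivAt (fun t : ℝ => h (r * Complex.exp (t * Complex.I)))
      (r * h1 (r * Complex.exp (t * Complex.I)) (Complex.I * Complex.exp (t * Complex.I))) t := by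
  have h0 := (hasDerivAt_exp_mul_I t).const_mul (r : ℂ)
  have h3 := (hh.deriv_fst _ (by
    rwa [norm_ofReal_mul_unit (Complex.norm_exp_ofReal_mul_I t)])).comp_hasDerivAt t h0
  refine h3.congr_deriv ?_
  rw [clm_ofReal_mul, Complex.real_smul]

theorem DiskJet.hasDerivAt_angular_fst (hh : DiskJet h h1 h2) {r : ℝ} (hr : |r| < 1) (t : ℝ) :
    HasDerivAt (fun t : ℝ => h1 (r * Complex.exp (t * Complex.I))
        (Complex.I * Complex.exp (t * Complex.I)))
      (r * h2 (r * Complex.exp (t * Complex.I)) (Complex.I * Complex.exp (t * Complex.I))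
          (Complex.I * Complex.exp (t * Complex.I))
        - h1 (r * Complex.exp (t * Complex.I)) (Complex.exp (t * Complex.I))) t := by
  have h0 := (hasDerivAt_exp_mul_I t).const_mul (r : ℂ)
  have h3 := (hh.deriv_snd _ (by
    rwa [norm_ofReal_mul_unit (Complex.norm_exp_ofReal_mul_I t)])).comp_hasDerivAt t h0
  have h4 := h3.clm_apply ((hasDerivAt_exp_mul_I t).const_mul Complex.I)
  refine h4.congr_deriv ?_
  simp only [Function.comp_apply]
  rw [← mul_assoc Complex.I, Complex.I_mul_I, neg_one_mul, map_neg, sub_eq_add_neg,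
    clm_ofReal_mul, smul_apply, Complex.real_smul]

/-- The operator `Leuclid`, through the first two derivatives. -/
def diskOp (h : ℂ → ℂ) (h1 : ℂ → ℂ →L[ℝ] ℂ) (h2 : ℂ → ℂ →L[ℝ] ℂ →L[ℝ] ℂ) (r : ℝ) (c : ℂ) : ℂ :=
  h (r * c) - ((1 - r ^ 2 : ℝ) : ℂ) * h2 (r * c) c c + 3 * r * h1 (r * c) c
    - h2 (r * c) (Complex.I * c) (Complex.I * c)

/-- The second angular derivative is r² h2(ic, ic) - r h1(c); after division by r² its first-order
part cancels the radial term (1/r)∂_r, so the polar singularity at the centre disappears. -/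
theorem DiskJet.Leuclid_eq (hh : DiskJet h h1 h2) {z : ℂ} (hz0 : z ≠ 0) (hz : ‖z‖ < 1) :
    Leuclid h z = diskOp h h1 h2 ‖z‖ (Complex.exp (z.arg * Complex.I)) := by
  have hr : |‖z‖| < 1 := by rwa [abs_norm]
  have hc := Complex.norm_exp_ofReal_mul_I z.arg
  have hpos : (‖z‖ : ℂ) ≠ 0 := by exact_mod_cast norm_ne_zero_iff.2 hz0
  have d2 : iteratedDeriv 2 (fun r : ℝ => h (r * Complex.exp (z.arg * Complex.I))) ‖z‖
      = h2 (‖z‖ * Complex.exp (z.arg * Complex.I)) (Complex.exp (z.arg * Complex.I))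
        (Complex.exp (z.arg * Complex.I)) := by
    rw [iteratedDeriv_succ, iteratedDeriv_one]
    have : deriv (fun r : ℝ => h (r * Complex.exp (z.arg * Complex.I))) =ᶠ[nhds ‖z‖]
        fun r : ℝ => h1 (r * Complex.exp (z.arg * Complex.I)) (Complex.exp (z.arg * Complex.I)) := by
      filter_upwards [eventually_abs_lt hr] with r hr
      exact (hh.hasDerivAt_radial hc hr).deriv
    rw [this.deriv_eq, (hh.hasDerivAt_radial_fst hc hr _).deriv]
  have d3 : iteratedDeriv 2 (fun t : ℝ => h ((‖z‖ : ℝ) * Complex.exp (t * Complex.I))) z.arg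
      = ‖z‖ * (‖z‖ * h2 (‖z‖ * Complex.exp (z.arg * Complex.I))
          (Complex.I * Complex.exp (z.arg * Complex.I)) (Complex.I * Complex.exp (z.arg * Complex.I))
        - h1 (‖z‖ * Complex.exp (z.arg * Complex.I)) (Complex.exp (z.arg * Complex.I))) := by
    rw [iteratedDeriv_succ, iteratedDeriv_one]
    have : deriv (fun t : ℝ => h ((‖z‖ : ℝ) * Complex.exp (t * Complex.I))) = fun t : ℝ =>
        (‖z‖ : ℂ) * h1 (‖z‖ * Complex.exp (t * Complex.I)) (Complex.I * Complex.exp (t * Complex.I)) := by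
      funext t
      exact (hh.hasDerivAt_angular hr t).deriv
    rw [this, ((hh.hasDerivAt_angular_fst hr z.arg).const_mul _).deriv]
  simp only [Leuclid]
  rw [d2, d3, (hh.hasDerivAt_radial hc hr).deriv, diskOp]
  conv_lhs => enter [1]; rw [← Complex.norm_mul_exp_arg_mul_I z]
  push_cast
  field_simp
  ring

theorem integral_disk_polar (F : ℂ → ℂ) :
    ∫ z in Metric.closedBall 0 1, F z
      = ∫ p in Icc (0 : ℝ) 1 ×ˢ Icc (-Real.pi) Real.pi,
          (p.1 : ℂ) * F (p.1 * Complex.exp (p.2 * Complex.I)) := by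
  rw [← integral_indicator Metric.isClosed_closedBall.measurableSet,
    ← Complex.integral_comp_polarCoord_symm]
  have hset : (Ioc (0 : ℝ) 1 ×ˢ Ioo (-Real.pi) Real.pi : Set (ℝ × ℝ))
      =ᵐ[volume] (Icc (0 : ℝ) 1 ×ˢ Icc (-Real.pi) Real.pi : Set (ℝ × ℝ)) :=
    Measure.set_prod_ae_eq Ioc_ae_eq_Icc Ioo_ae_eq_Icc
  rw [← setIntegral_congr_set hset]
  have hsub : (Ioc (0 : ℝ) 1 ×ˢ Ioo (-Real.pi) Real.pi : Set (ℝ × ℝ)) ⊆ polarCoord.target := by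
    rintro ⟨r, t⟩ ⟨h1, h2⟩
    exact ⟨h1.1, h2⟩
  have he : ∀ r t : ℝ, Complex.polarCoord.symm (r, t) = r * Complex.exp (t * Complex.I) := by
    intro r t
    rw [Complex.polarCoord_symm_apply, Complex.exp_mul_I]
    push_cast
    rfl
  rw [setIntegral_eq_of_subset_of_forall_sdiff_eq_zero polarCoord.open_target.measurableSet hsub]
  · refine setIntegral_congr_fun (measurableSet_Ioc.prod measurableSet_Ioo) ?_
    rintro ⟨r, t⟩ ⟨h1, h2⟩
    simp only [mem_Ioc] at h1
    simp only [he]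
    rw [indicator_of_mem, Complex.real_smul]
    simp [norm_ofReal_mul_unit (Complex.norm_exp_ofReal_mul_I t), abs_of_pos h1.1, h1.2,
      -norm_mul, -Complex.norm_mul]
  · rintro ⟨r, t⟩ ⟨⟨h1, h2⟩, h3⟩
    simp only [he]
    rw [indicator_of_notMem, smul_zero]
    intro hmem
    rw [mem_closedBall_zero_iff, norm_ofReal_mul_unit (Complex.norm_exp_ofReal_mul_I t)] at hmem
    exact h3 ⟨⟨h1, (le_abs_self r).trans hmem⟩, h2⟩

/-- Green's formula for the degenerate operator `Leuclid`. -/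
theorem DiskJet.green (hh : DiskJet h h1 h2) (he : DiskJet e e1 e2) :
    ∫ z in Metric.closedBall 0 1, (e z * Leuclid h z - h z * Leuclid e z) = 0 := by
  rw [integral_disk_polar]
  let c : ℝ → ℂ := fun t => Complex.exp (t * Complex.I)
  have hcn : ∀ t, ‖c t‖ = 1 := Complex.norm_exp_ofReal_mul_I
  have hcc : Continuous c := by fun_prop
  let B : Set (ℝ × ℝ) := Icc (0 : ℝ) 1 ×ˢ Icc (-Real.pi) Real.pi
  let P : ℝ × ℝ → ℂ := fun p => p.1 * c p.2
  have hP : Continuous P := by fun_prop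
  have hPm : MapsTo P B (Metric.closedBall 0 1) := by
    rintro ⟨r, t⟩ ⟨hr, -⟩
    rw [mem_closedBall_zero_iff]
    simp only [P]
    rw [norm_ofReal_mul_unit (hcn t), abs_of_nonneg hr.1]
    exact hr.2
  have cont : ∀ {h : ℂ → ℂ} {h1 : ℂ → ℂ →L[ℝ] ℂ} {h2 : ℂ → ℂ →L[ℝ] ℂ →L[ℝ] ℂ}, DiskJet h h1 h2 →
      ContinuousOn (fun p => h (P p)) B ∧ ContinuousOn (fun p => h1 (P p) (c p.2)) B ∧
      ContinuousOn (fun p => h1 (P p) (Complex.I * c p.2)) B ∧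
      ContinuousOn (fun p => h2 (P p) (c p.2) (c p.2)) B ∧
      ContinuousOn (fun p => h2 (P p) (Complex.I * c p.2) (Complex.I * c p.2)) B := by
    intro h h1 h2 hh
    have k1 := hh.cont_fst.comp hP.continuousOn hPm
    have k2 := hh.cont_snd.comp hP.continuousOn hPm
    have kc : ContinuousOn (fun p : ℝ × ℝ => c p.2) B := (hcc.comp continuous_snd).continuousOn
    have ki : ContinuousOn (fun p : ℝ × ℝ => Complex.I * c p.2) B := continuousOn_const.mul kc
    exact ⟨hh.cont.comp hP.continuousOn hPm, k1.clm_apply kc, k1.clm_apply ki,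
      (k2.clm_apply kc).clm_apply kc, (k2.clm_apply ki).clm_apply ki⟩
  obtain ⟨ch, ch1, chi, chc, chd⟩ := cont hh
  obtain ⟨ce, ce1, cei, cec, ced⟩ := cont he
  have cr : ContinuousOn (fun p : ℝ × ℝ => (p.1 : ℂ)) B :=
    (Complex.continuous_ofReal.comp continuous_fst).continuousOn
  -- Times the polar Jacobian r, the integrand is -A - D, where A is the r-derivative of r(1 - r²)(e
  -- ∂_r h - h ∂_r e) and D is the derivative in the angle of e h1(ic) - h e1(ic).
  let A : ℝ × ℝ → ℂ := fun p =>
    (1 - 3 * (p.1 : ℂ) ^ 2) * (e (P p) * h1 (P p) (c p.2) - h (P p) * e1 (P p) (c p.2))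
    + p.1 * (1 - (p.1 : ℂ) ^ 2) * (e (P p) * h2 (P p) (c p.2) (c p.2) - h (P p) * e2 (P p) (c p.2) (c p.2))
  let D : ℝ × ℝ → ℂ := fun p =>
    e (P p) * (p.1 * h2 (P p) (Complex.I * c p.2) (Complex.I * c p.2) - h1 (P p) (c p.2))
    - h (P p) * (p.1 * e2 (P p) (Complex.I * c p.2) (Complex.I * c p.2) - e1 (P p) (c p.2))
  have hA : ContinuousOn A B := by
    refine ((continuousOn_const.sub (continuousOn_const.mul (cr.pow 2))).mul
      ((ce.mul ch1).sub (ch.mul ce1))).add ((cr.mul (continuousOn_const.sub (cr.pow 2))).mul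
      ((ce.mul chc).sub (ch.mul cec)))
  have hD : ContinuousOn D B :=
    (ce.mul ((cr.mul chd).sub ch1)).sub (ch.mul ((cr.mul ced).sub ce1))
  have hBc : IsCompact B := isCompact_Icc.prod isCompact_Icc
  have hAi : IntegrableOn A B (volume.prod volume) := hA.integrableOn_compact hBc
  have hDi : IntegrableOn D B (volume.prod volume) := hD.integrableOn_compact hBc
  have hset : (Ioo (0 : ℝ) 1 ×ˢ Icc (-Real.pi) Real.pi : Set (ℝ × ℝ)) =ᵐ[volume] B :=
    Measure.set_prod_ae_eq Ioo_ae_eq_Icc (ae_eq_refl _)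
  have hmain : ∫ p in B, (p.1 : ℂ) * (e (P p) * Leuclid h (P p) - h (P p) * Leuclid e (P p))
      = ∫ p in B, (-A p - D p) := by
    rw [← setIntegral_congr_set hset, ← setIntegral_congr_set hset]
    refine setIntegral_congr_fun (measurableSet_Ioo.prod measurableSet_Icc) ?_
    rintro ⟨r, t⟩ ⟨⟨hr0, hr1⟩, -⟩
    have hrn : ‖P (r, t)‖ = r := by
      simp only [P]
      rw [norm_ofReal_mul_unit (hcn t), abs_of_pos hr0]
    have hne : P (r, t) ≠ 0 := by rw [← norm_ne_zero_iff, hrn]; exact hr0.ne'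
    have hexp : Complex.exp ((P (r, t)).arg * Complex.I) = c t := by
      have h := Complex.norm_mul_exp_arg_mul_I (P (r, t))
      rw [hrn] at h
      exact mul_left_cancel₀ (by exact_mod_cast hr0.ne') h
    simp only
    rw [hh.Leuclid_eq hne (by rw [hrn]; exact hr1), he.Leuclid_eq hne (by rw [hrn]; exact hr1),
      hrn, hexp]
    simp only [diskOp, A, D, P]
    push_cast
    ring
  refine hmain.trans ?_
  -- The factor r(1 - r²) vanishes at r = 0 and at r = 1: the degeneracy at the boundary stands in
  -- for a boundary condition.
  have hzA : ∫ p in B, A p = 0 := by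
    have hs := setIntegral_prod_swap (μ := (volume : Measure ℝ)) (ν := (volume : Measure ℝ))
      (Icc (0 : ℝ) 1) (Icc (-Real.pi) Real.pi) A
    change ∫ p in B, A p ∂(volume.prod volume) = 0
    refine hs.symm.trans ?_
    rw [setIntegral_prod (fun z => A z.swap) hAi.swap]
    refine integral_eq_zero_of_ae ((ae_restrict_iff' measurableSet_Icc).2
      (Filter.Eventually.of_forall fun t ht => ?_))
    have hmap : ContinuousOn (fun r : ℝ => (r, t)) (Icc 0 1) := by fun_prop
    have hm : MapsTo (fun r : ℝ => (r, t)) (Icc 0 1) B := fun r hr => ⟨hr, ht⟩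
    have hF : ContinuousOn (fun r : ℝ => (r : ℂ) * (1 - (r : ℂ) ^ 2) *
        (e (r * c t) * h1 (r * c t) (c t) - h (r * c t) * e1 (r * c t) (c t))) (Icc 0 1) :=
      ((cr.mul (continuousOn_const.sub (cr.pow 2))).mul
        ((ce.mul ch1).sub (ch.mul ce1))).comp hmap hm
    have hint : IntervalIntegrable (fun r => A (r, t)) volume 0 1 :=
      ((hA.comp hmap hm).mono (by rw [uIcc_of_le zero_le_one])).intervalIntegrable
    have hftc := intervalIntegral.integral_eq_sub_of_hasDerivAt_of_le zero_le_one hF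
      (f' := fun r => A (r, t)) (fun r hr => ?_) hint
    · simp only [Prod.swap_prod_mk, Pi.zero_apply]
      rw [integral_Icc_eq_integral_Ioc, ← intervalIntegral.integral_of_le zero_le_one, hftc]
      simp
    · have hr' : |r| < 1 := by rw [abs_of_pos hr.1]; exact hr.2
      have q0 : HasDerivAt (fun r : ℝ => (r : ℂ)) 1 r := Complex.ofRealCLM.hasDerivAt
      have q1 := (q0.mul ((q0.pow 2).const_sub 1)).mul
        (((he.hasDerivAt_radial (hcn t) hr').mul (hh.hasDerivAt_radial_fst (hcn t) hr' (c t))).sub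
        ((hh.hasDerivAt_radial (hcn t) hr').mul (he.hasDerivAt_radial_fst (hcn t) hr' (c t))))
      refine q1.congr_deriv ?_
      simp only [A, P, Pi.mul_apply, Pi.sub_apply, Pi.pow_apply]
      push_cast
      ring
  -- The angular primitive is 2π-periodic.
  have hzD : ∫ p in B, D p = 0 := by
    change ∫ p in B, D p ∂(volume.prod volume) = 0
    rw [setIntegral_prod _ hDi, integral_Icc_eq_integral_Ioc,
      ← setIntegral_congr_set Ioo_ae_eq_Ioc]
    refine integral_eq_zero_of_ae ((ae_restrict_iff' measurableSet_Ioo).2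
      (Filter.Eventually.of_forall fun r hr => ?_))
    have hr' : |r| < 1 := by rw [abs_of_pos hr.1]; exact hr.2
    have hle : -Real.pi ≤ Real.pi := by linarith [Real.pi_pos]
    have hmap : ContinuousOn (fun t : ℝ => (r, t)) (Icc (-Real.pi) Real.pi) := by fun_prop
    have hm : MapsTo (fun t : ℝ => (r, t)) (Icc (-Real.pi) Real.pi) B :=
      fun t ht => ⟨Ioo_subset_Icc_self hr, ht⟩
    have hint : IntervalIntegrable (fun t => D (r, t)) volume (-Real.pi) Real.pi :=
      ((hD.comp hmap hm).mono (by rw [uIcc_of_le hle])).intervalIntegrable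
    have hder : ∀ t : ℝ, HasDerivAt (fun t : ℝ => e (r * c t) * h1 (r * c t) (Complex.I * c t)
        - h (r * c t) * e1 (r * c t) (Complex.I * c t)) (D (r, t)) t := by
      intro t
      have q1 := ((he.hasDerivAt_angular hr' t).mul (hh.hasDerivAt_angular_fst hr' t)).sub
        ((hh.hasDerivAt_angular hr' t).mul (he.hasDerivAt_angular_fst hr' t))
      refine q1.congr_deriv ?_
      simp only [D, P, c]
      ring
    have hftc := intervalIntegral.integral_eq_sub_of_hasDerivAt (fun t _ => hder t) hint
    beta_reduce
    rw [integral_Icc_eq_integral_Ioc, ← intervalIntegral.integral_of_le hle, hftc]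
    have : c Real.pi = c (-Real.pi) := by
      simp only [c]
      push_cast
      rw [neg_mul, Complex.exp_neg, Complex.exp_pi_mul_I]
      norm_num
    rw [this, sub_self]
    rfl
  have hAn : Integrable (fun p => -A p) (volume.restrict B) := hAi.neg
  rw [integral_sub hAn hDi, integral_neg, hzA, hzD]
  simp

/-- Off the centre and the unit circle, which are null, the operator equals an expression continuous
in z; in it z/‖z‖ replaces the exponential of the discontinuous argument. -/
theorem DiskJet.aestronglyMeasurable_Leuclid (hh : DiskJet h h1 h2) :
    AEStronglyMeasurable (Leuclid h) (volume.restrict (Metric.closedBall 0 1)) := by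
  have hms : MeasurableSet (Metric.ball (0 : ℂ) 1 \ {0}) :=
    Metric.isOpen_ball.measurableSet.diff (measurableSet_singleton 0)
  have hae : (Metric.ball (0 : ℂ) 1 \ {0} : Set ℂ) =ᵐ[volume] Metric.closedBall (0 : ℂ) 1 := by
    have h1 : (Metric.ball (0 : ℂ) 1 \ {0} : Set ℂ) =ᵐ[volume] Metric.ball (0 : ℂ) 1 :=
      sdiff_null_ae_eq_self (measure_singleton 0)
    refine h1.trans ?_
    exact ae_eq_of_subset_of_measure_ge Metric.ball_subset_closedBall
      (Measure.addHaar_closedBall_eq_addHaar_ball volume 0 1).le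
      Metric.isOpen_ball.measurableSet.nullMeasurableSet (measure_closedBall_lt_top).ne
  rw [← Measure.restrict_congr_set hae]
  refine AEStronglyMeasurable.congr (f := fun z => diskOp h h1 h2 ‖z‖ (z / ‖z‖)) ?_ ?_
  · refine ContinuousOn.aestronglyMeasurable ?_ hms
    have hcn : ContinuousOn (fun z : ℂ => (‖z‖ : ℂ)) (Metric.ball (0 : ℂ) 1 \ {0}) := by fun_prop
    have hz : ∀ z ∈ Metric.ball (0 : ℂ) 1 \ {0}, (‖z‖ : ℂ) ≠ 0 := by
      intro z hz
      exact_mod_cast norm_ne_zero_iff.2 hz.2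
    have kc : ContinuousOn (fun z : ℂ => z / ‖z‖) (Metric.ball (0 : ℂ) 1 \ {0}) :=
      continuousOn_id.div hcn hz
    have kP : ContinuousOn (fun z : ℂ => (‖z‖ : ℂ) * (z / ‖z‖)) (Metric.ball (0 : ℂ) 1 \ {0}) :=
      hcn.mul kc
    have hPm : MapsTo (fun z : ℂ => (‖z‖ : ℂ) * (z / ‖z‖)) (Metric.ball (0 : ℂ) 1 \ {0})
        (Metric.closedBall 0 1) := by
      intro z hzm
      simp only
      rw [mul_div_cancel₀ _ (hz z hzm)]
      exact Metric.ball_subset_closedBall hzm.1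
    have ki : ContinuousOn (fun z : ℂ => Complex.I * (z / ‖z‖)) (Metric.ball (0 : ℂ) 1 \ {0}) :=
      continuousOn_const.mul kc
    have k2 := hh.cont_snd.comp kP hPm
    have kr : ContinuousOn (fun z : ℂ => ((1 - ‖z‖ ^ 2 : ℝ) : ℂ)) (Metric.ball (0 : ℂ) 1 \ {0}) := by
      fun_prop
    exact (((hh.cont.comp kP hPm).sub (kr.mul ((k2.clm_apply kc).clm_apply kc))).add
      ((continuousOn_const.mul hcn).mul ((hh.cont_fst.comp kP hPm).clm_apply kc))).sub
      ((k2.clm_apply ki).clm_apply ki)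
  · refine (ae_restrict_iff' hms).2 (Filter.Eventually.of_forall fun z hz => ?_)
    have hz0 : z ≠ 0 := hz.2
    have hne : (‖z‖ : ℂ) ≠ 0 := by exact_mod_cast norm_ne_zero_iff.2 hz0
    have h3 : z / ‖z‖ = Complex.exp (z.arg * Complex.I) := by
      rw [div_eq_iff hne, mul_comm]
      exact (Complex.norm_mul_exp_arg_mul_I z).symm
    simp only
    rw [h3]
    exact (hh.Leuclid_eq hz0 (by simpa using hz.1)).symm

/-- The Chebyshev ridge function `U_n(Re(z e^{-iθ}))`. -/
def ridge (n : ℤ) (θ : ℝ) (z : ℂ) : ℝ :=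
  (Polynomial.Chebyshev.U ℝ n).eval (z * Complex.exp (-(θ * Complex.I))).re

/-- The linear functional `z ↦ Re(z e^{-iθ})`. -/
def ridgeCLM (θ : ℝ) : ℂ →L[ℝ] ℝ :=
  Complex.reCLM.comp ((ContinuousLinearMap.mul ℝ ℂ).flip (Complex.exp (-(θ * Complex.I))))

theorem ridgeCLM_apply (θ : ℝ) (z : ℂ) :
    ridgeCLM θ z = (z * Complex.exp (-(θ * Complex.I))).re := rfl

theorem diskJet_ridge (n : ℤ) (θ : ℝ) :
    DiskJet (fun z => (ridge n θ z : ℂ))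
      (fun z => (((Polynomial.Chebyshev.U ℝ n).derivative.eval (ridgeCLM θ z) : ℝ)) •
        Complex.ofRealCLM.comp (ridgeCLM θ))
      (fun z => (((Polynomial.Chebyshev.U ℝ n).derivative.derivative.eval (ridgeCLM θ z) : ℝ) •
        ridgeCLM θ).smulRight (Complex.ofRealCLM.comp (ridgeCLM θ))) := by
  refine ⟨?_, ?_, ?_, fun z _ => ?_, fun z _ => ?_⟩
  · exact (Complex.continuous_ofReal.comp ((Polynomial.continuous _).comp
      (ridgeCLM θ).continuous)).continuousOn
  · exact (((Polynomial.continuous _).comp (ridgeCLM θ).continuous).smul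
      continuous_const).continuousOn
  · refine Continuous.continuousOn ?_
    have : Continuous fun z => ((Polynomial.Chebyshev.U ℝ n).derivative.derivative.eval
        (ridgeCLM θ z) : ℝ) := (Polynomial.continuous _).comp (ridgeCLM θ).continuous
    have h2 : Continuous fun z => ((Polynomial.Chebyshev.U ℝ n).derivative.derivative.eval
        (ridgeCLM θ z) : ℝ) • ridgeCLM θ := this.smul continuous_const
    exact ((ContinuousLinearMap.smulRightL ℝ ℂ (ℂ →L[ℝ] ℂ)).flip
      (Complex.ofRealCLM.comp (ridgeCLM θ))).continuous.comp h2
  · have h := ((Polynomial.Chebyshev.U ℝ n).hasDerivAt (ridgeCLM θ z)).comp_hasFDerivAt z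
      (ridgeCLM θ).hasFDerivAt
    have h2 := Complex.ofRealCLM.hasFDerivAt.comp z h
    refine h2.congr_fderiv ?_
    ext v
    simp
  · have h := ((Polynomial.Chebyshev.U ℝ n).derivative.hasDerivAt (ridgeCLM θ z)).comp_hasFDerivAt z
      (ridgeCLM θ).hasFDerivAt
    exact h.smul_const (Complex.ofRealCLM.comp (ridgeCLM θ) : ℂ →L[ℝ] ℂ)

/-- Let x = Re(z e^{-iθ}), and let p, q be the values of this functional at the radial and angular
unit vectors, so that p² + q² = 1 and x = rp. The coefficient of U_n'' is (1 - r²)p² + q² = 1 - x²,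
and Chebyshev's equation (1 - x²)U'' - 3xU' + n(n+2)U = 0 leaves 1 + n(n+2) = (n+1)². Agreement with
the ridge on the closed disk is enough, as needed for functions composed with `PhiInv`. -/
theorem Leuclid_ridge (n : ℤ) (θ : ℝ) {h : ℂ → ℂ}
    (hh : EqOn h (fun z => (ridge n θ z : ℂ)) (Metric.closedBall 0 1)) {z : ℂ} (hz0 : z ≠ 0)
    (hz : ‖z‖ < 1) : Leuclid h z = ((n + 1 : ℝ) ^ 2 : ℝ) * (ridge n θ z : ℂ) := by
  rw [((diskJet_ridge n θ).congr hh).Leuclid_eq hz0 hz, diskOp]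
  set c := Complex.exp (z.arg * Complex.I) with hc
  have hzc : (‖z‖ : ℂ) * c = z := Complex.norm_mul_exp_arg_mul_I z
  rw [hzc, hh (by simpa using hz.le)]
  have hcn : ‖c‖ = 1 := Complex.norm_exp_ofReal_mul_I _
  have hx : ridgeCLM θ z = ‖z‖ * ridgeCLM θ c := by
    conv_lhs => rw [← hzc]
    rw [← Complex.real_smul, map_smul, smul_eq_mul]
  have hpq : ridgeCLM θ c ^ 2 + ridgeCLM θ (Complex.I * c) ^ 2 = 1 := by
    have h1 : Complex.normSq (c * Complex.exp (-(θ * Complex.I))) = 1 := by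
      rw [Complex.normSq_eq_norm_sq, norm_mul, hcn, ← neg_mul, ← Complex.ofReal_neg,
        Complex.norm_exp_ofReal_mul_I]
      norm_num
    rw [Complex.normSq_apply] at h1
    rw [ridgeCLM_apply, ridgeCLM_apply, mul_assoc Complex.I, Complex.I_mul_re]
    linear_combination h1
  have hode := congrArg (Polynomial.eval (ridgeCLM θ z))
    (Polynomial.Chebyshev.one_sub_X_sq_mul_derivative_derivative_U_eq_poly_in_U (R := ℝ) n)
  rw [Function.iterate_succ, Function.iterate_one, Function.comp_apply] at hode
  simp only [Polynomial.eval_mul, Polynomial.eval_sub, Polynomial.eval_add, Polynomial.eval_pow,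
    Polynomial.eval_X, Polynomial.eval_one, Polynomial.eval_ofNat, Polynomial.eval_intCast] at hode
  simp only [ContinuousLinearMap.smulRight_apply, smul_apply, ContinuousLinearMap.comp_apply,
    Complex.ofRealCLM_apply, Complex.real_smul, smul_eq_mul]
  rw [show ridge n θ z = (Polynomial.Chebyshev.U ℝ n).eval (ridgeCLM θ z) from rfl]
  have key : (Polynomial.Chebyshev.U ℝ n).eval (ridgeCLM θ z)
      - (1 - ‖z‖ ^ 2) * ((Polynomial.Chebyshev.U ℝ n).derivative.derivative.eval (ridgeCLM θ z)
        * ridgeCLM θ c * ridgeCLM θ c)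
      + 3 * ‖z‖ * ((Polynomial.Chebyshev.U ℝ n).derivative.eval (ridgeCLM θ z) * ridgeCLM θ c)
      - (Polynomial.Chebyshev.U ℝ n).derivative.derivative.eval (ridgeCLM θ z)
        * ridgeCLM θ (Complex.I * c) * ridgeCLM θ (Complex.I * c)
      = (n + 1) ^ 2 * (Polynomial.Chebyshev.U ℝ n).eval (ridgeCLM θ z) := by
    linear_combination -hode - (Polynomial.Chebyshev.U ℝ n).derivative.derivative.eval
      (ridgeCLM θ z) * hpq - ((Polynomial.Chebyshev.U ℝ n).derivative.derivative.eval
      (ridgeCLM θ z) * (ridgeCLM θ z + ‖z‖ * ridgeCLM θ c) +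
      3 * (Polynomial.Chebyshev.U ℝ n).derivative.eval (ridgeCLM θ z)) * hx
  have key' := congrArg (fun x : ℝ => (x : ℂ)) key
  push_cast at key' ⊢
  linear_combination key'

end UnitDisk
end XrayDisk

/-! ### The operator 𝓛: ridge eigenfunctions, symmetry, totality. -/

namespace XrayDisk
noncomputable section InteriorOperator

variable {κ R : ℝ}

theorem contDiffOn_weight (hκ : R ^ 2 * |κ| < 1) :
    ContDiffOn ℝ ∞ (weight κ) (Metric.closedBall 0 R) := by
  refine ContDiffOn.div ?_ ?_ fun z hz => (one_sub_norm_pos hκ (mem_closedBall_zero_iff.1 hz)).ne'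
  · exact (contDiff_const.add (contDiff_const.mul (contDiff_norm_sq ℝ))).contDiffOn
  · exact (contDiff_const.sub (contDiff_const.mul (contDiff_norm_sq ℝ))).contDiffOn

theorem contDiffOn_Phi (hκ : R ^ 2 * |κ| < 1) :
    ContDiffOn ℝ ∞ (Phi κ R) (Metric.closedBall 0 R) := by
  refine ContDiffOn.mul (Complex.ofRealCLM.contDiff.comp_contDiffOn ?_) contDiffOn_id
  refine ContDiffOn.div_const (ContDiffOn.div contDiffOn_const ?_ fun z hz =>
    (one_sub_norm_pos hκ (mem_closedBall_zero_iff.1 hz)).ne') R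
  exact (contDiff_const.sub (contDiff_const.mul (contDiff_norm_sq ℝ))).contDiffOn

theorem contDiffOn_PhiInv (hκ : R ^ 2 * |κ| < 1) :
    ContDiffOn ℝ ∞ (PhiInv κ R) (Metric.closedBall 0 1) := by
  refine ContDiffOn.mul (Complex.ofRealCLM.contDiff.comp_contDiffOn ?_) contDiffOn_id
  have h1 := one_sub_pos hκ
  refine ContDiffOn.div contDiffOn_const (contDiffOn_const.add (ContDiffOn.sqrt ?_ fun z hz =>
    (PhiInv_disc_pos hκ (mem_closedBall_zero_iff.1 hz)).ne')) fun z hz => ?_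
  · exact (contDiff_const.add (contDiff_const.mul (contDiff_norm_sq ℝ))).contDiffOn
  · have := Real.sqrt_nonneg ((1 - κ * R ^ 2) ^ 2 + 4 * (κ * R ^ 2) * ‖z‖ ^ 2)
    positivity

theorem mapsTo_PhiInv (hR : 0 < R) (hκ : R ^ 2 * |κ| < 1) :
    MapsTo (PhiInv κ R) (Metric.closedBall 0 1) (Metric.closedBall 0 R) := fun z hz => by
  rw [mem_closedBall_zero_iff] at *
  exact norm_PhiInv_le hR hκ hz

theorem exists_weight_le (hκ : R ^ 2 * |κ| < 1) :
    ∃ C, 0 < C ∧ ∀ z : ℂ, ‖z‖ ≤ R → weight κ z ≤ C := by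
  obtain ⟨C, hC⟩ := (isCompact_closedBall (0 : ℂ) R).exists_bound_of_continuousOn
    (contDiffOn_weight hκ).continuousOn
  refine ⟨max C 1, by positivity, fun z hz => le_trans (le_trans (le_abs_self _) ?_) (le_max_left _ _)⟩
  exact hC z (by simpa using hz)

theorem isFiniteMeasure_dVol (hκ : R ^ 2 * |κ| < 1) : IsFiniteMeasure (dVol κ R) := by
  refine isFiniteMeasure_withDensity_ofReal (Integrable.hasFiniteIntegral ?_)
  refine ContinuousOn.integrableOn_compact (isCompact_closedBall (0 : ℂ) R) ?_
  refine ContinuousOn.inv₀ (by fun_prop) fun z hz => ?_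
  have := one_add_norm_pos hκ (mem_closedBall_zero_iff.1 hz)
  positivity

theorem ae_norm_le_dVol (κ R : ℝ) : ∀ᵐ z ∂(dVol κ R), ‖z‖ ≤ R := by
  have h : ∀ᵐ z ∂(volume.restrict (Metric.closedBall (0 : ℂ) R)), ‖z‖ ≤ R := by
    filter_upwards [ae_restrict_mem Metric.isClosed_closedBall.measurableSet] with z hz
    exact mem_closedBall_zero_iff.1 hz
  exact (withDensity_absolutelyContinuous _ _).ae_le h

theorem isFiniteMeasure_wdVol (hκ : R ^ 2 * |κ| < 1) : IsFiniteMeasure (wdVol κ R) := by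
  have := isFiniteMeasure_dVol hκ
  obtain ⟨C, -, hC⟩ := exists_weight_le hκ
  refine isFiniteMeasure_withDensity_ofReal (Integrable.hasFiniteIntegral ?_)
  refine Integrable.of_bound (measurable_weight κ).aestronglyMeasurable C ?_
  filter_upwards [ae_norm_le_dVol κ R] with z hz
  rw [Real.norm_of_nonneg (weight_pos hκ hz).le]
  exact hC z hz

theorem wdVol_absolutelyContinuous (κ R : ℝ) : wdVol κ R ≪ volume :=
  ((withDensity_absolutelyContinuous _ _).trans (withDensity_absolutelyContinuous _ _)).trans
    Measure.absolutelyContinuous_restrict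

/-- The centre and the boundary circle, where the polar formula for the operator is not available,
are null sets. -/
theorem ae_Phi_mem (hR : 0 < R) (hκ : R ^ 2 * |κ| < 1) :
    ∀ᵐ z ∂(wdVol κ R), Phi κ R z ≠ 0 ∧ ‖Phi κ R z‖ < 1 := by
  have h0 : ∀ᵐ z ∂(volume : Measure ℂ), z ≠ 0 := Measure.ae_ne volume 0
  have h1 : ∀ᵐ z ∂(volume : Measure ℂ), z ∉ Metric.sphere (0 : ℂ) R :=
    measure_eq_zero_iff_ae_notMem.1 (Measure.addHaar_sphere volume 0 R)
  filter_upwards [ae_norm_le_wdVol κ R, (wdVol_absolutelyContinuous κ R).ae_le h0,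
    (wdVol_absolutelyContinuous κ R).ae_le h1] with z hz hz0 hz1
  have hlt : ‖z‖ < R := lt_of_le_of_ne hz fun h => hz1 (by simpa using h)
  have k1 := one_sub_pos hκ
  have k2 := one_sub_norm_pos hκ hz
  have hn := norm_Phi_eq hR hκ hz
  have hzpos : 0 < ‖z‖ := norm_pos_iff.2 hz0
  constructor
  · rw [← norm_pos_iff, hn]
    positivity
  · rw [hn, div_div, div_mul_eq_mul_div, div_lt_one (by positivity)]
    have h3 : 0 < 1 + κ * (R * ‖z‖) := by
      have : |κ * (R * ‖z‖)| < 1 := by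
        rw [abs_mul, abs_of_nonneg (by positivity : 0 ≤ R * ‖z‖)]
        have : R * ‖z‖ ≤ R ^ 2 := by nlinarith
        nlinarith [abs_nonneg κ]
      linarith [(abs_lt.1 this).1]
    nlinarith [mul_pos (sub_pos.2 hlt) h3]

/-- The functions `w · U_n(Re(Φ e^{-iθ}))`, which are eigenfunctions of `𝓛`. -/
def ridgeM (κ R : ℝ) (n : ℤ) (θ : ℝ) (z : ℂ) : ℂ := (weight κ z : ℂ) * (ridge n θ (Phi κ R z) : ℂ)

theorem contDiff_ridge (n : ℤ) (θ : ℝ) : ContDiff ℝ ∞ (ridge n θ) :=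
  (Polynomial.contDiff_aeval (𝕜 := ℝ) (Polynomial.Chebyshev.U ℝ n) ∞).comp
    (ridgeCLM θ).contDiff

theorem contDiffOn_ridgeM (hκ : R ^ 2 * |κ| < 1) (n : ℤ) (θ : ℝ) :
    ContDiffOn ℝ ∞ (ridgeM κ R n θ) (Metric.closedBall 0 R) :=
  (Complex.ofRealCLM.contDiff.comp_contDiffOn (contDiffOn_weight hκ)).mul
    (Complex.ofRealCLM.contDiff.comp_contDiffOn
      ((contDiff_ridge n θ).comp_contDiffOn (contDiffOn_Phi hκ)))

theorem measurable_ridgeM (κ R : ℝ) (n : ℤ) (θ : ℝ) : Measurable (ridgeM κ R n θ) :=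
  (Complex.measurable_ofReal.comp (measurable_weight κ)).mul
    (Complex.measurable_ofReal.comp ((contDiff_ridge n θ).continuous.measurable.comp
      (measurable_Phi κ R)))

theorem memLp_of_bound (hκ : R ^ 2 * |κ| < 1) {f : ℂ → ℂ} (hf : Measurable f)
    {C : ℝ} (hC : ∀ z, ‖z‖ ≤ R → ‖f z‖ ≤ C) : MemLp f 2 (wdVol κ R) := by
  have := isFiniteMeasure_wdVol hκ
  refine MemLp.of_bound hf.aestronglyMeasurable C ?_
  filter_upwards [ae_norm_le_wdVol κ R] with z hz
  exact hC z hz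

theorem memLp_ridgeM (hκ : R ^ 2 * |κ| < 1) (n : ℤ) (θ : ℝ) :
    MemLp (ridgeM κ R n θ) 2 (wdVol κ R) := by
  obtain ⟨C, hC⟩ := (isCompact_closedBall (0 : ℂ) R).exists_bound_of_continuousOn
    (contDiffOn_ridgeM hκ n θ).continuousOn
  exact memLp_of_bound hκ (measurable_ridgeM κ R n θ) fun z hz => hC z (by simpa using hz)

/-- The class of `ridgeM` in `L²(M, w dVol)`. -/
def ridgeLp (hκ : R ^ 2 * |κ| < 1) (n : ℤ) (θ : ℝ) : L2M κ R :=
  (memLp_ridgeM hκ n θ).toLp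

theorem coeFn_ridgeLp (hκ : R ^ 2 * |κ| < 1) (n : ℤ) (θ : ℝ) :
    ridgeLp hκ n θ =ᵐ[wdVol κ R] ridgeM κ R n θ := (memLp_ridgeM hκ n θ).coeFn_toLp

theorem ofReal_weight_ne_zero (hκ : R ^ 2 * |κ| < 1) {z : ℂ} (hz : ‖z‖ ≤ R) :
    (weight κ z : ℂ) ≠ 0 := by exact_mod_cast (weight_pos hκ hz).ne'

theorem ridgeM_div_weight (hR : 0 < R) (hκ : R ^ 2 * |κ| < 1) (n : ℤ) (θ : ℝ) :
    EqOn (fun ζ => ridgeM κ R n θ (PhiInv κ R ζ) / (weight κ (PhiInv κ R ζ) : ℂ))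
      (fun z => (ridge n θ z : ℂ)) (Metric.closedBall 0 1) := by
  intro ζ hζ
  rw [mem_closedBall_zero_iff] at hζ
  simp only [ridgeM]
  rw [mul_div_cancel_left₀ _ (ofReal_weight_ne_zero hκ (norm_PhiInv_le hR hκ hζ)),
    Phi_PhiInv hR hκ hζ]

theorem Lfun_ridgeM (hR : 0 < R) (hκ : R ^ 2 * |κ| < 1) (n : ℤ) (θ : ℝ) {z : ℂ}
    (hz0 : Phi κ R z ≠ 0) (hz1 : ‖Phi κ R z‖ < 1) :
    Lfun κ R (ridgeM κ R n θ) z = ((n + 1 : ℝ) ^ 2 : ℝ) * ridgeM κ R n θ z := by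
  rw [Lfun, Leuclid_ridge n θ (ridgeM_div_weight hR hκ n θ) hz0 hz1, ridgeM]
  ring

theorem ridgeLp_mem_core (hR : 0 < R) (hκ : R ^ 2 * |κ| < 1) (n : ℤ) (θ : ℝ) :
    ∃ u : ℂ → ℂ, ContDiffOn ℝ ∞ u (Metric.closedBall 0 R) ∧
    ridgeLp hκ n θ =ᵐ[wdVol κ R] u ∧
    ((((n + 1 : ℝ) ^ 2 : ℝ) : ℂ) • ridgeLp hκ n θ : L2M κ R) =ᵐ[wdVol κ R] Lfun κ R u := by
  refine ⟨ridgeM κ R n θ, contDiffOn_ridgeM hκ n θ, coeFn_ridgeLp hκ n θ, ?_⟩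
  filter_upwards [coeFn_ridgeLp hκ n θ, ae_Phi_mem hR hκ,
    Lp.coeFn_smul (((n + 1 : ℝ) ^ 2 : ℝ) : ℂ) (ridgeLp hκ n θ)] with z h1 h2 h3
  rw [h3, Pi.smul_apply, h1, Lfun_ridgeM hR hκ n θ h2.1 h2.2, smul_eq_mul]

theorem conj_ridgeM (κ R : ℝ) (n : ℤ) (θ : ℝ) (z : ℂ) :
    conj (ridgeM κ R n θ z) = ridgeM κ R n θ z := by
  rw [ridgeM, map_mul, Complex.conj_ofReal, Complex.conj_ofReal]

/-- The ridge being an eigenfunction, the difference of the two sides is a multiple of Green's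
formula for the ridge and (u/w) ∘ Φ⁻¹. The factors w in `ridgeM` and in `Lfun` together form the w²
of the change of variables `integral_disk`. -/
theorem inner_ridgeLp_core (hR : 0 < R) (hκ : R ^ 2 * |κ| < 1) (n : ℤ) (θ : ℝ) {f g : L2M κ R}
    {u : ℂ → ℂ} (hu : ContDiffOn ℝ ∞ u (Metric.closedBall 0 R)) (hf : f =ᵐ[wdVol κ R] u)
    (hg : g =ᵐ[wdVol κ R] Lfun κ R u) :
    ⟪ridgeLp hκ n θ, g⟫_ℂ = (((n + 1 : ℝ) ^ 2 : ℝ) : ℂ) * ⟪ridgeLp hκ n θ, f⟫_ℂ := by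
  set l : ℂ := (((n + 1 : ℝ) ^ 2 : ℝ) : ℂ) with hl
  rw [← sub_eq_zero, ← inner_smul_right, ← inner_sub_right]
  have hd : (g - l • f : L2M κ R) =ᵐ[wdVol κ R] fun z => Lfun κ R u z - l * u z := by
    filter_upwards [hf, hg, Lp.coeFn_sub g (l • f), Lp.coeFn_smul l f] with z h1 h2 h3 h4
    rw [h3, Pi.sub_apply, h4, Pi.smul_apply, h1, h2, smul_eq_mul]
  rw [inner_Lp_eq (coeFn_ridgeLp hκ n θ) hd]
  set h : ℂ → ℂ := fun ζ => u (PhiInv κ R ζ) / (weight κ (PhiInv κ R ζ) : ℂ) with hh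
  have hcd : ContDiffOn ℝ ∞ h (Metric.closedBall 0 1) := by
    have hP := contDiffOn_PhiInv hκ (R := R)
    have hm := mapsTo_PhiInv hR hκ
    simp only [hh, div_eq_mul_inv]
    exact (hu.comp hP hm).mul (ContDiffOn.inv
      ((Complex.ofRealCLM.contDiff.comp_contDiffOn (contDiffOn_weight hκ)).comp hP hm)
      fun ζ hζ => ofReal_weight_ne_zero hκ (norm_PhiInv_le hR hκ (mem_closedBall_zero_iff.1 hζ)))
  obtain ⟨h1, h2, hj⟩ := exists_diskJet hcd
  have he := diskJet_ridge n θ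
  have hgreen := hj.green he
  have hcont : ∀ {k : ℂ → ℂ}, ContinuousOn k (Metric.closedBall 0 1) →
      AEStronglyMeasurable k (volume.restrict (Metric.closedBall 0 1)) := fun hk =>
    hk.aestronglyMeasurable Metric.isClosed_closedBall.measurableSet
  have hsm : AEStronglyMeasurable (fun z => (ridge n θ z : ℂ) * Leuclid h z
      - h z * Leuclid (fun z => (ridge n θ z : ℂ)) z) (volume.restrict (Metric.closedBall 0 1)) :=
    ((hcont he.cont).mul hj.aestronglyMeasurable_Leuclid).sub
    ((hcont hj.cont).mul he.aestronglyMeasurable_Leuclid)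
  rw [integral_disk hR hκ hsm] at hgreen
  rw [← mul_zero ((jacConst κ R : ℝ) : ℂ), ← hgreen, ← integral_const_mul]
  refine integral_congr_ae ?_
  have hjac := jacConst_pos hR hκ
  filter_upwards [ae_norm_le_wdVol κ R, ae_Phi_mem hR hκ] with z hz hz2
  have hw := ofReal_weight_ne_zero hκ hz
  have hhz : h (Phi κ R z) = u z / weight κ z := by rw [hh]; simp only [PhiInv_Phi hR hκ hz]
  rw [conj_ridgeM,
    Leuclid_ridge n θ (fun _ _ => rfl) hz2.1 hz2.2, hhz, ← hl, Lfun, ← hh, ridgeM]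
  have hj0 : (jacConst κ R : ℂ) ≠ 0 := by exact_mod_cast hjac.ne'
  push_cast
  field_simp

theorem ridge_recurrence (n : ℤ) (θ : ℝ) (z : ℂ) :
    ridgeCLM θ z * ridge n θ z = (ridge (n + 1) θ z + ridge (n - 1) θ z) / 2 := by
  have h := congrArg (Polynomial.eval (ridgeCLM θ z)) (Polynomial.Chebyshev.U_add_one ℝ n)
  simp only [Polynomial.eval_mul, Polynomial.eval_sub, Polynomial.eval_X, Polynomial.eval_ofNat] at h
  have e : ∀ n, ridge n θ z = (Polynomial.Chebyshev.U ℝ n).eval (ridgeCLM θ z) := fun _ => rfl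
  rw [e, e, e]
  linear_combination -(1 / 2) * h

/-- Every real functional on the plane has a direction and a length, so ridges in all directions θ
give access to moments along all functionals. -/
theorem ridgeCLM_polar (L : StrongDual ℝ ℂ) : ∃ ρ θ : ℝ, ∀ z, L z = ρ * ridgeCLM θ z := by
  set a : ℂ := L 1 + L Complex.I * Complex.I with ha
  refine ⟨‖a‖, a.arg, fun z => ?_⟩
  have h : L z = z.re * L 1 + z.im * L Complex.I := by
    conv_lhs => rw [← Complex.re_add_im z]
    have : (z.re : ℂ) + z.im * Complex.I = z.re • (1 : ℂ) + z.im • Complex.I := by simp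
    rw [this, map_add, map_smul, map_smul, smul_eq_mul, smul_eq_mul]
  have h2 : (‖a‖ : ℂ) * Complex.exp (-(a.arg * Complex.I)) = conj a := by
    conv_rhs => rw [← Complex.norm_mul_exp_arg_mul_I a]
    rw [map_mul, Complex.conj_ofReal, ← Complex.exp_conj, map_mul, Complex.conj_ofReal,
      Complex.conj_I, mul_neg]
  rw [ridgeCLM_apply, ← Complex.re_ofReal_mul, mul_left_comm, h2, h, ha]
  simp

/-- Multiplication of U_n by its argument gives (U_{n+1} + U_{n-1})/2. Orthogonality of f to all
ridges therefore annihilates every power of Re(Φ e^{-iθ}) against w f, and `ae_eq_zero_of_moments`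
applies to the injective map Φ. -/
theorem ridgeLp_total (hR : 0 < R) (hκ : R ^ 2 * |κ| < 1) :
    (Submodule.span ℂ (range fun i : ℕ × ℝ => ridgeLp hκ i.1 i.2)).topologicalClosure = ⊤ := by
  refine total_of_forall_inner_eq_zero fun f hf => ?_
  have := isFiniteMeasure_wdVol hκ
  obtain ⟨C, hC0, hC⟩ := exists_weight_le hκ
  let G : ℂ → ℂ := fun z => weight κ z * f z
  have hfi : Integrable f (wdVol κ R) := (Lp.memLp f).integrable (by norm_num)
  have hGi : Integrable G (wdVol κ R) := by
    refine Integrable.bdd_mul (c := C) hfi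
      (Complex.measurable_ofReal.comp (measurable_weight κ)).aestronglyMeasurable ?_
    filter_upwards [ae_norm_le_wdVol κ R] with z hz
    rw [Complex.norm_real, Real.norm_of_nonneg (weight_pos hκ hz).le]
    exact hC z hz
  -- Extending to all integers by U_{-1} = 0 and U_{-m-2} = -U_m spares the recurrence a special
  -- case at n = 0.
  have hmode : ∀ (θ : ℝ) (n : ℤ), ∫ z, (ridge n θ (Phi κ R z) : ℂ) * G z ∂(wdVol κ R) = 0 := by
    have hnat : ∀ (θ : ℝ) (n : ℕ), ∫ z, (ridge n θ (Phi κ R z) : ℂ) * G z ∂(wdVol κ R) = 0 := by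
      intro θ n
      rw [← hf (n, θ), inner_Lp_eq (coeFn_ridgeLp hκ n θ) (ae_eq_refl _)]
      refine integral_congr_ae (Filter.Eventually.of_forall fun z => ?_)
      simp only [conj_ridgeM]
      simp only [G, ridgeM]
      ring
    intro θ n
    obtain hn | hn := le_or_gt 0 n
    · lift n to ℕ using hn
      exact hnat θ n
    · obtain rfl | hn1 := eq_or_ne n (-1)
      · simp [ridge]
      · obtain ⟨m, hm⟩ : ∃ m : ℕ, n = -(m : ℤ) - 2 := ⟨(-n - 2).toNat, by omega⟩
        have h := hnat θ m
        subst hm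
        simp only [ridge, Polynomial.Chebyshev.U_neg_sub_two, Polynomial.eval_neg] at h ⊢
        simp only [Complex.ofReal_neg, neg_mul, integral_neg, h, neg_zero]
  have hbd : ∀ (θ : ℝ) (n : ℤ) (k : ℕ), Integrable (fun z => ((ridgeCLM θ (Phi κ R z) : ℝ) : ℂ) ^ k *
      ((ridge n θ (Phi κ R z) : ℂ) * G z)) (wdVol κ R) := by
    intro θ n k
    have hc : Continuous fun ζ : ℂ => ((ridgeCLM θ ζ : ℝ) : ℂ) ^ k * (ridge n θ ζ : ℂ) :=
      ((Complex.continuous_ofReal.comp (ridgeCLM θ).continuous).pow k).mul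
        (Complex.continuous_ofReal.comp (contDiff_ridge n θ).continuous)
    obtain ⟨D, hD⟩ := (isCompact_closedBall (0 : ℂ) 1).exists_bound_of_continuousOn hc.continuousOn
    refine (Integrable.bdd_mul (c := D) hGi
      (hc.measurable.comp (measurable_Phi κ R)).aestronglyMeasurable ?_).congr
      (Filter.Eventually.of_forall fun z => ?_)
    · filter_upwards [ae_norm_le_wdVol κ R] with z hz
      exact hD _ (by simpa using norm_Phi_le hR hκ hz)
    · simp only [Function.comp_apply]; ring
  have hmom : ∀ (θ : ℝ) (k : ℕ) (n : ℤ), ∫ z, ((ridgeCLM θ (Phi κ R z) : ℝ) : ℂ) ^ k *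
      ((ridge n θ (Phi κ R z) : ℂ) * G z) ∂(wdVol κ R) = 0 := by
    intro θ k
    induction k with
    | zero => intro n; simpa using hmode θ n
    | succ k ih =>
      intro n
      have e : ∀ z, ((ridgeCLM θ (Phi κ R z) : ℝ) : ℂ) ^ (k + 1) *
          ((ridge n θ (Phi κ R z) : ℂ) * G z)
          = (1 / 2) * (((ridgeCLM θ (Phi κ R z) : ℝ) : ℂ) ^ k *
            ((ridge (n + 1) θ (Phi κ R z) : ℂ) * G z))
          + (1 / 2) * (((ridgeCLM θ (Phi κ R z) : ℝ) : ℂ) ^ k *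
            ((ridge (n - 1) θ (Phi κ R z) : ℂ) * G z)) := by
        intro z
        have h := congrArg (fun x : ℝ => (x : ℂ)) (ridge_recurrence n θ (Phi κ R z))
        push_cast at h
        linear_combination ((ridgeCLM θ (Phi κ R z) : ℝ) : ℂ) ^ k * G z * h
      simp only [e]
      rw [integral_add ((hbd θ _ k).const_mul _) ((hbd θ _ k).const_mul _)]
      simp only [integral_const_mul, ih, mul_zero, add_zero]
  have hG0 : G =ᵐ[wdVol κ R] 0 := by
    refine ae_eq_zero_of_moments (measurable_Phi κ R) (measurable_PhiInv κ R) ?_ (C := 1) ?_ hGi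
      fun L n => ?_
    · filter_upwards [ae_norm_le_wdVol κ R] with z hz
      exact PhiInv_Phi hR hκ hz
    · filter_upwards [ae_norm_le_wdVol κ R] with z hz
      exact norm_Phi_le hR hκ hz
    · obtain ⟨ρ, θ, hL⟩ := ridgeCLM_polar L
      have h := hmom θ n 0
      simp only [ridge, Polynomial.Chebyshev.U_zero, Polynomial.eval_one, Complex.ofReal_one,
        one_mul] at h
      simp only [hL, Complex.ofReal_mul, mul_pow, mul_assoc, integral_const_mul, h, mul_zero]
  refine Lp.ext ?_
  filter_upwards [hG0, Lp.coeFn_zero ℂ 2 (wdVol κ R), ae_norm_le_wdVol κ R] with z h1 h2 hz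
  rw [h2]
  exact (mul_eq_zero.1 h1).resolve_left (ofReal_weight_ne_zero hκ hz)

theorem coreL_subset_diagGraph (hR : 0 < R) (hκ : R ^ 2 * |κ| < 1) :
    {p : L2M κ R × L2M κ R | ∃ u : ℂ → ℂ, ContDiffOn ℝ ∞ u (Metric.closedBall 0 R) ∧
    p.1 =ᵐ[wdVol κ R] u ∧ p.2 =ᵐ[wdVol κ R] Lfun κ R u}
      ⊆ diagGraph (fun i : ℕ × ℝ => ridgeLp hκ i.1 i.2) fun i => ((i.1 : ℤ) + 1 : ℝ) ^ 2 := by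
  rintro p ⟨u, hu, h1, h2⟩ ⟨n, θ⟩
  exact inner_ridgeLp_core hR hκ n θ hu h1 h2

theorem isPositivePurePoint_opL (hR : 0 < R) (hκ : R ^ 2 * |κ| < 1) :
    IsPositivePurePoint (opL κ R) :=
  isPositivePurePoint_closureOfCore (ridgeLp_total hR hκ)
    (fun i => ridgeLp_mem_core hR hκ i.1 i.2) (coreL_subset_diagGraph hR hκ)
    fun i => by push_cast; positivity

theorem ridgeLp_mem_eigenspace (hR : 0 < R) (hκ : R ^ 2 * |κ| < 1) (n : ℕ) (θ : ℝ) :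
    ridgeLp hκ n θ ∈ eigenspace (opL κ R) ((((n : ℤ) : ℝ) + 1) ^ 2) := by
  rw [mem_eigenspace, opL, closureOfCore_graph (ridgeLp_total hR hκ)
    (fun i => ridgeLp_mem_core hR hκ i.1 i.2) (coreL_subset_diagGraph hR hκ)]
  exact coreL_subset_diagGraph hR hκ (ridgeLp_mem_core hR hκ n θ)

end InteriorOperator
end XrayDisk

/-! ### Geodesics, their images under Φ, and the change of variables to chords. -/

namespace XrayDisk
noncomputable section Geodesics

variable {κ R : ℝ}

theorem hasDerivAt_tanh (x : ℝ) : HasDerivAt Real.tanh (1 - Real.tanh x ^ 2) x := by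
  have h := (Real.hasDerivAt_sinh x).div (Real.hasDerivAt_cosh x) (Real.cosh_pos x).ne'
  have e : Real.tanh = Real.sinh / Real.cosh := by
    funext y; exact Real.tanh_eq_sinh_div_cosh y
  rw [e]
  refine h.congr_deriv ?_
  have := (Real.cosh_pos x).ne'
  simp only [Pi.div_apply]
  field_simp

/-- A solution of `T' = 1 + κ T²` running from `0` to `m`. -/
theorem exists_riccati {κ m : ℝ} (hm : 0 < m) (h : 0 < 1 + κ * m ^ 2) :
    ∃ (τ : ℝ) (T : ℝ → ℝ), 0 < τ ∧ T 0 = 0 ∧ T τ = m ∧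
      ∀ t ∈ Icc 0 τ, HasDerivAt T (1 + κ * T t ^ 2) t ∧ 0 < 1 + κ * T t ^ 2 := by
  obtain hκ | rfl | hκ := lt_trichotomy κ 0
  · set s := Real.sqrt (-κ) with hs
    have hs0 : 0 < s := Real.sqrt_pos.2 (by linarith)
    have hs2 : s ^ 2 = -κ := Real.sq_sqrt (by linarith)
    have hsm : s * m ∈ Ioo 0 1 := by
      refine ⟨by positivity, ?_⟩
      by_contra! h1
      have : 1 ≤ (s * m) ^ 2 := one_le_pow₀ h1
      rw [mul_pow, hs2] at this
      linarith
    refine ⟨Real.artanh (s * m) / s, fun t => Real.tanh (s * t) / s, ?_, by simp, ?_, ?_⟩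
    · exact div_pos (Real.artanh_pos hsm) hs0
    · simp only
      rw [mul_div_cancel₀ _ hs0.ne', Real.tanh_artanh ⟨by linarith [hsm.1], hsm.2⟩,
        mul_div_cancel_left₀ _ hs0.ne']
    · intro t _
      have e : 1 + κ * (Real.tanh (s * t) / s) ^ 2 = 1 - Real.tanh (s * t) ^ 2 := by
        have := hκ.ne
        rw [div_pow, hs2]
        field_simp
        ring
      rw [e]
      constructor
      · have h1 := (((hasDerivAt_tanh (s * t)).comp t ((hasDerivAt_id t).const_mul s)).div_const s)
        refine h1.congr_deriv ?_
        field_simp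
      · have := Real.tanh_sq_lt_one (s * t)
        linarith
  · refine ⟨m, id, hm, rfl, rfl, fun t _ => ⟨?_, by simp⟩⟩
    simpa using hasDerivAt_id t
  · set s := Real.sqrt κ with hs
    have hs0 : 0 < s := Real.sqrt_pos.2 hκ
    have hs2 : s ^ 2 = κ := Real.sq_sqrt hκ.le
    refine ⟨Real.arctan (s * m) / s, fun t => Real.tan (s * t) / s, ?_, by simp, ?_, ?_⟩
    · exact div_pos (Real.arctan_pos.2 (by positivity)) hs0
    · simp only
      rw [mul_div_cancel₀ _ hs0.ne', Real.tan_arctan, mul_div_cancel_left₀ _ hs0.ne']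
    · intro t ht
      refine ⟨?_, by positivity⟩
      have h1 : s * t ≤ Real.arctan (s * m) := by
        have := ht.2
        rw [le_div_iff₀ hs0] at this
        linarith
      have hc : 0 < Real.cos (s * t) := by
        refine Real.cos_pos_of_mem_Ioo ⟨?_, h1.trans_lt (Real.arctan_lt_pi_div_two _)⟩
        have := mul_nonneg hs0.le ht.1
        linarith [Real.pi_pos]
      have h2 := (((Real.hasDerivAt_tan hc.ne').comp t ((hasDerivAt_id t).const_mul s)).div_const s)
      refine h2.congr_deriv ?_
      simp only [Real.tan_eq_sin_div_cos]
      rw [← hs2]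
      have := Real.sin_sq_add_cos_sq (s * t)
      field_simp
      linear_combination -this

/-- The Möbius parametrization of a geodesic issued from a boundary point. -/
def moebius (κ R : ℝ) (a : ℂ) (T : ℝ) : ℂ := (R - a * T) / (1 + κ * R * a * T)

theorem normSq_moebius_num {a : ℂ} (ha : ‖a‖ = 1) (T : ℝ) :
    Complex.normSq (R - a * T) = R ^ 2 + T ^ 2 - 2 * R * T * a.re := by
  have h : a.re * a.re + a.im * a.im = 1 := by
    rw [← Complex.normSq_apply, Complex.normSq_eq_norm_sq, ha, one_pow]
  rw [Complex.normSq_apply]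
  simp
  linear_combination T ^ 2 * h

theorem normSq_moebius_den {a : ℂ} (ha : ‖a‖ = 1) (T : ℝ) :
    Complex.normSq (1 + κ * R * a * T)
      = 1 + 2 * κ * R * T * a.re + κ ^ 2 * R ^ 2 * T ^ 2 := by
  have h : a.re * a.re + a.im * a.im = 1 := by
    rw [← Complex.normSq_apply, Complex.normSq_eq_norm_sq, ha, one_pow]
  rw [Complex.normSq_apply]
  simp
  linear_combination κ ^ 2 * R ^ 2 * T ^ 2 * h

/-- The numerator of `1 - κ |γ|²` along a geodesic. -/
def chordDen (κ R c T : ℝ) : ℝ := (1 - κ * R ^ 2) * (1 - κ * T ^ 2) + 4 * κ * R * T * c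

/-- The parameters that lie on the geodesic inside M: T = 0 is the starting point and equality in
`le` is the exit point. In the application a = e^{iα} and T solves the Riccati equation in arc
length, `pos` being the positivity of T'. -/
structure ChordTime (κ R : ℝ) (a : ℂ) (T : ℝ) : Prop where
  norm_eq : ‖a‖ = 1
  re_pos : 0 < a.re
  nonneg : 0 ≤ T
  le : (1 - κ * R ^ 2) * T ≤ 2 * R * a.re
  pos : 0 < 1 + κ * T ^ 2

variable {a : ℂ} {T : ℝ}

theorem ChordTime.den_pos (h : ChordTime κ R a T) (hR : 0 < R) (hκ : R ^ 2 * |κ| < 1) :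
    0 < 1 + 2 * κ * R * T * a.re + κ ^ 2 * R ^ 2 * T ^ 2 := by
  have h0 := h.re_pos
  have h1 := h.nonneg
  obtain hk | hk := le_or_gt 0 κ
  · positivity
  · have e1 := one_add_pos hκ
    have h2 : 0 ≤ R ^ 2 + T ^ 2 - 2 * R * T * a.re := by
      rw [← normSq_moebius_num h.norm_eq]; exact Complex.normSq_nonneg _
    have h3 : 1 + 2 * κ * R * T * a.re + κ ^ 2 * R ^ 2 * T ^ 2
        = (1 + κ * R ^ 2) * (1 + κ * T ^ 2) + (-κ) * (R ^ 2 + T ^ 2 - 2 * R * T * a.re) := by ring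
    rw [h3]
    have := mul_pos e1 h.pos
    have := mul_nonneg (neg_nonneg.2 hk.le) h2
    linarith

theorem ChordTime.den_ne_zero (h : ChordTime κ R a T) (hR : 0 < R) (hκ : R ^ 2 * |κ| < 1) :
    (1 + κ * R * a * T : ℂ) ≠ 0 := by
  rw [← Complex.normSq_pos, normSq_moebius_den h.norm_eq]
  exact h.den_pos hR hκ

theorem ChordTime.norm_sq (h : ChordTime κ R a T) :
    ‖moebius κ R a T‖ ^ 2 = (R ^ 2 + T ^ 2 - 2 * R * T * a.re) /
      (1 + 2 * κ * R * T * a.re + κ ^ 2 * R ^ 2 * T ^ 2) := by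
  rw [← Complex.normSq_eq_norm_sq, moebius, Complex.normSq_div, normSq_moebius_num h.norm_eq,
    normSq_moebius_den h.norm_eq]

theorem ChordTime.one_add (h : ChordTime κ R a T) (hR : 0 < R) (hκ : R ^ 2 * |κ| < 1) :
    1 + κ * ‖moebius κ R a T‖ ^ 2 = (1 + κ * R ^ 2) * (1 + κ * T ^ 2) /
      (1 + 2 * κ * R * T * a.re + κ ^ 2 * R ^ 2 * T ^ 2) := by
  have := h.den_pos hR hκ
  rw [h.norm_sq, eq_div_iff this.ne', add_mul, mul_assoc κ (_ / _), div_mul_cancel₀ _ this.ne']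
  ring

theorem ChordTime.one_sub (h : ChordTime κ R a T) (hR : 0 < R) (hκ : R ^ 2 * |κ| < 1) :
    1 - κ * ‖moebius κ R a T‖ ^ 2 = chordDen κ R a.re T /
      (1 + 2 * κ * R * T * a.re + κ ^ 2 * R ^ 2 * T ^ 2) := by
  have := h.den_pos hR hκ
  rw [h.norm_sq, chordDen, eq_div_iff this.ne', sub_mul, mul_assoc κ (_ / _), div_mul_cancel₀ _ this.ne']
  ring

theorem ChordTime.sq_sub (h : ChordTime κ R a T) (hR : 0 < R) (hκ : R ^ 2 * |κ| < 1) :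
    R ^ 2 - ‖moebius κ R a T‖ ^ 2 = T * (1 + κ * R ^ 2) * (2 * R * a.re - (1 - κ * R ^ 2) * T) /
      (1 + 2 * κ * R * T * a.re + κ ^ 2 * R ^ 2 * T ^ 2) := by
  have := h.den_pos hR hκ
  rw [h.norm_sq, eq_div_iff this.ne', sub_mul, div_mul_cancel₀ _ this.ne']
  ring

theorem ChordTime.norm_le (h : ChordTime κ R a T) (hR : 0 < R) (hκ : R ^ 2 * |κ| < 1) :
    ‖moebius κ R a T‖ ≤ R := by
  have h1 := h.den_pos hR hκ
  have h2 := h.nonneg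
  have h3 := one_add_pos hκ
  have h4 := sub_nonneg.2 h.le
  have h5 : 0 ≤ R ^ 2 - ‖moebius κ R a T‖ ^ 2 := by rw [h.sq_sub hR hκ]; positivity
  exact le_of_sq_le_sq (by linarith) hR.le

theorem ChordTime.chordDen_pos (h : ChordTime κ R a T) (hR : 0 < R) (hκ : R ^ 2 * |κ| < 1) :
    0 < chordDen κ R a.re T := by
  have h1 := one_sub_norm_pos hκ (h.norm_le hR hκ)
  rw [h.one_sub hR hκ] at h1
  exact (div_pos_iff_of_pos_right (h.den_pos hR hκ)).1 h1

theorem norm_mul_unit {c : ℂ} (hc : ‖c‖ = 1) (z : ℂ) : ‖c * z‖ = ‖z‖ := by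
  rw [norm_mul, hc, one_mul]

theorem ChordTime.weight_eq (h : ChordTime κ R a T) (hR : 0 < R) (hκ : R ^ 2 * |κ| < 1)
    {c : ℂ} (hc : ‖c‖ = 1) :
    weight κ (c * moebius κ R a T)
      = (1 + κ * R ^ 2) * (1 + κ * T ^ 2) / chordDen κ R a.re T := by
  have h1 := h.den_pos hR hκ
  rw [weight, norm_mul_unit hc, h.one_add hR hκ, h.one_sub hR hκ, div_div_div_cancel_right₀ h1.ne']

/-- The image under `Phi` of a geodesic is a chord of the unit disk. -/
theorem ChordTime.Phi_eq (h : ChordTime κ R a T) (hR : 0 < R) (hκ : R ^ 2 * |κ| < 1)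
    {c : ℂ} (hc : ‖c‖ = 1) :
    Phi κ R (c * moebius κ R a T)
      = c * (1 - (T * (1 + κ * R ^ 2) / (R * chordDen κ R a.re T) : ℝ) *
        ((1 + κ * R ^ 2) * a.re + (1 - κ * R ^ 2) * a.im * Complex.I)) := by
  have h1 := h.den_pos hR hκ
  have h2 := h.chordDen_pos hR hκ
  have h3 := h.den_ne_zero hR hκ
  rw [Phi, norm_mul_unit hc, h.one_sub hR hκ, moebius]
  have hconj : (1 + κ * R * conj a * T : ℂ) * (1 + κ * R * a * T)
      = ((1 + 2 * κ * R * T * a.re + κ ^ 2 * R ^ 2 * T ^ 2 : ℝ) : ℂ) := by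
    rw [← normSq_moebius_den h.norm_eq, Complex.normSq_eq_conj_mul_self]
    simp
  have hone : a * conj a = 1 := by
    rw [Complex.mul_conj, Complex.normSq_eq_norm_sq, h.norm_eq]; simp
  have hN : (chordDen κ R a.re T : ℂ) ≠ 0 := by exact_mod_cast h2.ne'
  have hR' : (R : ℂ) ≠ 0 := by exact_mod_cast hR.ne'
  have e1 : (((1 - κ * R ^ 2) / (chordDen κ R a.re T /
      (1 + 2 * κ * R * T * a.re + κ ^ 2 * R ^ 2 * T ^ 2)) / R : ℝ) : ℂ)
      = (1 - κ * R ^ 2) * ((1 + κ * R * conj a * T : ℂ) * (1 + κ * R * a * T))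
        / chordDen κ R a.re T / R := by
    rw [hconj]
    push_cast
    field_simp
  rw [e1]
  have e2 : (chordDen κ R a.re T : ℂ)
      = (1 - κ * R ^ 2) * (1 - κ * T ^ 2) + 2 * κ * R * T * (a + conj a) := by
    rw [chordDen]
    push_cast
    rw [Complex.re_eq_add_conj]
    ring
  have e3 : ((1 + κ * R ^ 2) * a.re + (1 - κ * R ^ 2) * a.im * Complex.I : ℂ)
      = a + κ * R ^ 2 * conj a := by
    rw [Complex.re_eq_add_conj, Complex.im_eq_sub_conj]
    field_simp
    ring
  have hc0 : c ≠ 0 := by rw [← norm_ne_zero_iff, hc]; norm_num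
  rw [e3]
  push_cast
  generalize hD : (1 + κ * R * a * T : ℂ) = D at h3 ⊢
  field_simp
  rw [e2]
  linear_combination (-(κ * R * T ^ 2 * (1 - κ * R ^ 2)) : ℂ) * hone

theorem hasDerivAt_moebius (h3 : (1 + κ * R * a * T : ℂ) ≠ 0) :
    HasDerivAt (moebius κ R a) (-(1 + κ * R ^ 2) * a / (1 + κ * R * a * T) ^ 2) T := by
  have h0 : HasDerivAt (fun t : ℝ => (t : ℂ)) 1 T := Complex.ofRealCLM.hasDerivAt
  have h := ((h0.const_mul a).const_sub (R : ℂ)).div ((h0.const_mul (κ * R * a : ℂ)).const_add 1) h3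
  refine h.congr_deriv ?_
  field_simp
  ring

/-- The left side is the acceleration prescribed by the geodesic equation; the right side is the
derivative in t of the explicit velocity, that is, its T-derivative times 1 + κT². Besides
`ChordTime.one_add`, only a ā = 1 and c c̄ = 1 enter. -/
theorem geodesic_algebra (hR : 0 < R) (hκ : R ^ 2 * |κ| < 1) (h : ChordTime κ R a T) {c : ℂ}
    (hc : ‖c‖ = 1) :
    2 * κ * conj (c * moebius κ R a T) *
      (-(1 + κ * R ^ 2) * c * a * (1 + κ * T ^ 2) / (1 + κ * R * a * T) ^ 2) ^ 2 /
      (1 + κ * (‖c * moebius κ R a T‖ : ℂ) ^ 2)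
    = -(1 + κ * R ^ 2) * c * a * (2 * κ * (1 + κ * T ^ 2) * (T - R * a)) /
      (1 + κ * R * a * T) ^ 3 := by
  have h1 := h.den_pos hR hκ
  have h3 := h.den_ne_zero hR hκ
  have e0 : (1 + κ * (‖c * moebius κ R a T‖ : ℂ) ^ 2)
      = ((1 + κ * R ^ 2) * (1 + κ * T ^ 2) : ℂ) /
        ((1 + κ * R * conj a * T : ℂ) * (1 + κ * R * a * T)) := by
    have hconj : (1 + κ * R * conj a * T : ℂ) * (1 + κ * R * a * T)
        = ((1 + 2 * κ * R * T * a.re + κ ^ 2 * R ^ 2 * T ^ 2 : ℝ) : ℂ) := by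
      rw [← normSq_moebius_den h.norm_eq, Complex.normSq_eq_conj_mul_self]
      simp
    rw [hconj, norm_mul_unit hc]
    have := congrArg (fun x : ℝ => (x : ℂ)) (h.one_add hR hκ)
    push_cast at this ⊢
    exact this
  have hc' : (1 + κ * R * conj a * T : ℂ) ≠ 0 := by
    have := (map_ne_zero (starRingEnd ℂ)).2 h3
    simpa using this
  have hone : a * conj a = 1 := by
    rw [Complex.mul_conj, Complex.normSq_eq_norm_sq, h.norm_eq]; simp
  have honec : c * conj c = 1 := by
    rw [Complex.mul_conj, Complex.normSq_eq_norm_sq, hc]; simp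
  have k1 : (1 + κ * R ^ 2 : ℂ) ≠ 0 := by exact_mod_cast (one_add_pos hκ).ne'
  have k2 : (1 + κ * T ^ 2 : ℂ) ≠ 0 := by exact_mod_cast h.pos.ne'
  have hc0 : c ≠ 0 := by rw [← norm_ne_zero_iff, hc]; norm_num
  have ha0 : a ≠ 0 := by rw [← norm_ne_zero_iff, h.norm_eq]; norm_num
  rw [e0, moebius, map_mul, map_div₀]
  simp only [map_add, map_sub, map_mul, map_one, Complex.conj_ofReal]
  generalize hD : (1 + κ * R * a * T : ℂ) = D at h3 ⊢
  generalize hD' : (1 + κ * R * conj a * T : ℂ) = D' at hc' ⊢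
  generalize hk : (1 + κ * R ^ 2 : ℂ) = k at k1 ⊢
  generalize hT' : (1 + κ * T ^ 2 : ℂ) = T' at k2 ⊢
  field_simp
  linear_combination (κ * (R * a - a * conj a * T) : ℂ) * honec - κ * T * hone

theorem angDen_lamC (hκ : R ^ 2 * |κ| < 1) (α : ℝ) :
    (1 + κ * R ^ 2) ^ 2 * angDen (lamC κ R) α = (1 - κ * R ^ 2) ^ 2 + 4 * (κ * R ^ 2) * Real.cos α ^ 2 := by
  have h1 := (one_add_pos hκ).ne'
  have h2 := Real.sin_sq α
  rw [angDen, lamC, h2]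
  field_simp
  ring

theorem cos_scat (hκ : R ^ 2 * |κ| < 1) {α : ℝ} (hα : |α| < Real.pi / 2) :
    Real.cos (scat κ R α) = Real.cos α / Real.sqrt (angDen (lamC κ R) α) := by
  have h := congrArg Complex.re (exp_scat hκ hα)
  rw [Complex.exp_ofReal_mul_I_re, angExp, Complex.div_ofReal_re] at h
  simpa [Complex.cos_ofReal_re] using h

theorem scat_mem (κ R α : ℝ) : scat κ R α ∈ Ioo (-(Real.pi / 2)) (Real.pi / 2) :=
  Real.arctan_mem_Ioo _

theorem cos_scat_pos (κ R α : ℝ) : 0 < Real.cos (scat κ R α) := Real.cos_arctan_pos _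

/-- The factor between the arc length along a geodesic and along a chord of the unit disk. -/
def chordConst (κ R α : ℝ) : ℝ := R / ((1 - κ * R ^ 2) * Real.sqrt (angDen (lamC κ R) α))

theorem sqrt_angDen_pos (hκ : R ^ 2 * |κ| < 1) (α : ℝ) :
    0 < Real.sqrt (angDen (lamC κ R) α) := Real.sqrt_pos.2 (angDen_pos (lamC_pos hκ) α)

theorem chordConst_pos (hR : 0 < R) (hκ : R ^ 2 * |κ| < 1) (α : ℝ) : 0 < chordConst κ R α := by
  have h1 := one_sub_pos hκ
  have h2 := sqrt_angDen_pos hκ α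
  rw [chordConst]
  positivity

/-- The point of `M` at position `y` of the chord that corresponds to the geodesic of `p`. -/
def geoPt (κ R : ℝ) (p : S1 × ℝ) (y : ℝ) : ℂ :=
  PhiInv κ R (chordPt ((AddCircle.toCircle p.1 : ℂ) * angExp (lamC κ R) p.2) (scat κ R p.2) y)

/-- The integrand of the X-ray transform, along the corresponding chord of the unit disk. -/
def chordFun (κ R : ℝ) (f : ℂ → ℂ) (p : S1 × ℝ) (y : ℝ) : ℂ :=
  (chordConst κ R p.2 : ℂ) * (f (geoPt κ R p y) / (weight κ (geoPt κ R p y) : ℂ) ^ 2)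

/-- The position on the chord, measured from its initial point, at the parameter `T`. -/
def chordPos (κ R α T : ℝ) : ℝ :=
  (1 + κ * R ^ 2) ^ 2 * Real.sqrt (angDen (lamC κ R) α) / R * (T / chordDen κ R (Real.cos α) T)

theorem hasDerivAt_chordPos {α T : ℝ} (h : chordDen κ R (Real.cos α) T ≠ 0) :
    HasDerivAt (chordPos κ R α) ((1 + κ * R ^ 2) ^ 2 * Real.sqrt (angDen (lamC κ R) α) / R *
      ((1 - κ * R ^ 2) * (1 + κ * T ^ 2) / chordDen κ R (Real.cos α) T ^ 2)) T := by
  have hN : HasDerivAt (chordDen κ R (Real.cos α))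
      ((1 - κ * R ^ 2) * (-(κ * (2 * T))) + 4 * κ * R * Real.cos α) T := by
    have h1 := ((((hasDerivAt_id T).fun_pow 2).const_mul κ).const_sub 1).const_mul (1 - κ * R ^ 2)
    have h2 := ((hasDerivAt_id T).const_mul (4 * κ * R)).mul_const (Real.cos α)
    refine (h1.add h2).congr_deriv ?_
    simp
  have h3 := ((hasDerivAt_id T).div hN h).const_mul
    ((1 + κ * R ^ 2) ^ 2 * Real.sqrt (angDen (lamC κ R) α) / R)
  refine h3.congr_deriv ?_
  simp only [id, chordDen]
  congr 2
  ring

theorem norm_toCircle (b : S1) : ‖(AddCircle.toCircle b : ℂ)‖ = 1 := Circle.norm_coe _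

/-- The X-ray transform is an integral along chords of the unit disk. -/
theorem hasXray_of_integrableOn (hR : 0 < R) (hκ : R ^ 2 * |κ| < 1) {p : S1 × ℝ}
    (hp : |p.2| < Real.pi / 2) {f : ℂ → ℂ}
    (hf : IntegrableOn (chordFun κ R f p)
      (Icc (-Real.cos (scat κ R p.2)) (Real.cos (scat κ R p.2)))) :
    HasXray κ R f p (∫ y in Icc (-Real.cos (scat κ R p.2)) (Real.cos (scat κ R p.2)),
      chordFun κ R f p y) := by
  obtain ⟨b, α⟩ := p
  simp only at hp hf ⊢
  set c : ℂ := (AddCircle.toCircle b : ℂ) with hcdef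
  have hc : ‖c‖ = 1 := norm_toCircle b
  set a : ℂ := Complex.exp (α * Complex.I) with ha
  have han : ‖a‖ = 1 := Complex.norm_exp_ofReal_mul_I α
  have hare : a.re = Real.cos α := Complex.exp_ofReal_mul_I_re α
  have haim : a.im = Real.sin α := Complex.exp_ofReal_mul_I_im α
  have hcos : 0 < Real.cos α := Real.cos_pos_of_mem_Ioo (abs_lt.1 hp)
  have k1 := one_sub_pos hκ
  have k2 := one_add_pos hκ
  have hsq := sqrt_angDen_pos hκ α
  set S := Real.sqrt (angDen (lamC κ R) α) with hS
  have hS2 : S ^ 2 = angDen (lamC κ R) α := Real.sq_sqrt (angDen_pos (lamC_pos hκ) α).le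
  have hden := angDen_lamC hκ α
  rw [← hS2] at hden
  -- The value of T at the exit: by `ChordTime.sq_sub` the curve meets the boundary exactly at T = 0
  -- and T = m.
  set m := 2 * R * Real.cos α / (1 - κ * R ^ 2) with hm
  have hm0 : 0 < m := by positivity
  have hmk : (1 - κ * R ^ 2) * m = 2 * R * Real.cos α := by rw [hm]; field_simp
  have hm1 : 0 < 1 + κ * m ^ 2 := by
    have h1 : (1 - κ * R ^ 2) ^ 2 * (1 + κ * m ^ 2) = (1 + κ * R ^ 2) ^ 2 * S ^ 2 := by
      rw [hden]
      linear_combination κ * ((1 - κ * R ^ 2) * m + 2 * R * Real.cos α) * hmk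
    exact pos_of_mul_pos_right (by rw [h1]; positivity) (sq_nonneg (1 - κ * R ^ 2))
  obtain ⟨τ, T, hτ, hT0, hTτ, hT⟩ := exists_riccati hm0 hm1
  have hTc : ContinuousOn T (Icc 0 τ) := fun t ht => (hT t ht).1.continuousAt.continuousWithinAt
  have hmono : StrictMonoOn T (Icc 0 τ) := by
    refine strictMonoOn_of_deriv_pos (convex_Icc 0 τ) hTc fun t ht => ?_
    rw [interior_Icc] at ht
    rw [(hT t (Ioo_subset_Icc_self ht)).1.deriv]
    exact (hT t (Ioo_subset_Icc_self ht)).2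
  have h0m : (0 : ℝ) ∈ Icc 0 τ := ⟨le_rfl, hτ.le⟩
  have hτm : τ ∈ Icc 0 τ := ⟨hτ.le, le_rfl⟩
  have hct : ∀ t ∈ Icc 0 τ, ChordTime κ R a (T t) := by
    intro t ht
    have h1 : T t ≤ m := hTτ ▸ hmono.monotoneOn ht hτm ht.2
    refine ⟨han, by rw [hare]; exact hcos, hT0 ▸ hmono.monotoneOn h0m ht ht.1, ?_, (hT t ht).2⟩
    rw [hare, ← hmk]
    gcongr
  let γ : ℝ → ℂ := fun t => c * moebius κ R a (T t)
  -- The velocity as a function of T, namely the derivative of the Möbius curve times T' = 1 + κT².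
  let V : ℝ → ℂ := fun T => -(1 + κ * R ^ 2) * c * a * (1 + κ * T ^ 2) / (1 + κ * R * a * T) ^ 2
  let γ' : ℝ → ℂ := fun t => V (T t)
  have hγ : ∀ t ∈ Icc 0 τ, HasDerivAt γ (γ' t) t := by
    intro t ht
    have h1 := ((hasDerivAt_moebius ((hct t ht).den_ne_zero hR hκ)).scomp t (hT t ht).1).const_mul c
    refine h1.congr_deriv ?_
    simp only [γ', V, Complex.real_smul]
    push_cast
    ring
  have hγ' : ∀ t ∈ Icc 0 τ, HasDerivAt γ'
      (2 * κ * conj (γ t) * γ' t ^ 2 / (1 + κ * (‖γ t‖ : ℂ) ^ 2)) t := by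
    intro t ht
    have h3 := (hct t ht).den_ne_zero hR hκ
    have h0 : HasDerivAt (fun t : ℝ => (t : ℂ)) 1 (T t) := Complex.ofRealCLM.hasDerivAt
    have hV := ((((h0.fun_pow 2).const_mul (κ : ℂ)).const_add 1).const_mul
      (-(1 + κ * R ^ 2) * c * a : ℂ)).div
      (((h0.const_mul (κ * R * a : ℂ)).const_add 1).fun_pow 2) (pow_ne_zero 2 h3)
    have h1 := hV.scomp t (hT t ht).1
    refine h1.congr_deriv ?_
    have halg := geodesic_algebra hR hκ (hct t ht) hc
    simp only [γ, γ', V]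
    rw [halg, Complex.real_smul]
    push_cast
    field_simp
    ring
  have hgeo : IsGeodesicChord κ R (basePoint R (b, α)) (inwardVec κ R (b, α)) τ γ γ' := by
    refine ⟨hτ, ?_, ?_, fun t ht => (hγ t ht).hasDerivWithinAt,
      fun t ht => (hγ' t ht).hasDerivWithinAt, fun t ht => ?_, ?_⟩
    · simp only [γ, hT0, moebius, basePoint]
      push_cast
      rw [mul_zero, mul_zero, sub_zero, add_zero, div_one, mul_comm]
    · simp only [γ', V, hT0, inwardVec]
      push_cast
      rw [add_mul (Real.pi : ℂ), Complex.exp_add, Complex.exp_pi_mul_I, ← ha, ← hcdef]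
      ring
    · have ht' := Ioo_subset_Icc_self ht
      have h1 : 0 < T t := hT0 ▸ hmono h0m ht' ht.1
      have h2 : T t < m := hTτ ▸ hmono ht' hτm ht.2
      have h3 : 0 < 2 * R * a.re - (1 - κ * R ^ 2) * T t := by
        rw [hare, ← hmk, ← mul_sub]
        exact mul_pos k1 (sub_pos.2 h2)
      have h4 := (hct t ht').den_pos hR hκ
      have h5 : 0 < R ^ 2 - ‖moebius κ R a (T t)‖ ^ 2 := by
        rw [(hct t ht').sq_sub hR hκ]; positivity
      simp only [γ]
      rw [norm_mul_unit hc]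
      exact lt_of_pow_lt_pow_left₀ 2 hR.le (by linarith)
    · have h5 : R ^ 2 - ‖moebius κ R a (T τ)‖ ^ 2 = 0 := by
        rw [(hct τ hτm).sq_sub hR hκ, hTτ, hmk, hare]; simp
      simp only [γ]
      rw [norm_mul_unit hc]
      exact (pow_left_inj₀ (norm_nonneg _) hR.le two_ne_zero).1 (by linarith)
  have hcs : Real.cos (scat κ R α) = Real.cos α / S := cos_scat hκ hp
  -- The position on the chord decreases from cos 𝔰 to -cos 𝔰, because the entry point e^{iβ} is the
  -- end y = cos 𝔰 of the chord in direction e^{iβ}E.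
  let y : ℝ → ℝ := fun t => Real.cos (scat κ R α) - chordPos κ R α (T t)
  have hpos : ∀ t ∈ Icc 0 τ, 0 < chordDen κ R (Real.cos α) (T t) := fun t ht => by
    rw [← hare]; exact (hct t ht).chordDen_pos hR hκ
  have hy' : ∀ t ∈ Icc 0 τ,
      HasDerivAt y (-(weight κ (γ t) ^ 2 / chordConst κ R α)) t := by
    intro t ht
    have h1 := ((hasDerivAt_chordPos (hpos t ht).ne').comp t (hT t ht).1).const_sub
      (Real.cos (scat κ R α))
    refine h1.congr_deriv ?_
    have hN := (hpos t ht).ne'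
    simp only [γ]
    rw [(hct t ht).weight_eq hR hκ hc, hare, chordConst, ← hS]
    field_simp
  have hwpos : ∀ t ∈ Icc 0 τ, 0 < weight κ (γ t) ^ 2 / chordConst κ R α := by
    intro t ht
    have h1 : ‖γ t‖ ≤ R := by
      simp only [γ]; rw [norm_mul_unit hc]; exact (hct t ht).norm_le hR hκ
    have := weight_pos hκ h1
    have := chordConst_pos hR hκ α
    positivity
  have hanti : StrictAntiOn y (Icc 0 τ) := by
    refine strictAntiOn_of_deriv_neg (convex_Icc 0 τ)
      (fun t ht => (hy' t ht).continuousAt.continuousWithinAt) fun t ht => ?_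
    rw [interior_Icc] at ht
    rw [(hy' t (Ioo_subset_Icc_self ht)).deriv]
    exact neg_neg_of_pos (hwpos t (Ioo_subset_Icc_self ht))
  have hy0 : y 0 = Real.cos (scat κ R α) := by simp [y, hT0, chordPos]
  have hyτ : y τ = -Real.cos (scat κ R α) := by
    have h1 : chordDen κ R (Real.cos α) m * (1 - κ * R ^ 2) = (1 + κ * R ^ 2) ^ 2 * S ^ 2 := by
      rw [hden, chordDen]
      linear_combination κ * (2 * R * Real.cos α - (1 - κ * R ^ 2) * m) * hmk
    have h2 : 0 < chordDen κ R (Real.cos α) m := hTτ ▸ hpos τ hτm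
    simp only [y, hTτ, chordPos]
    have h3 : (1 + κ * R ^ 2) ^ 2 * S / R * (m / chordDen κ R (Real.cos α) m)
        = 2 * Real.cos α / S := by
      rw [div_mul_div_comm, div_eq_div_iff (by positivity) hsq.ne']
      linear_combination -m * h1 + chordDen κ R (Real.cos α) m * hmk
    rw [hcs, h3]
    ring
  have himage : y '' Icc 0 τ = Icc (-Real.cos (scat κ R α)) (Real.cos (scat κ R α)) := by
    rw [ContinuousOn.image_Icc_of_antitoneOn hτ.le
      (fun t ht => (hy' t ht).continuousAt.continuousWithinAt) hanti.antitoneOn, hy0, hyτ]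
  have hpt : ∀ t ∈ Icc 0 τ, geoPt κ R (b, α) (y t) = γ t := by
    intro t ht
    have h1 : ‖γ t‖ ≤ R := by
      simp only [γ]; rw [norm_mul_unit hc]; exact (hct t ht).norm_le hR hκ
    rw [← PhiInv_Phi hR hκ h1, geoPt]
    congr 1
    simp only [γ]
    rw [(hct t ht).Phi_eq hR hκ hc, chordPt, hare, haim]
    -- E e^{-i𝔰} = 1 identifies the entry point; the identity `hA` below identifies the direction of
    -- motion with that of the chord.
    have hE : angExp (lamC κ R) α * ((Real.cos (scat κ R α) : ℂ) - Real.sin (scat κ R α) * Complex.I) = 1 := by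
      rw [← exp_scat hκ hp, Complex.exp_mul_I]
      push_cast
      have := Complex.cos_sq_add_sin_sq (scat κ R α : ℂ)
      linear_combination this - Complex.sin (scat κ R α : ℂ) ^ 2 * Complex.I_sq
    have hA : ((1 + κ * R ^ 2) * (Real.cos α) + (1 - κ * R ^ 2) * Real.sin α * Complex.I : ℂ)
        = (1 + κ * R ^ 2) * S * angExp (lamC κ R) α := by
      have e1 : (S : ℂ) ≠ 0 := by exact_mod_cast hsq.ne'
      have e2 : (1 + κ * R ^ 2 : ℂ) ≠ 0 := by exact_mod_cast k2.ne'
      rw [angExp, ← hS, lamC]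
      push_cast
      field_simp
    rw [hA]
    simp only [y, chordPos, ← hS]
    push_cast at hE ⊢
    linear_combination c * hE
  -- The factor w⁻² and the constant in `chordFun` are those that cancel |dy/dt|.
  have hval : ∀ t ∈ Icc 0 τ, |(-(weight κ (γ t) ^ 2 / chordConst κ R α))| •
      chordFun κ R f (b, α) (y t) = f (γ t) := by
    intro t ht
    have h1 := hwpos t ht
    have h2 : (weight κ (γ t) : ℂ) ≠ 0 := by
      intro h0
      have : weight κ (γ t) = 0 := by exact_mod_cast h0
      simp [this] at h1
    have h3 : (chordConst κ R α : ℂ) ≠ 0 := by exact_mod_cast (chordConst_pos hR hκ α).ne'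
    rw [abs_neg, abs_of_pos h1, chordFun, hpt t ht, Complex.real_smul]
    push_cast
    field_simp
  refine ⟨τ, γ, γ', hgeo, ?_, ?_⟩
  · rw [intervalIntegrable_iff_integrableOn_Icc_of_le hτ.le]
    rw [← himage, integrableOn_image_iff_integrableOn_abs_deriv_smul measurableSet_Icc
      (fun t ht => (hy' t ht).hasDerivWithinAt) hanti.injOn] at hf
    exact hf.congr_fun hval measurableSet_Icc
  · rw [← himage, integral_image_eq_integral_abs_deriv_smul measurableSet_Icc
      (fun t ht => (hy' t ht).hasDerivWithinAt) hanti.injOn,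
      setIntegral_congr_fun measurableSet_Icc hval, integral_Icc_eq_integral_Ioc,
      intervalIntegral.integral_of_le hτ.le]

end Geodesics
end XrayDisk

/-! ### The X-ray transform as a bounded operator: Santaló's formula and the L² bound. -/

namespace XrayDisk
noncomputable section Transform

variable {κ R : ℝ}

theorem scat_image (hκ : R ^ 2 * |κ| < 1) :
    scat κ R '' Ioo (-(Real.pi / 2)) (Real.pi / 2) = Ioo (-(Real.pi / 2)) (Real.pi / 2) := by
  have hl := lamC_pos hκ
  refine Subset.antisymm (image_subset_iff.2 fun a _ => scat_mem κ R a) fun s hs => ?_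
  refine ⟨Real.arctan (Real.tan s / lamC κ R), Real.arctan_mem_Ioo _, ?_⟩
  change Real.arctan (lamC κ R * _) = s
  rw [Real.tan_arctan, mul_div_cancel₀ _ hl.ne', Real.arctan_tan hs.1 hs.2]

theorem scat_injOn (hκ : R ^ 2 * |κ| < 1) :
    InjOn (scat κ R) (Ioo (-(Real.pi / 2)) (Real.pi / 2)) := fun _ ha _ hb h =>
  Real.injOn_tan ha hb (mul_left_cancel₀ (lamC_pos hκ).ne' (Real.arctan_injective h))

theorem measurable_toCircle : Measurable fun b : S1 => (AddCircle.toCircle b : ℂ) :=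
  (continuous_subtype_val.comp AddCircle.continuous_toCircle).measurable

theorem measurableSet_Icc_fiber {X : Type*} [MeasurableSpace X] {c : X → ℝ} (hc : Measurable c) :
    MeasurableSet {q : X × ℝ | q.2 ∈ Icc (-c q.1) (c q.1)} :=
  (measurableSet_le (hc.comp measurable_fst).neg measurable_snd).inter
    (measurableSet_le measurable_snd (hc.comp measurable_fst))

theorem measurable_setLIntegral_Icc {X : Type*} [MeasurableSpace X] {c : X → ℝ} (hc : Measurable c)
    {G : X × ℝ → ℝ≥0∞} (hG : Measurable G) :
    Measurable fun x => ∫⁻ y in Icc (-c x) (c x), G (x, y) := by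
  have h := (hG.indicator (measurableSet_Icc_fiber hc)).lintegral_prod_right'
    (ν := (volume : Measure ℝ))
  have e : (fun x => ∫⁻ y in Icc (-c x) (c x), G (x, y)) = fun x => ∫⁻ y,
      {q : X × ℝ | q.2 ∈ Icc (-c q.1) (c q.1)}.indicator G (x, y) := by
    funext x
    rw [← lintegral_indicator measurableSet_Icc]
    refine lintegral_congr fun y => ?_
    simp only [indicator_apply, mem_ofPred_eq]
  rw [e]
  exact h

theorem stronglyMeasurable_setIntegral_Icc {X : Type*} [MeasurableSpace X] {c : X → ℝ}
    (hc : Measurable c) {G : X × ℝ → ℂ} (hG : Measurable G) :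
    StronglyMeasurable fun x => ∫ y in Icc (-c x) (c x), G (x, y) := by
  have h := (hG.indicator (measurableSet_Icc_fiber hc)).stronglyMeasurable.integral_prod_right'
    (ν := (volume : Measure ℝ))
  have e : (fun x => ∫ y in Icc (-c x) (c x), G (x, y)) = fun x => ∫ y,
      {q : X × ℝ | q.2 ∈ Icc (-c q.1) (c q.1)}.indicator G (x, y) := by
    funext x
    rw [← integral_indicator measurableSet_Icc]
    refine integral_congr_ae (Filter.Eventually.of_forall fun y => ?_)
    simp only [indicator_apply, mem_ofPred_eq]
  rw [e]
  exact h

theorem eLpNorm_two_sq {X : Type*} [MeasurableSpace X] {μ : Measure X} (g : X → ℂ) :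
    eLpNorm g 2 μ ^ 2 = ∫⁻ x, ‖g x‖ₑ ^ 2 ∂μ := by
  have := eLpNorm_nnreal_pow_eq_lintegral (f := g) (p := 2) (μ := μ) two_ne_zero
  simpa using this

/-- Santaló's formula. -/
theorem lintegral_santalo (hκ : R ^ 2 * |κ| < 1) {F : ℂ → ℝ≥0∞} (hF : Measurable F) :
    ∫⁻ p, ENNReal.ofReal (angDeriv (lamC κ R) p.2 * Real.cos (scat κ R p.2)) *
      (∫⁻ y in Icc (-Real.cos (scat κ R p.2)) (Real.cos (scat κ R p.2)),
        F (chordPt ((AddCircle.toCircle p.1 : ℂ) * angExp (lamC κ R) p.2) (scat κ R p.2) y))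
          ∂(dSigma κ R)
      = ENNReal.ofReal (R / (1 + κ * R ^ 2)) * (ENNReal.ofReal (2 * Real.pi) *
        ∫⁻ ζ in Metric.closedBall 0 1, F ζ) := by
  have hl := lamC_pos hκ
  -- In the coordinates (direction, σ) = (β + 𝔰(α), 𝔰(α)) the factor 𝔰' dα becomes dσ. The chords of
  -- one fixed direction already fill the disk, so integration over directions contributes just the
  -- factor 2π.
  let H : S1 × ℝ → ℝ≥0∞ := fun q => ENNReal.ofReal (Real.cos q.2) *
    ∫⁻ y in Icc (-Real.cos q.2) (Real.cos q.2), F (chordPt (AddCircle.toCircle q.1 : ℂ) q.2 y)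
  have hH : Measurable H := by
    have hcs : Measurable fun q : S1 × ℝ => Real.cos q.2 := by fun_prop
    refine hcs.ennreal_ofReal.mul (measurable_setLIntegral_Icc hcs
      (G := fun q => F (chordPt (AddCircle.toCircle q.1.1 : ℂ) q.1.2 q.2)) (hF.comp ?_))
    exact continuous_chordPt.measurable.comp ((measurable_toCircle.comp
      (measurable_fst.comp measurable_fst)).prodMk
      ((measurable_snd.comp measurable_fst).prodMk measurable_snd))
  have hsc := measurable_scat κ R
  have had : Measurable (angDeriv (lamC κ R)) := (contDiff_angDeriv hl).continuous.measurable
  have hshift : Measurable fun a : ℝ => ((scat κ R a : ℝ) : S1) := AddCircle.measurable_mk'.comp hsc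
  have e1 : ∀ᵐ p ∂(dSigma κ R),
      ENNReal.ofReal (angDeriv (lamC κ R) p.2 * Real.cos (scat κ R p.2)) *
      ∫⁻ y in Icc (-Real.cos (scat κ R p.2)) (Real.cos (scat κ R p.2)),
        F (chordPt ((AddCircle.toCircle p.1 : ℂ) * angExp (lamC κ R) p.2) (scat κ R p.2) y)
      = ENNReal.ofReal (angDeriv (lamC κ R) p.2) *
        H (p.1 + ((scat κ R p.2 : ℝ) : S1), scat κ R p.2) := by
    filter_upwards [ae_abs_lt_dSigma κ R] with p hp
    simp only [H]
    rw [ENNReal.ofReal_mul (angDeriv_pos hl _).le, AddCircle.toCircle_add, Circle.coe_mul,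
      toCircle_coe, exp_scat hκ hp, mul_assoc]
  rw [lintegral_congr_ae e1, dSigma, lintegral_smul_measure, smul_eq_mul]
  congr 1
  have hmeas : Measurable fun p : S1 × ℝ => ENNReal.ofReal (angDeriv (lamC κ R) p.2) *
      H (p.1 + ((scat κ R p.2 : ℝ) : S1), scat κ R p.2) :=
    (had.comp measurable_snd).ennreal_ofReal.mul (hH.comp
      ((measurable_fst.add (hshift.comp measurable_snd)).prodMk (hsc.comp measurable_snd)))
  rw [lintegral_prod_symm' _ hmeas]
  have e2 : ∀ a : ℝ, ∫⁻ b : S1, ENNReal.ofReal (angDeriv (lamC κ R) a) *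
      H (b + ((scat κ R a : ℝ) : S1), scat κ R a)
      = ENNReal.ofReal |angDeriv (lamC κ R) a| * ∫⁻ b : S1, H (b, scat κ R a) := by
    intro a
    rw [abs_of_pos (angDeriv_pos hl a), lintegral_const_mul' _ _ ENNReal.ofReal_ne_top,
      lintegral_add_right_eq_self fun b => H (b, scat κ R a)]
  simp only [e2]
  have e3 := lintegral_image_eq_lintegral_abs_deriv_mul measurableSet_Ioo
    (fun a ha => (hasDerivAt_scat hκ (abs_lt.2 ha)).hasDerivWithinAt) (scat_injOn hκ)
    (fun s => ∫⁻ b : S1, H (b, s))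
  rw [scat_image hκ] at e3
  rw [← e3, lintegral_lintegral_swap (f := fun s b => H (b, s)) (hH.comp measurable_swap).aemeasurable]
  have e4 : ∀ b : S1, ∫⁻ s in Ioo (-(Real.pi / 2)) (Real.pi / 2), H (b, s)
      = ∫⁻ ζ in Metric.closedBall 0 1, F ζ := fun b => (lintegral_chord (norm_toCircle b) hF).symm
  simp only [e4]
  rw [lintegral_const, AddCircle.measure_univ, mul_comm]

theorem measurable_geoPt (hκ : R ^ 2 * |κ| < 1) :
    Measurable fun q : (S1 × ℝ) × ℝ => geoPt κ R q.1 q.2 := by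
  have hE := (contDiff_angExp (lamC_pos hκ)).continuous.measurable
  refine (measurable_PhiInv κ R).comp (continuous_chordPt.measurable.comp (Measurable.prodMk ?_
    (Measurable.prodMk ?_ measurable_snd)))
  · exact (measurable_toCircle.comp (measurable_fst.comp measurable_fst)).mul
      (hE.comp (measurable_snd.comp measurable_fst))
  · exact (measurable_scat κ R).comp (measurable_snd.comp measurable_fst)

theorem measurable_chordFun (hκ : R ^ 2 * |κ| < 1) {f : ℂ → ℂ} (hf : Measurable f) :
    Measurable fun q : (S1 × ℝ) × ℝ => chordFun κ R f q.1 q.2 := by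
  have hg := measurable_geoPt (R := R) hκ
  have hw := measurable_weight κ
  have hd : Measurable (angDen (lamC κ R)) := (contDiff_angDen _).continuous.measurable
  have hc : Measurable fun q : (S1 × ℝ) × ℝ => chordConst κ R q.1.2 := by
    unfold chordConst
    exact measurable_const.div (measurable_const.mul
      (hd.comp (measurable_snd.comp measurable_fst)).sqrt)
  exact (Complex.measurable_ofReal.comp hc).mul ((hf.comp hg).div
    ((Complex.measurable_ofReal.comp (hw.comp hg)).pow_const 2))

theorem exists_weight_ge (hR : 0 < R) (hκ : R ^ 2 * |κ| < 1) :
    ∃ C, 0 < C ∧ ∀ z : ℂ, ‖z‖ ≤ R → C ≤ weight κ z := by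
  obtain ⟨z, hz, hmin⟩ := (isCompact_closedBall (0 : ℂ) R).exists_isMinOn
    (Metric.nonempty_closedBall.2 hR.le) (contDiffOn_weight hκ).continuousOn
  exact ⟨weight κ z, weight_pos hκ (by simpa using hz), fun y hy => hmin (by simpa using hy)⟩

/-- The squared arc length factor is a constant multiple of 𝔰', precisely the density in Santaló's
formula. -/
theorem chordConst_sq (hκ : R ^ 2 * |κ| < 1) (α : ℝ) :
    chordConst κ R α ^ 2 = R ^ 2 / ((1 - κ * R ^ 2) ^ 2 * lamC κ R) * angDeriv (lamC κ R) α := by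
  have h1 := (one_sub_pos hκ).ne'
  have h2 := (lamC_pos hκ).ne'
  have h3 := (angDen_pos (lamC_pos hκ) α).ne'
  rw [chordConst, div_pow, mul_pow, Real.sq_sqrt (angDen_pos (lamC_pos hκ) α).le, angDeriv]
  field_simp

theorem enorm_sq_eq (z : ℂ) : ‖z‖ₑ ^ 2 = ENNReal.ofReal (‖z‖ ^ 2) := by
  rw [← ofReal_norm, ENNReal.ofReal_pow (norm_nonneg z)]

/-- The `L²` bound behind the continuity of the X-ray transform. -/
theorem exists_lintegral_chordFun_le (hR : 0 < R) (hκ : R ^ 2 * |κ| < 1) :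
    ∃ C : NNReal, ∀ f : ℂ → ℂ, Measurable f →
    ∫⁻ p, ENNReal.ofReal (2 * Real.cos (scat κ R p.2)) *
      (∫⁻ y in Icc (-Real.cos (scat κ R p.2)) (Real.cos (scat κ R p.2)),
        ‖chordFun κ R f p y‖ₑ ^ 2) ∂(dSigma κ R) ≤ C * ∫⁻ z, ‖f z‖ₑ ^ 2 ∂(wdVol κ R) := by
  have hl := lamC_pos hκ
  have hj := jacConst_pos hR hκ
  obtain ⟨B, hB0, hB⟩ := exists_weight_ge hR hκ
  set K : ℝ := R ^ 2 / ((1 - κ * R ^ 2) ^ 2 * lamC κ R) with hK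
  have hK0 : 0 ≤ K := by positivity
  have hD : 0 ≤ 1 / (jacConst κ R * B ^ 2) := by positivity
  -- The factors: 2K from the length of the chord and `chordConst_sq`, then the density of dΣ², the
  -- angle 2π, and the return to w dVol with the lower bound B for w.
  refine ⟨Real.toNNReal (2 * K) * (Real.toNNReal (R / (1 + κ * R ^ 2)) *
    (Real.toNNReal (2 * Real.pi) * Real.toNNReal (1 / (jacConst κ R * B ^ 2)))), fun f hf => ?_⟩
  let F : ℂ → ℝ≥0∞ := fun ζ => ‖f (PhiInv κ R ζ) / (weight κ (PhiInv κ R ζ) : ℂ) ^ 2‖ₑ ^ 2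
  have hF : Measurable F := by
    have hP := measurable_PhiInv κ R
    exact ((hf.comp hP).div ((Complex.measurable_ofReal.comp
      ((measurable_weight κ).comp hP)).pow_const 2)).enorm.pow_const 2
  have e1 : ∀ p : S1 × ℝ, ENNReal.ofReal (2 * Real.cos (scat κ R p.2)) *
      ∫⁻ y in Icc (-Real.cos (scat κ R p.2)) (Real.cos (scat κ R p.2)),
        ‖chordFun κ R f p y‖ₑ ^ 2
      = ENNReal.ofReal (2 * K) *
      (ENNReal.ofReal (angDeriv (lamC κ R) p.2 * Real.cos (scat κ R p.2)) *
      ∫⁻ y in Icc (-Real.cos (scat κ R p.2)) (Real.cos (scat κ R p.2)),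
        F (chordPt ((AddCircle.toCircle p.1 : ℂ) * angExp (lamC κ R) p.2) (scat κ R p.2) y)) := by
    intro p
    have hs := angDeriv_pos hl p.2
    have hc := cos_scat_pos κ R p.2
    have e : ∀ y, ‖chordFun κ R f p y‖ₑ ^ 2 = ENNReal.ofReal (K * angDeriv (lamC κ R) p.2) *
        F (chordPt ((AddCircle.toCircle p.1 : ℂ) * angExp (lamC κ R) p.2) (scat κ R p.2) y) := by
      intro y
      rw [chordFun, enorm_mul, mul_pow, ← chordConst_sq hκ, enorm_sq_eq, Complex.norm_real,
        Real.norm_eq_abs, sq_abs]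
      rfl
    simp only [e]
    rw [lintegral_const_mul' _ _ ENNReal.ofReal_ne_top, ← mul_assoc, ← mul_assoc,
      ← ENNReal.ofReal_mul (by positivity), ← ENNReal.ofReal_mul (by positivity)]
    congr 2
    ring
  simp only [e1]
  rw [lintegral_const_mul' _ _ ENNReal.ofReal_ne_top, lintegral_santalo hκ hF,
    lintegral_disk hR hκ hF]
  have e2 : ∫⁻ z, ENNReal.ofReal (weight κ z ^ 2 / jacConst κ R) * F (Phi κ R z) ∂(wdVol κ R)
      ≤ ENNReal.ofReal (1 / (jacConst κ R * B ^ 2)) * ∫⁻ z, ‖f z‖ₑ ^ 2 ∂(wdVol κ R) := by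
    rw [← lintegral_const_mul' _ _ ENNReal.ofReal_ne_top]
    refine lintegral_mono_ae ?_
    filter_upwards [ae_norm_le_wdVol κ R] with z hz
    simp only [F]
    have hw := hB z hz
    have hw0 : 0 < weight κ z := hB0.trans_le hw
    rw [PhiInv_Phi hR hκ hz, enorm_sq_eq, enorm_sq_eq, ← ENNReal.ofReal_mul (by positivity),
      ← ENNReal.ofReal_mul hD]
    refine ENNReal.ofReal_le_ofReal ?_
    rw [norm_div, norm_pow, Complex.norm_real, Real.norm_of_nonneg hw0.le]
    have e3 : weight κ z ^ 2 / jacConst κ R * (‖f z‖ / weight κ z ^ 2) ^ 2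
        = 1 / (jacConst κ R * weight κ z ^ 2) * ‖f z‖ ^ 2 := by field_simp
    rw [e3]
    gcongr
  push_cast
  simp only [ENNReal.ofNNReal_toNNReal]
  rw [mul_assoc, mul_assoc, mul_assoc]
  gcongr

/-- Cauchy–Schwarz on an interval of length 2c; with c = cos 𝔰 this supplies the cosine required by
Santaló's formula. -/
theorem enorm_setIntegral_sq_le {g : ℝ → ℂ} {c : ℝ} (hg : AEStronglyMeasurable g
    (volume.restrict (Icc (-c) c))) :
    ‖∫ y in Icc (-c) c, g y‖ₑ ^ 2 ≤ ENNReal.ofReal (2 * c) * ∫⁻ y in Icc (-c) c, ‖g y‖ₑ ^ 2 := by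
  have h1 : ‖∫ y in Icc (-c) c, g y‖ₑ ≤ eLpNorm g 1 (volume.restrict (Icc (-c) c)) := by
    rw [eLpNorm_one_eq_lintegral_enorm]
    exact enorm_integral_le_lintegral_enorm g
  have h2 := eLpNorm_le_eLpNorm_mul_rpow_measure_univ (p := 1) (q := 2) one_le_two hg
  calc ‖∫ y in Icc (-c) c, g y‖ₑ ^ 2
      ≤ (eLpNorm g 2 (volume.restrict (Icc (-c) c)) *
        (volume.restrict (Icc (-c) c)) univ ^ (1 / (1 : ℝ≥0∞).toReal - 1 / (2 : ℝ≥0∞).toReal)) ^ 2 := by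
        gcongr; exact h1.trans h2
    _ = ENNReal.ofReal (2 * c) * ∫⁻ y in Icc (-c) c, ‖g y‖ₑ ^ 2 := by
        have h3 : (1 / (1 : ℝ≥0∞).toReal - 1 / (2 : ℝ≥0∞).toReal) * ((2 : ℕ) : ℝ) = 1 := by norm_num
        rw [mul_pow, eLpNorm_two_sq, mul_comm, Measure.restrict_apply_univ, Real.volume_Icc,
          ← ENNReal.rpow_natCast (_ ^ _), ← ENNReal.rpow_mul, h3, ENNReal.rpow_one, sub_neg_eq_add,
          two_mul]

/-- The X-ray transform, as an integral along chords of the unit disk. -/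
def xray (κ R : ℝ) (f : ℂ → ℂ) (p : S1 × ℝ) : ℂ :=
  ∫ y in Icc (-Real.cos (scat κ R p.2)) (Real.cos (scat κ R p.2)), chordFun κ R f p y

theorem chordFun_add (f g : ℂ → ℂ) (p : S1 × ℝ) (y : ℝ) :
    chordFun κ R (f + g) p y = chordFun κ R f p y + chordFun κ R g p y := by
  simp only [chordFun, Pi.add_apply]; ring

theorem chordFun_sub (f g : ℂ → ℂ) (p : S1 × ℝ) (y : ℝ) :
    chordFun κ R (f - g) p y = chordFun κ R f p y - chordFun κ R g p y := by
  simp only [chordFun, Pi.sub_apply]; ring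

theorem xray_smul (c : ℂ) (f : ℂ → ℂ) : xray κ R (c • f) = c • xray κ R f := by
  funext p
  simp only [xray, Pi.smul_apply, smul_eq_mul]
  rw [← integral_const_mul]
  congr 1
  funext y
  simp only [chordFun, Pi.smul_apply, smul_eq_mul]
  ring

theorem measurable_chordFun_right (hκ : R ^ 2 * |κ| < 1) {f : ℂ → ℂ} (hf : Measurable f)
    (p : S1 × ℝ) : Measurable (chordFun κ R f p) := by
  have h := measurable_chordFun (R := R) hκ hf
  generalize chordFun κ R f = G at h ⊢
  exact h.comp (measurable_prodMk_left (x := p))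

theorem measurable_cos_scat (κ R : ℝ) :
    Measurable fun p : S1 × ℝ => Real.cos (scat κ R p.2) :=
  Real.measurable_cos.comp ((measurable_scat κ R).comp measurable_snd)

theorem aestronglyMeasurable_xray (hκ : R ^ 2 * |κ| < 1) {f : ℂ → ℂ} (hf : Measurable f) :
    AEStronglyMeasurable (xray κ R f) (dSigma κ R) :=
  (stronglyMeasurable_setIntegral_Icc (measurable_cos_scat κ R)
    (G := fun q => chordFun κ R f q.1 q.2) (measurable_chordFun hκ hf)).aestronglyMeasurable

theorem measurable_sq_chordFun (hκ : R ^ 2 * |κ| < 1) {f : ℂ → ℂ} (hf : Measurable f) :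
    Measurable fun p : S1 × ℝ => ENNReal.ofReal (2 * Real.cos (scat κ R p.2)) *
      ∫⁻ y in Icc (-Real.cos (scat κ R p.2)) (Real.cos (scat κ R p.2)),
        ‖chordFun κ R f p y‖ₑ ^ 2 :=
  ((measurable_cos_scat κ R).const_mul 2).ennreal_ofReal.mul
    (measurable_setLIntegral_Icc (measurable_cos_scat κ R)
      (G := fun q => ‖chordFun κ R f q.1 q.2‖ₑ ^ 2) ((measurable_chordFun hκ hf).enorm.pow_const 2))

theorem lintegral_sq_lt_top {X : Type*} [MeasurableSpace X] {μ : Measure X} {f : X → ℂ}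
    (hf : MemLp f 2 μ) : ∫⁻ x, ‖f x‖ₑ ^ 2 ∂μ < ⊤ := by
  rw [← eLpNorm_two_sq]
  exact ENNReal.pow_lt_top hf.2

theorem memLp_two_of_lintegral {X : Type*} [MeasurableSpace X] {μ : Measure X} {f : X → ℂ}
    (hf : AEStronglyMeasurable f μ) (h : ∫⁻ x, ‖f x‖ₑ ^ 2 ∂μ < ⊤) : MemLp f 2 μ := by
  rw [← eLpNorm_two_sq] at h
  exact ⟨hf, (ENNReal.pow_lt_top_iff.1 h).resolve_right two_ne_zero⟩

theorem ae_integrableOn_chordFun (hR : 0 < R) (hκ : R ^ 2 * |κ| < 1) {f : ℂ → ℂ}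
    (hf : Measurable f) (hf2 : MemLp f 2 (wdVol κ R)) :
    ∀ᵐ p ∂(dSigma κ R), IntegrableOn (chordFun κ R f p)
      (Icc (-Real.cos (scat κ R p.2)) (Real.cos (scat κ R p.2))) := by
  obtain ⟨C, hC⟩ := exists_lintegral_chordFun_le hR hκ
  have hlt := (hC f hf).trans_lt (ENNReal.mul_lt_top ENNReal.coe_lt_top (lintegral_sq_lt_top hf2))
  filter_upwards [ae_lt_top (measurable_sq_chordFun hκ hf) hlt.ne] with p hp
  have hc : ENNReal.ofReal (2 * Real.cos (scat κ R p.2)) ≠ 0 := by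
    have := cos_scat_pos κ R p.2
    simpa using this
  have h1 := ENNReal.lt_top_of_mul_ne_top_right hp.ne hc
  exact (memLp_two_of_lintegral (measurable_chordFun_right hκ hf p).aestronglyMeasurable h1).integrable
    one_le_two

/-- A null set may contain whole geodesics, so independence of the representative holds only for
almost every geodesic; it follows from the L² bound applied to f - g. -/
theorem xray_ae_congr (hR : 0 < R) (hκ : R ^ 2 * |κ| < 1) {f g : ℂ → ℂ} (hf : Measurable f)
    (hg : Measurable g) (hfg : f =ᵐ[wdVol κ R] g) : xray κ R f =ᵐ[dSigma κ R] xray κ R g := by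
  obtain ⟨C, hC⟩ := exists_lintegral_chordFun_le hR hκ
  have h0 : ∫⁻ z, ‖(f - g) z‖ₑ ^ 2 ∂(wdVol κ R) = 0 := by
    rw [lintegral_eq_zero_iff ((hf.sub hg).enorm.pow_const 2)]
    filter_upwards [hfg] with z hz
    simp [hz]
  have h1 := hC (f - g) (hf.sub hg)
  rw [h0, mul_zero, nonpos_iff_eq_zero,
    lintegral_eq_zero_iff (measurable_sq_chordFun hκ (hf.sub hg))] at h1
  filter_upwards [h1] with p hp
  have hc : ENNReal.ofReal (2 * Real.cos (scat κ R p.2)) ≠ 0 := by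
    have := cos_scat_pos κ R p.2
    simpa using this
  have h2 := (mul_eq_zero.1 hp).resolve_left hc
  rw [lintegral_eq_zero_iff ((measurable_chordFun_right hκ (hf.sub hg) p).enorm.pow_const 2)] at h2
  refine integral_congr_ae ?_
  filter_upwards [h2] with y hy
  have h3 : chordFun κ R (f - g) p y = 0 := by simpa using hy
  rwa [chordFun_sub, sub_eq_zero] at h3

theorem exists_xray_clm (hR : 0 < R) (hκ : R ^ 2 * |κ| < 1) :
    ∃ J : L2M κ R →L[ℂ] Lp ℂ 2 (dSigma κ R), ∀ f : L2M κ R, J f =ᵐ[dSigma κ R] xray κ R f := by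
  obtain ⟨C, hC⟩ := exists_lintegral_chordFun_le hR hκ
  refine exists_clm_of_bound (xray κ R) (NNReal.sqrt C) ?_ ?_ xray_smul
    (fun f hf => aestronglyMeasurable_xray hκ hf) ?_
  · exact fun f g hf hg hfg => xray_ae_congr hR hκ hf hg hfg
  · intro f g hf hg hf2 hg2
    filter_upwards [ae_integrableOn_chordFun hR hκ hf hf2, ae_integrableOn_chordFun hR hκ hg hg2]
      with p h1 h2
    simp only [xray, Pi.add_apply, chordFun_add]
    exact integral_add h1 h2
  · intro f hf hf2
    rw [← ENNReal.pow_le_pow_left_iff two_ne_zero, mul_pow, eLpNorm_two_sq, eLpNorm_two_sq, ← ENNReal.coe_pow,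
      NNReal.sq_sqrt]
    refine le_trans (lintegral_mono fun p => ?_) (hC f hf)
    exact enorm_setIntegral_sq_le (measurable_chordFun_right hκ hf p).aestronglyMeasurable

/-- 𝒮_A sends the direction η to -η and σ to -σ: the same chord with y reversed. -/
theorem chordFun_SA (hκ : R ^ 2 * |κ| < 1) (f : ℂ → ℂ) {p : S1 × ℝ} (hp : |p.2| < Real.pi / 2)
    (y : ℝ) : chordFun κ R f (SA κ R p) y = chordFun κ R f p (-y) := by
  have hl := lamC_pos hκ
  have h2 : (SA κ R p).2 = -p.2 := rfl
  have hE := angExp_ne_zero hl p.2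
  have hg : geoPt κ R (SA κ R p) y = geoPt κ R p (-y) := by
    simp only [geoPt]
    congr 1
    rw [toCircle_SA hκ p hp, h2, angExp_neg hl, scat_neg, chordPt, chordPt, Real.sin_neg]
    push_cast
    field_simp
    ring
  have hc : chordConst κ R (SA κ R p).2 = chordConst κ R p.2 := by
    rw [h2, chordConst, chordConst, angDen_neg]
  rw [chordFun, hg, hc, chordFun]

theorem xray_SA (hκ : R ^ 2 * |κ| < 1) (f : ℂ → ℂ) {p : S1 × ℝ} (hp : |p.2| < Real.pi / 2) :
    xray κ R f (SA κ R p) = xray κ R f p := by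
  have hc : Real.cos (scat κ R (SA κ R p).2) = Real.cos (scat κ R p.2) := by
    rw [show (SA κ R p).2 = -p.2 from rfl, scat_neg, Real.cos_neg]
  have h0 : -Real.cos (scat κ R p.2) ≤ Real.cos (scat κ R p.2) := by
    linarith [cos_scat_pos κ R p.2]
  simp only [xray, hc, chordFun_SA hκ f hp]
  rw [integral_Icc_eq_integral_Ioc, integral_Icc_eq_integral_Ioc,
    ← intervalIntegral.integral_of_le h0, ← intervalIntegral.integral_of_le h0,
    intervalIntegral.integral_comp_neg, neg_neg]

/-- The X-ray transform as a bounded operator. -/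
theorem exists_xrayTransform (hR : 0 < R) (hκ : R ^ 2 * |κ| < 1) :
    ∃ I : L2M κ R →L[ℂ] L2plus κ R, IsXrayTransform κ R I ∧ ∀ f : L2M κ R, ∀ g : ℂ → ℂ,
      Measurable g → f =ᵐ[wdVol κ R] g →
      (I f : Lp ℂ 2 (dSigma κ R)) =ᵐ[dSigma κ R] xray κ R g := by
  obtain ⟨J, hJ⟩ := exists_xray_clm hR hκ
  have hmem : ∀ f, J f ∈ L2plus κ R := fun f => mem_L2plus_of_invariant (hJ f) (by
    filter_upwards [ae_abs_lt_dSigma κ R] with p hp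
    exact xray_SA hκ f hp)
  refine ⟨J.codRestrict (L2plus κ R) hmem, fun f => ?_, fun f g hg hfg => ?_⟩
  · have hfm := (Lp.stronglyMeasurable f).measurable
    filter_upwards [hJ f, ae_abs_lt_dSigma κ R, ae_integrableOn_chordFun hR hκ hfm (Lp.memLp f)]
      with p h1 h2 h3
    have h4 : ((J.codRestrict (L2plus κ R) hmem f : Lp ℂ 2 (dSigma κ R)) : S1 × ℝ → ℂ) p
        = xray κ R f p := h1
    rw [h4]
    exact hasXray_of_integrableOn hR hκ h2 h3
  · exact (hJ f).trans (xray_ae_congr hR hκ (Lp.stronglyMeasurable f).measurable hg hfg)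

end Transform
end XrayDisk

/-! ### Chebyshev identities: chord integrals and Fourier expansion. -/

namespace XrayDisk
noncomputable section Ridges

variable {κ R : ℝ}

open Polynomial.Chebyshev in
theorem sin_mul_U_neg_cos (n : ℕ) (x : ℝ) :
    (U ℝ n).eval (-Real.cos x) * Real.sin x = (-1) ^ n * Real.sin ((n + 1) * x) := by
  have h := U_real_cos (Real.pi - x) n
  rw [Real.cos_pi_sub, Real.sin_pi_sub] at h
  rw [h]
  push_cast
  rw [show ((n : ℝ) + 1) * (Real.pi - x) = ((n + 1 : ℕ) : ℝ) * Real.pi - (n + 1) * x by push_cast; ring,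
    Real.sin_sub, Real.sin_nat_mul_pi, Real.cos_nat_mul_pi, pow_succ]
  ring

open Polynomial.Chebyshev in
/-- The integral of a ridge Chebyshev polynomial along a chord. -/
theorem integral_chebyshev_chord (n : ℕ) (ψ χ : ℝ) :
    ∫ y in -Real.sin ψ..Real.sin ψ,
        (U ℝ n).eval (y * Real.sin χ + Real.cos ψ * Real.cos χ)
      = 2 / (n + 1) * Real.sin ((n + 1) * ψ) * (U ℝ n).eval (Real.cos χ) := by
  have hm : (n : ℝ) + 1 ≠ 0 := by positivity
  -- If sin χ = 0 the integrand is constant along the chord, and the primitive used in the other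
  -- case is not available.
  by_cases hχ : Real.sin χ = 0
  · have hc : Real.cos χ = 1 ∨ Real.cos χ = -1 := by
      have := Real.sin_sq_add_cos_sq χ
      rw [hχ] at this
      exact sq_eq_sq_iff_eq_or_eq_neg.1 (by linarith)
    simp only [hχ, mul_zero, zero_add, intervalIntegral.integral_const, smul_eq_mul]
    rcases hc with hc | hc
    · have h := U_real_cos ψ n
      have h1 : (U ℝ n).eval 1 = n + 1 := by simp
      rw [hc, mul_one, h1]
      push_cast at h
      field_simp
      linear_combination 2 * h
    · have h := sin_mul_U_neg_cos n ψ
      have h1 : (U ℝ n).eval (-1) = (-1) ^ n * (n + 1) := by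
        simp
      rw [hc, mul_neg_one, h1]
      field_simp
      linear_combination 2 * h
  -- The relation T_{n+1}' = (n+1)U_n gives the primitive; its end values are multiples of
  -- cos((n+1)(ψ ∓ χ)), whose difference is a product of sines.
  · have hd : ∀ y ∈ uIcc (-Real.sin ψ) (Real.sin ψ),
        HasDerivAt (fun y => (T ℝ (n + 1 : ℕ)).eval (y * Real.sin χ + Real.cos ψ * Real.cos χ) /
          ((n + 1) * Real.sin χ))
          ((U ℝ n).eval (y * Real.sin χ + Real.cos ψ * Real.cos χ)) y := by
      intro y _
      have h1 : HasDerivAt (fun y : ℝ => y * Real.sin χ + Real.cos ψ * Real.cos χ) (Real.sin χ) y :=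
        (hasDerivAt_mul_const _).add_const _
      refine ((((T ℝ (n + 1 : ℕ)).hasDerivAt _).comp y h1).div_const _).congr_deriv ?_
      rw [T_derivative_eq_U]
      push_cast
      simp
      field_simp
    rw [intervalIntegral.integral_eq_sub_of_hasDerivAt hd
      ((Polynomial.continuous _).comp (by fun_prop)).continuousOn.intervalIntegrable]
    have e1 : Real.sin ψ * Real.sin χ + Real.cos ψ * Real.cos χ = Real.cos (ψ - χ) := by
      rw [Real.cos_sub]; ring
    have e2 : -Real.sin ψ * Real.sin χ + Real.cos ψ * Real.cos χ = Real.cos (ψ + χ) := by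
      rw [Real.cos_add]; ring
    have h := U_real_cos χ n
    rw [e1, e2, T_real_cos, T_real_cos]
    push_cast at h ⊢
    rw [mul_sub, mul_add, Real.cos_sub, Real.cos_add]
    field_simp
    linear_combination -2 * Real.sin ((n + 1) * ψ) * h

theorem sum_zpow_succ {z : ℂ} (hz : z ≠ 0) (n : ℕ) :
    ∑ k ∈ Finset.range (n + 2), z ^ (((n + 1 : ℕ) : ℤ) - 2 * k)
      = z * (∑ k ∈ Finset.range (n + 1), z ^ ((n : ℤ) - 2 * k)) + z ^ (-((n : ℤ) + 1)) := by
  rw [Finset.sum_range_succ, Finset.mul_sum]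
  congr 1
  · refine Finset.sum_congr rfl fun k _ => ?_
    rw [← zpow_one_add₀ hz]
    congr 1
    push_cast
    ring
  · congr 1
    push_cast
    ring

open Polynomial.Chebyshev in
/-- The Fourier expansion of `U_n (cos x)`. -/
theorem chebyshev_U_eq_sum {z : ℂ} (hz : z ≠ 0) (n : ℕ) :
    (U ℂ n).eval ((z + z⁻¹) / 2) = ∑ k ∈ Finset.range (n + 1), z ^ ((n : ℤ) - 2 * k) := by
  induction n using Nat.strong_induction_on with
  | _ n ih =>
    match n with
    | 0 => simp
    | 1 =>
      simp [Finset.sum_range_succ]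
      ring
    | n + 2 =>
      have h0 := sum_zpow_succ hz n
      rw [sum_zpow_succ hz (n + 1)]
      have h1 := ih (n + 1) (by omega)
      have h2 := ih n (by omega)
      have e : (U ℂ ((n + 2 : ℕ) : ℤ)) = 2 * Polynomial.X * U ℂ ((n + 1 : ℕ) : ℤ) - U ℂ n := by
        push_cast
        exact U_add_two ℂ n
      rw [e, Polynomial.eval_sub, Polynomial.eval_mul, Polynomial.eval_mul, Polynomial.eval_X, h1, h2]
      have e2 : z ^ (-(((n + 1 : ℕ) : ℤ) + 1)) = z⁻¹ * z ^ (-((n : ℤ) + 1)) := by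
        rw [← zpow_neg_one, ← zpow_add₀ hz]
        congr 1
        push_cast
        ring
      rw [show (n + 1 + 1 : ℕ) = n + 2 from rfl, e2]
      have e3 : z ^ (-((n : ℤ) + 1)) = (∑ k ∈ Finset.range (n + 2), z ^ (((n + 1 : ℕ) : ℤ) - 2 * k))
        - z * (∑ k ∈ Finset.range (n + 1), z ^ ((n : ℤ) - 2 * k)) := by rw [h0]; ring
      rw [e3]
      simp
      field_simp
      ring

theorem chebyshev_U_cos_eq_sum (x : ℝ) (n : ℕ) :
    (((Polynomial.Chebyshev.U ℝ n).eval (Real.cos x) : ℝ) : ℂ)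
      = ∑ k ∈ Finset.range (n + 1), Complex.exp (x * Complex.I) ^ ((n : ℤ) - 2 * k) := by
  rw [← chebyshev_U_eq_sum (Complex.exp_ne_zero _), ← Complex.exp_neg]
  have h : (Complex.exp (x * Complex.I) + Complex.exp (-(x * Complex.I))) / 2 = ((Real.cos x : ℝ) : ℂ) := by
    rw [Complex.ofReal_cos, Complex.cos, neg_mul]
  rw [h, ← Polynomial.Chebyshev.map_U (Complex.ofRealHom) n, Polynomial.eval_map,
    show ((Real.cos x : ℝ) : ℂ) = Complex.ofRealHom (Real.cos x) from rfl, Polynomial.eval₂_at_apply]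
  rfl

theorem integral_sin_nat_mul_sq (n : ℕ) :
    ∫ σ in -(Real.pi / 2)..Real.pi / 2, Real.sin ((n + 1) * (Real.pi / 2 - σ)) ^ 2 = Real.pi / 2 := by
  have hm : (n : ℝ) + 1 ≠ 0 := by positivity
  rw [intervalIntegral.integral_comp_sub_left (fun x => Real.sin ((n + 1) * x) ^ 2)]
  rw [intervalIntegral.integral_comp_mul_left (fun x => Real.sin x ^ 2) hm, integral_sin_sq]
  have e1 : ((n : ℝ) + 1) * (Real.pi / 2 - Real.pi / 2) = 0 := by ring
  have e2 : ((n : ℝ) + 1) * (Real.pi / 2 - -(Real.pi / 2)) = ((n + 1 : ℕ) : ℝ) * Real.pi := by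
    push_cast; ring
  rw [e1, e2, Real.sin_nat_mul_pi]
  simp
  field_simp

end Ridges
end XrayDisk

/-! ### Ridge functions: inner products and X-ray transforms. -/

namespace XrayDisk
noncomputable section Ridges

variable {κ R : ℝ}

theorem ridge_chordPt {n : ℕ} {θ δ σ y : ℝ} {η : ℂ}
    (h : η * Complex.exp (-(θ * Complex.I)) = Complex.exp (δ * Complex.I)) :
    ridge n θ (chordPt η σ y) = (Polynomial.Chebyshev.U ℝ n).eval
      (y * Real.sin (Real.pi / 2 - δ) + Real.cos (Real.pi / 2 - σ) * Real.cos (Real.pi / 2 - δ)) := by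
  rw [ridge, chordPt, mul_right_comm, h, Real.sin_pi_div_two_sub, Real.cos_pi_div_two_sub,
    Real.cos_pi_div_two_sub, Complex.exp_mul_I, ← Complex.ofReal_cos, ← Complex.ofReal_sin]
  congr 1
  simp [-Complex.ofReal_cos, -Complex.ofReal_sin]
  ring

theorem integral_ridge_chordPt {n : ℕ} {θ δ σ : ℝ} {η : ℂ}
    (h : η * Complex.exp (-(θ * Complex.I)) = Complex.exp (δ * Complex.I)) :
    ∫ y in -Real.cos σ..Real.cos σ, (ridge n θ (chordPt η σ y) : ℂ)
      = ((2 / (n + 1) * Real.sin ((n + 1) * (Real.pi / 2 - σ)) *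
        (Polynomial.Chebyshev.U ℝ n).eval (Real.cos (Real.pi / 2 - δ)) : ℝ) : ℂ) := by
  rw [← integral_chebyshev_chord, Real.sin_pi_div_two_sub σ, intervalIntegral.integral_ofReal]
  simp only [ridge_chordPt h]

theorem continuous_ridge_mul_ridge (n : ℤ) (θ θ' : ℝ) :
    Continuous fun z => (ridge n θ z : ℂ) * (ridge n θ' z : ℂ) :=
  (Complex.continuous_ofReal.comp (contDiff_ridge n θ).continuous).mul
    (Complex.continuous_ofReal.comp (contDiff_ridge n θ').continuous)

/-- The inner products of ridge functions of the same degree. -/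
theorem integral_ridge_mul_ridge (n : ℕ) (θ θ' : ℝ) :
    ∫ z in Metric.closedBall 0 1, (ridge n θ z : ℂ) * (ridge n θ' z : ℂ)
      = ((Real.pi / (n + 1) * (Polynomial.Chebyshev.U ℝ n).eval (Real.cos (θ - θ')) : ℝ) : ℂ) := by
  -- The chords are taken along the level lines of the first ridge, which is then constant on each
  -- of them and leaves the chord integral of the second.
  set η : ℂ := Complex.exp ((θ + Real.pi / 2 : ℝ) * Complex.I)
  have h1 : η * Complex.exp (-(θ * Complex.I)) = Complex.exp ((Real.pi / 2 : ℝ) * Complex.I) := by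
    rw [← Complex.exp_add]; congr 1; push_cast; ring
  have h2 : η * Complex.exp (-(θ' * Complex.I))
      = Complex.exp ((θ - θ' + Real.pi / 2 : ℝ) * Complex.I) := by
    rw [← Complex.exp_add]; congr 1; push_cast; ring
  rw [integral_chord (η := η) (Complex.norm_exp_ofReal_mul_I _) (continuous_ridge_mul_ridge n θ θ')]
  simp only [ridge_chordPt h1, sub_self, Real.sin_zero, Real.cos_zero, mul_zero, mul_one, zero_add]
  simp only [intervalIntegral.integral_const_mul, integral_ridge_chordPt h2]
  have e : ∀ σ : ℝ, (Real.cos σ : ℂ) * ((((Polynomial.Chebyshev.U ℝ n).eval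
      (Real.cos (Real.pi / 2 - σ)) : ℝ) : ℂ) * ((2 / (n + 1) * Real.sin ((n + 1) * (Real.pi / 2 - σ)) *
        (Polynomial.Chebyshev.U ℝ n).eval (Real.cos (Real.pi / 2 - (θ - θ' + Real.pi / 2))) : ℝ) : ℂ))
      = ((2 / (n + 1) * (Polynomial.Chebyshev.U ℝ n).eval (Real.cos (θ - θ')) *
        Real.sin ((n + 1) * (Real.pi / 2 - σ)) ^ 2 : ℝ) : ℂ) := by
    intro σ
    -- The Jacobian cos σ turns the constant value U_n(sin σ) into a second copy of sin((n+1)(π/2 -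
    -- σ)).
    have h3 := Polynomial.Chebyshev.U_real_cos (Real.pi / 2 - σ) n
    rw [Real.sin_pi_div_two_sub] at h3
    rw [show Real.pi / 2 - (θ - θ' + Real.pi / 2) = -(θ - θ') by ring, Real.cos_neg]
    rw [← Complex.ofReal_mul, ← Complex.ofReal_mul]
    congr 1
    push_cast at h3
    rw [sq, ← h3]
    ring
  simp only [e]
  rw [intervalIntegral.integral_ofReal, intervalIntegral.integral_const_mul,
    integral_sin_nat_mul_sq]
  congr 1
  field_simp

theorem inner_ridgeLp_ridgeLp (hR : 0 < R) (hκ : R ^ 2 * |κ| < 1) (n : ℕ) (θ θ' : ℝ) :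
    ⟪ridgeLp hκ n θ, ridgeLp hκ n θ'⟫_ℂ = ((jacConst κ R * (Real.pi / (n + 1)) *
      (Polynomial.Chebyshev.U ℝ n).eval (Real.cos (θ - θ')) : ℝ) : ℂ) := by
  have hj := (jacConst_pos hR hκ).ne'
  rw [inner_Lp_eq (coeFn_ridgeLp hκ n θ) (coeFn_ridgeLp hκ n θ'), mul_assoc, Complex.ofReal_mul,
    ← integral_ridge_mul_ridge, integral_disk hR hκ
      (continuous_ridge_mul_ridge n θ θ').aestronglyMeasurable, ← integral_const_mul]
  refine integral_congr_ae (Filter.Eventually.of_forall fun z => ?_)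
  simp only [conj_ridgeM]
  rw [ridgeM, ridgeM]
  have hj' : (jacConst κ R : ℂ) ≠ 0 := by exact_mod_cast hj
  push_cast
  field_simp

/-- The amplitude of the X-ray transform of a ridge function. -/
def ridgeAmp (κ R : ℝ) (n : ℕ) : ℝ :=
  R / ((1 - κ * R ^ 2) * Real.sqrt (lamC κ R)) / (n + 1)

/-- The phase of the ridge function in the direction `θ`. -/
def ridgePhase (θ : ℝ) : ℂ := Complex.exp (-((θ + Real.pi / 2 : ℝ) * Complex.I))

theorem chordConst_eq (hκ : R ^ 2 * |κ| < 1) (α : ℝ) : chordConst κ R α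
    = R / ((1 - κ * R ^ 2) * Real.sqrt (lamC κ R)) * Real.sqrt (angDeriv (lamC κ R) α) := by
  have hl := lamC_pos hκ
  have h1 := (Real.sqrt_pos.2 hl).ne'
  have h2 := (Real.sqrt_pos.2 (angDen_pos hl α)).ne'
  have h3 := (one_sub_pos hκ).ne'
  rw [chordConst, angDeriv, Real.sqrt_div hl.le]
  field_simp

theorem sin_nat_mul_pi_div_two_sub (m : ℕ) (σ : ℝ) :
    ((Real.sin (m * (Real.pi / 2 - σ)) : ℝ) : ℂ)
      = (Complex.I ^ m * Complex.exp (σ * Complex.I) ^ (-(m : ℤ))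
        - Complex.I ^ (-(m : ℤ)) * Complex.exp (σ * Complex.I) ^ (m : ℤ)) / (2 * Complex.I) := by
  have h : Complex.exp (((Real.pi / 2 - σ : ℝ) : ℂ) * Complex.I)
      = Complex.I * (Complex.exp (σ * Complex.I))⁻¹ := by
    rw [← Complex.exp_neg]
    have h0 := Complex.exp_pi_div_two_mul_I
    calc Complex.exp (((Real.pi / 2 - σ : ℝ) : ℂ) * Complex.I)
        = Complex.exp (Real.pi / 2 * Complex.I) * Complex.exp (-(σ * Complex.I)) := by
          rw [← Complex.exp_add]; congr 1; push_cast; ring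
      _ = _ := by rw [h0]
  have h1 : Complex.exp (((m * (Real.pi / 2 - σ) : ℝ) : ℂ) * Complex.I)
      = Complex.I ^ m * Complex.exp (σ * Complex.I) ^ (-(m : ℤ)) := by
    rw [zpow_neg, zpow_natCast, ← inv_pow, ← mul_pow, ← h, ← Complex.exp_nat_mul]
    congr 1; push_cast; ring
  have h2 : Complex.exp (-(((m * (Real.pi / 2 - σ) : ℝ) : ℂ)) * Complex.I)
      = Complex.I ^ (-(m : ℤ)) * Complex.exp (σ * Complex.I) ^ (m : ℤ) := by
    rw [neg_mul, Complex.exp_neg, h1, mul_inv, zpow_neg, zpow_neg, inv_inv, zpow_natCast, zpow_natCast]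
  rw [Complex.ofReal_sin, Complex.sin, h1, h2]
  have := Complex.I_sq
  field_simp
  linear_combination (-(Complex.I ^ m * Complex.exp (σ * Complex.I) ^ (-(m : ℤ))
        - Complex.I ^ (-(m : ℤ)) * Complex.exp (σ * Complex.I) ^ (m : ℤ))) * this

theorem chordFun_weight_mul_ridgeM (hR : 0 < R) (hκ : R ^ 2 * |κ| < 1) (n : ℤ) (θ : ℝ) {p : S1 × ℝ}
    {y : ℝ} (hy : y ∈ Icc (-Real.cos (scat κ R p.2)) (Real.cos (scat κ R p.2))) :
    chordFun κ R (fun z => weight κ z * ridgeM κ R n θ z) p y = chordConst κ R p.2 *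
      (ridge n θ (chordPt (AddCircle.toCircle p.1 * angExp (lamC κ R) p.2) (scat κ R p.2) y) : ℂ) := by
  have hη : ‖(AddCircle.toCircle p.1 : ℂ) * angExp (lamC κ R) p.2‖ = 1 := by
    rw [norm_mul, norm_toCircle, norm_angExp (lamC_pos hκ), one_mul]
  have hζ := norm_chordPt_le hη (abs_le.2 hy)
  have hw := ofReal_weight_ne_zero hκ (norm_PhiInv_le hR hκ hζ)
  rw [chordFun, ridgeM, geoPt, Phi_PhiInv hR hκ hζ]
  field_simp

/-- The w² in the integrand cancels against arc length, so this is a Chebyshev chord integral: a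
multiple of sin((n+1)(π/2 - 𝔰)) U_n(cos(β + 𝔰 - θ - π/2)). U_n expands into the frequencies a = n -
2k in e^{iβ}E, the sine into E^{±(n+1)}; the two terms for each a form one invariant mode with m = n
+ 1. The factor √p comes from `chordConst_eq`. -/
theorem xray_weight_mul_ridgeM (hR : 0 < R) (hκ : R ^ 2 * |κ| < 1) (n : ℕ) (θ : ℝ) {p : S1 × ℝ}
    (hp : |p.2| < Real.pi / 2) :
    xray κ R (fun z => weight κ z * ridgeM κ R n θ z) p
      = ∑ k ∈ Finset.range (n + 1), (ridgeAmp κ R n * Complex.I ^ (-(n : ℤ)) *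
        ridgePhase θ ^ ((n : ℤ) - 2 * k)) * plusMode κ R ((n : ℤ) - 2 * k) (n + 1) p := by
  have hl := lamC_pos hκ
  obtain ⟨q, a⟩ := p
  obtain ⟨b, rfl⟩ := QuotientAddGroup.mk_surjective q
  change |a| < Real.pi / 2 at hp
  have hb : (AddCircle.toCircle (QuotientAddGroup.mk b : S1) : ℂ) = Complex.exp (b * Complex.I) :=
    toCircle_coe b
  set E := angExp (lamC κ R) a with hE
  set t := Complex.exp (b * Complex.I) with ht
  have hEx : E = Complex.exp (scat κ R a * Complex.I) := (exp_scat hκ hp).symm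
  have hE0 : E ≠ 0 := angExp_ne_zero hl a
  have ht0 : t ≠ 0 := Complex.exp_ne_zero _
  have h1 : t * E * Complex.exp (-(θ * Complex.I))
      = Complex.exp ((b + scat κ R a - θ : ℝ) * Complex.I) := by
    rw [hEx, ht, ← Complex.exp_add, ← Complex.exp_add]; congr 1; push_cast; ring
  have h2 : Complex.exp (((b + scat κ R a - θ - Real.pi / 2 : ℝ) : ℂ) * Complex.I)
      = t * E * ridgePhase θ := by
    rw [ridgePhase, hEx, ht, ← Complex.exp_add, ← Complex.exp_add]; congr 1; push_cast; ring
  have h0 : -Real.cos (scat κ R a) ≤ Real.cos (scat κ R a) := by linarith [cos_scat_pos κ R a]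
  rw [xray, setIntegral_congr_fun measurableSet_Icc
    (fun y hy => chordFun_weight_mul_ridgeM hR hκ n θ hy), integral_const_mul,
    integral_Icc_eq_integral_Ioc]
  simp only [hb]
  rw [← intervalIntegral.integral_of_le h0, integral_ridge_chordPt h1, Complex.ofReal_mul,
    ← Real.cos_neg, neg_sub, chebyshev_U_cos_eq_sum, h2, chordConst_eq hκ, Finset.mul_sum,
    Finset.mul_sum]
  refine Finset.sum_congr rfl fun k _ => ?_
  have h3 := sin_nat_mul_pi_div_two_sub (n + 1) (scat κ R a)
  rw [← hEx] at h3
  -- All the modes in the sum have the same sign, so it matches the single relative sign in the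
  -- expansion of the sine.
  have hsgn : (-1 : ℂ) ^ ((n : ℤ) - 2 * k) = (-1) ^ n := by
    rw [zpow_sub₀ (by norm_num), zpow_mul]
    simp
  rw [plusMode, bdryMode, bdryMode, hsgn, hb, zpow_add₀ hE0, zpow_sub₀ hE0 _ ((n : ℤ) + 1), mul_zpow, mul_zpow]
  generalize ridgePhase θ ^ ((n : ℤ) - 2 * k) = Z
  generalize t ^ ((n : ℤ) - 2 * k) = X
  generalize E ^ ((n : ℤ) - 2 * k) = Y
  rw [ridgeAmp]
  generalize R / ((1 - κ * R ^ 2) * Real.sqrt (lamC κ R)) = A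
  push_cast at h3 ⊢
  rw [h3]
  have hEm : E ^ ((n : ℤ) + 1) ≠ 0 := zpow_ne_zero _ hE0
  rw [zpow_neg, zpow_neg, zpow_neg]
  generalize E ^ ((n : ℤ) + 1) = W at hEm ⊢
  have hI := Complex.I_ne_zero
  have hz : Complex.I ^ ((n : ℤ) + 1) = Complex.I ^ n * Complex.I := by
    rw [zpow_add₀ hI, zpow_natCast, zpow_one]
  have hn1 : (-1 : ℂ) ^ n = Complex.I ^ n * Complex.I ^ n := by
    rw [← mul_pow, Complex.I_mul_I]
  rw [hz, zpow_natCast, hn1, pow_succ Complex.I n]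
  have hIn : Complex.I ^ n ≠ 0 := pow_ne_zero _ hI
  obtain ⟨J, hJ⟩ : ∃ J, J = Complex.I ^ n := ⟨_, rfl⟩
  simp only [← hJ] at hIn ⊢
  have hn : (n : ℂ) + 1 ≠ 0 := by exact_mod_cast n.succ_ne_zero
  field_simp
  have := Complex.I_sq
  linear_combination (-(A * Real.sqrt (angDeriv (lamC κ R) a) * W ^ 2 * X * Y * Z)) * this

end Ridges
end XrayDisk

/-! ### The normal operator on ridges, and the inversion formula. -/

namespace XrayDisk
noncomputable section Normal

variable {κ R : ℝ}

/-- Multiplication by the weight, as a bounded operator. -/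
theorem exists_weight_clm (hκ : R ^ 2 * |κ| < 1) :
    ∃ W : L2M κ R →L[ℂ] L2M κ R, ∀ f : L2M κ R, W f =ᵐ[wdVol κ R] fun z => weight κ z * f z := by
  obtain ⟨C, hC0, hC⟩ := exists_weight_le hκ
  have hw : Measurable fun z => (weight κ z : ℂ) :=
    Complex.measurable_ofReal.comp (measurable_weight κ)
  refine exists_clm_of_bound (fun f z => weight κ z * f z) (Real.toNNReal C) ?_ ?_ ?_
    (fun f hf => (hw.mul hf).aestronglyMeasurable) ?_
  · intro f g _ _ hfg
    filter_upwards [hfg] with z hz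
    rw [hz]
  · intro f g _ _ _ _
    filter_upwards with z
    simp only [Pi.add_apply]
    ring
  · intro c f
    funext z
    simp only [Pi.smul_apply, smul_eq_mul]
    ring
  · intro f _ _
    have h := eLpNorm_le_mul_eLpNorm_of_ae_le_mul (p := 2) (μ := wdVol κ R)
      (f := fun z => weight κ z * f z) (g := f) (c := C) (by
        filter_upwards [ae_norm_le_wdVol κ R] with z hz
        rw [norm_mul, Complex.norm_real, Real.norm_of_nonneg (weight_pos hκ hz).le]
        gcongr
        exact hC z hz)
    exact h

theorem exists_div_weight (hR : 0 < R) (hκ : R ^ 2 * |κ| < 1) (f : L2M κ R) :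
    ∃ u : L2M κ R, u =ᵐ[wdVol κ R] fun z => f z / weight κ z := by
  obtain ⟨B, hB0, hB⟩ := exists_weight_ge hR hκ
  have hm : MemLp (fun z => f z / weight κ z) 2 (wdVol κ R) := by
    refine MemLp.of_le_mul (c := B⁻¹) (Lp.memLp f) ((Lp.stronglyMeasurable f).measurable.div
      (Complex.measurable_ofReal.comp (measurable_weight κ))).aestronglyMeasurable ?_
    filter_upwards [ae_norm_le_wdVol κ R] with z hz
    rw [norm_div, Complex.norm_real, Real.norm_of_nonneg (weight_pos hκ hz).le, div_eq_inv_mul]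
    have := hB z hz
    gcongr
  exact ⟨hm.toLp, hm.coeFn_toLp⟩

theorem plusLp_coeFn (hκ : R ^ 2 * |κ| < 1) (a m : ℤ) :
    (plusLp hκ a m : Lp ℂ 2 (dSigma κ R)) =ᵐ[dSigma κ R] plusMode κ R a m :=
  (memLp_plusMode hκ a m).coeFn_toLp

/-- The X-ray transform of a weighted ridge function. -/
theorem xray_ridgeLp (hR : 0 < R) (hκ : R ^ 2 * |κ| < 1) {J : L2M κ R →L[ℂ] L2plus κ R}
    (hJ : ∀ u : L2M κ R, ∀ g : ℂ → ℂ, Measurable g → u =ᵐ[wdVol κ R] g →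
      (J u : Lp ℂ 2 (dSigma κ R)) =ᵐ[dSigma κ R] xray κ R fun z => weight κ z * g z)
    (n : ℕ) (θ : ℝ) :
    J (ridgeLp hκ n θ) = ∑ k ∈ Finset.range (n + 1), (ridgeAmp κ R n * Complex.I ^ (-(n : ℤ)) *
        ridgePhase θ ^ ((n : ℤ) - 2 * k)) • plusLp hκ ((n : ℤ) - 2 * k) (n + 1) := by
  refine Subtype.ext (Lp.ext ?_)
  have h1 := hJ _ _ (measurable_ridgeM κ R n θ) (coeFn_ridgeLp hκ n θ)
  rw [Submodule.coe_sum]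
  have h2 : ∀ᵐ p ∂(dSigma κ R), ∀ k : ℕ, (((ridgeAmp κ R n * Complex.I ^ (-(n : ℤ)) *
        ridgePhase θ ^ ((n : ℤ) - 2 * k)) • plusLp hκ ((n : ℤ) - 2 * k) (n + 1) : L2plus κ R) :
        Lp ℂ 2 (dSigma κ R)) p = (ridgeAmp κ R n * Complex.I ^ (-(n : ℤ)) *
        ridgePhase θ ^ ((n : ℤ) - 2 * k)) * plusMode κ R ((n : ℤ) - 2 * k) (n + 1) p := by
    refine ae_all_iff.2 fun k => ?_
    filter_upwards [plusLp_coeFn (R := R) hκ ((n : ℤ) - 2 * k) (n + 1), Lp.coeFn_smul (ridgeAmp κ R n *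
      Complex.I ^ (-(n : ℤ)) * ridgePhase θ ^ ((n : ℤ) - 2 * k))
      (plusLp hκ ((n : ℤ) - 2 * k) (n + 1) : Lp ℂ 2 (dSigma κ R))] with p h3 h4
    rw [Submodule.coe_smul, h4, Pi.smul_apply, h3, smul_eq_mul]
  filter_upwards [h1, h2, ae_abs_lt_dSigma κ R, Lp.coeFn_finsetSum (Finset.range (n + 1)) fun k : ℕ =>
    (((ridgeAmp κ R n * Complex.I ^ (-(n : ℤ)) *
        ridgePhase θ ^ ((n : ℤ) - 2 * k)) • plusLp hκ ((n : ℤ) - 2 * k) (n + 1) : L2plus κ R) :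
        Lp ℂ 2 (dSigma κ R))] with p h1 h2 h3 h4
  rw [h1, xray_weight_mul_ridgeM hR hκ n θ h3, h4, Finset.sum_apply]
  exact Finset.sum_congr rfl fun k _ => (h2 k).symm

theorem odd_sub_add (n k : ℕ) : Odd ((n : ℤ) - 2 * k + (n + 1)) := ⟨n - k, by ring⟩

theorem inner_sum_smul_of_orthogonal {H ι : Type*} [NormedAddCommGroup H] [InnerProductSpace ℂ H]
    [DecidableEq ι] {s : Finset ι} {x : ι → H} {N : ℂ}
    (hx : ∀ i ∈ s, ∀ j ∈ s, ⟪x i, x j⟫_ℂ = if i = j then N else 0) (c d : ι → ℂ) :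
    ⟪∑ k ∈ s, c k • x k, ∑ k ∈ s, d k • x k⟫_ℂ = N * ∑ k ∈ s, conj (c k) * d k := by
  rw [sum_inner, Finset.mul_sum]
  refine Finset.sum_congr rfl fun k hk => ?_
  rw [inner_sum, Finset.sum_eq_single_of_mem k hk]
  · rw [inner_smul_left, inner_smul_right, hx k hk k hk, if_pos rfl]
    ring
  · intro j hj hjk
    rw [inner_smul_left, inner_smul_right, hx k hk j hj, if_neg (Ne.symm hjk)]
    ring

theorem inner_sum_plusLp (hR : 0 < R) (hκ : R ^ 2 * |κ| < 1) (n : ℕ) (c d : ℕ → ℂ) :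
    ⟪∑ k ∈ Finset.range (n + 1), c k • plusLp hκ ((n : ℤ) - 2 * k) (n + 1),
      ∑ k ∈ Finset.range (n + 1), d k • plusLp hκ ((n : ℤ) - 2 * k) (n + 1)⟫_ℂ
      = ((R / (1 + κ * R ^ 2) * (4 * Real.pi ^ 2) : ℝ) : ℂ) *
        ∑ k ∈ Finset.range (n + 1), conj (c k) * d k := by
  refine inner_sum_smul_of_orthogonal (fun k _ j _ => ?_) c d
  rw [inner_plusLp_plusLp hR hκ _ _ (by omega) (odd_sub_add n k) (odd_sub_add n j)]
  congr 1
  exact propext (by omega)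

theorem conj_ridgePhase_mul (θ θ' : ℝ) :
    conj (ridgePhase θ) * ridgePhase θ' = Complex.exp ((θ - θ' : ℝ) * Complex.I) := by
  rw [ridgePhase, ridgePhase, ← Complex.exp_conj, ← Complex.exp_add, map_neg, map_mul,
    Complex.conj_ofReal, Complex.conj_I]
  congr 1
  push_cast
  ring

/-- Orthogonality of the modes reduces the left side to a multiple of Σ e^{i(n-2k)(θ-θ')} =
U_n(cos(θ-θ')), the same function of the two directions as for the ridges themselves. Comparison of
the constants is where c_{κ,R} comes from. -/
theorem inner_xray_ridgeLp (hR : 0 < R) (hκ : R ^ 2 * |κ| < 1) {J : L2M κ R →L[ℂ] L2plus κ R}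
    (hJ : ∀ u : L2M κ R, ∀ g : ℂ → ℂ, Measurable g → u =ᵐ[wdVol κ R] g →
      (J u : Lp ℂ 2 (dSigma κ R)) =ᵐ[dSigma κ R] xray κ R fun z => weight κ z * g z)
    (n : ℕ) (θ θ' : ℝ) :
    ⟪J (ridgeLp hκ n θ), J (ridgeLp hκ n θ')⟫_ℂ
      = ((cConst κ R / (n + 1) : ℝ) : ℂ) * ⟪ridgeLp hκ n θ, ridgeLp hκ n θ'⟫_ℂ := by
  rw [xray_ridgeLp hR hκ hJ, xray_ridgeLp hR hκ hJ, inner_sum_plusLp hR hκ, inner_ridgeLp_ridgeLp hR hκ]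
  have hI : conj (Complex.I ^ (-(n : ℤ))) * Complex.I ^ (-(n : ℤ)) = 1 := by
    rw [map_zpow₀, ← mul_zpow]
    simp
  have e : ∀ k : ℕ, conj (ridgeAmp κ R n * Complex.I ^ (-(n : ℤ)) * ridgePhase θ ^ ((n : ℤ) - 2 * k)) *
      (ridgeAmp κ R n * Complex.I ^ (-(n : ℤ)) * ridgePhase θ' ^ ((n : ℤ) - 2 * k))
      = (ridgeAmp κ R n : ℂ) ^ 2 * Complex.exp ((θ - θ' : ℝ) * Complex.I) ^ ((n : ℤ) - 2 * k) := by
    intro k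
    rw [← conj_ridgePhase_mul, mul_zpow, map_mul, map_mul, Complex.conj_ofReal, map_zpow₀ _ (ridgePhase θ)]
    linear_combination ((ridgeAmp κ R n : ℂ) ^ 2 * (conj (ridgePhase θ) ^ ((n : ℤ) - 2 * k) *
      ridgePhase θ' ^ ((n : ℤ) - 2 * k))) * hI
  simp only [e]
  rw [← Finset.mul_sum, ← chebyshev_U_cos_eq_sum, ← Complex.ofReal_pow, ← Complex.ofReal_mul,
    ← Complex.ofReal_mul, ← Complex.ofReal_mul]
  congr 1
  have hl := lamC_pos hκ
  have h1 := (one_sub_pos hκ).ne'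
  have h2 := (one_add_pos hκ).ne'
  have key : R / (1 + κ * R ^ 2) * (4 * Real.pi ^ 2) * ridgeAmp κ R n ^ 2
      = cConst κ R / (n + 1) * (jacConst κ R * (Real.pi / (n + 1))) := by
    rw [ridgeAmp, div_pow, div_pow, mul_pow, Real.sq_sqrt hl.le, lamC, cConst, jacConst]
    generalize 1 - κ * R ^ 2 = a at h1
    generalize 1 + κ * R ^ 2 = b at h2
    field_simp
  rw [← mul_assoc, key, mul_assoc]

theorem ridge_eigenvalue_rpow (n : ℕ) : (((((n : ℤ) : ℝ) + 1) ^ 2 : ℝ)) ^ (-(1 / 2) : ℝ) = 1 / (n + 1) := by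
  have h : (0 : ℝ) ≤ ((n : ℤ) : ℝ) + 1 := by positivity
  rw [← Real.rpow_natCast, ← Real.rpow_mul h]
  norm_num
  rw [Real.rpow_neg_one]

theorem xray_ridgeLp_mem_eigenspace (hR : 0 < R) (hκ : R ^ 2 * |κ| < 1)
    {J : L2M κ R →L[ℂ] L2plus κ R}
    (hJ : ∀ u : L2M κ R, ∀ g : ℂ → ℂ, Measurable g → u =ᵐ[wdVol κ R] g →
      (J u : Lp ℂ 2 (dSigma κ R)) =ᵐ[dSigma κ R] xray κ R fun z => weight κ z * g z)
    (n : ℕ) (θ : ℝ) :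
    J (ridgeLp hκ n θ) ∈ eigenspace (opNegTsq κ R) ((((n : ℤ) : ℝ) + 1) ^ 2) := by
  rw [xray_ridgeLp hR hκ hJ]
  refine Submodule.sum_mem _ fun k _ => Submodule.smul_mem _ _ ?_
  have h := plusLp_mem_eigenspace hκ hR (odd_sub_add n k)
  push_cast at h ⊢
  exact h

/-- Tested against all ridges: for equal degrees it is `inner_xray_ridgeLp`, and for different
degrees both inner products vanish, being between eigenvectors of self-adjoint operators for
different eigenvalues. -/
theorem adjoint_xray_ridgeLp (hR : 0 < R) (hκ : R ^ 2 * |κ| < 1) {J : L2M κ R →L[ℂ] L2plus κ R}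
    (hJ : ∀ u : L2M κ R, ∀ g : ℂ → ℂ, Measurable g → u =ᵐ[wdVol κ R] g →
      (J u : Lp ℂ 2 (dSigma κ R)) =ᵐ[dSigma κ R] xray κ R fun z => weight κ z * g z)
    (n : ℕ) (θ : ℝ) :
    ContinuousLinearMap.adjoint J (J (ridgeLp hκ n θ))
      = ((cConst κ R * ((((n : ℤ) : ℝ) + 1) ^ 2) ^ (-(1 / 2) : ℝ) : ℝ) : ℂ) • ridgeLp hκ n θ := by
  rw [ridge_eigenvalue_rpow, mul_one_div]
  refine (innerSL_inj (𝕜 := ℂ)).1 ?_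
  refine clm_eq_of_total (ridgeLp_total hR hκ) fun i => ?_
  rw [innerSL_apply_apply, innerSL_apply_apply, ContinuousLinearMap.adjoint_inner_left, inner_smul_left,
    Complex.conj_ofReal]
  obtain ⟨j, φ⟩ := i
  by_cases hnj : n = j
  · subst hnj
    exact inner_xray_ridgeLp hR hκ hJ n θ φ
  · have hne : ((((n : ℤ) : ℝ) + 1) ^ 2) ≠ ((((j : ℤ) : ℝ) + 1) ^ 2) := by
      intro h
      have h' := (sq_eq_sq₀ (by positivity) (by positivity)).1 h
      exact hnj (by exact_mod_cast add_right_cancel h')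
    rw [(isPositivePurePoint_opNegTsq hR hκ).inner_eq_zero hne
        (xray_ridgeLp_mem_eigenspace hR hκ hJ n θ) (xray_ridgeLp_mem_eigenspace hR hκ hJ j φ),
      (isPositivePurePoint_opL hR hκ).inner_eq_zero hne
        (ridgeLp_mem_eigenspace hR hκ n θ) (ridgeLp_mem_eigenspace hR hκ j φ), mul_zero]

theorem integral_wdVol (hκ : R ^ 2 * |κ| < 1) (F : ℂ → ℂ) :
    ∫ z, F z ∂(wdVol κ R) = ∫ z, weight κ z * F z ∂(dVol κ R) := by
  rw [wdVol, integral_withDensity_eq_integral_toReal_smul (measurable_weight κ).ennreal_ofReal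
    (by simp)]
  refine integral_congr_ae ?_
  filter_upwards [ae_norm_le_dVol κ R] with z hz
  rw [ENNReal.toReal_ofReal (weight_pos hκ hz).le, Complex.real_smul]

theorem ae_eq_weight_div_mul_smul (hκ : R ^ 2 * |κ| < 1) {f u : L2M κ R}
    (hu : u =ᵐ[wdVol κ R] fun z => f z / weight κ z) {c : ℝ} (hc : c ≠ 0) :
    f =ᵐ[wdVol κ R] fun z => ((weight κ z / c : ℝ) : ℂ) * ((c : ℂ) • u : L2M κ R) z := by
  filter_upwards [Lp.coeFn_smul (c : ℂ) u, hu, ae_norm_le_wdVol κ R] with z h2 h3 h4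
  have hw := ofReal_weight_ne_zero hκ h4
  have hc' : (c : ℂ) ≠ 0 := by exact_mod_cast hc
  rw [h2, Pi.smul_apply, h3, smul_eq_mul, Complex.ofReal_div]
  generalize (f : ℂ → ℂ) z = y
  field_simp

/-- The division by w in u cancels the density of w dVol. So the adjoint of u ↦ I₀(w u) for w dVol
is the adjoint of I₀ for dVol. -/
theorem integral_conj_mul_dVol (hκ : R ^ 2 * |κ| < 1) {f u : L2M κ R}
    (hu : u =ᵐ[wdVol κ R] fun z => f z / weight κ z) (v : L2M κ R) :
    ∫ z, conj (f z) * v z ∂(dVol κ R) = ⟪u, v⟫_ℂ := by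
  rw [inner_Lp_eq hu (ae_eq_refl _), integral_wdVol hκ]
  refine integral_congr_ae ?_
  filter_upwards [ae_norm_le_dVol κ R] with z hz
  have hw := ofReal_weight_ne_zero hκ hz
  generalize (f : ℂ → ℂ) z = x
  generalize (v : ℂ → ℂ) z = y
  rw [map_div₀, Complex.conj_ofReal (weight κ z)]
  field_simp

theorem power_formula_xray (hR : 0 < R) (hκ : R ^ 2 * |κ| < 1) {J : L2M κ R →L[ℂ] L2plus κ R}
    (hJ : ∀ u : L2M κ R, ∀ g : ℂ → ℂ, Measurable g → u =ᵐ[wdVol κ R] g →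
      (J u : Lp ℂ 2 (dSigma κ R)) =ᵐ[dSigma κ R] xray κ R fun z => weight κ z * g z)
    (α : ℝ) (u : L2M κ R) :
    (∃ V : ℝ → L2M κ R,
      powExpansion α (coeffs (opNegTsq κ R) (J u)) ∈ HilbertScale (opNegTsq κ R) (1 / 2 - 2 * α) ∧
      IsImageOfExpansion (opL κ R) (ContinuousLinearMap.adjoint J)
        (powExpansion α (coeffs (opNegTsq κ R) (J u))) V ∧
      V ∈ HilbertScale (opL κ R) (1 - 2 * α) ∧
      coeffs (opL κ R) ((cConst κ R : ℂ) • u) = powExpansion (1 / 2 - α) V) ∧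
    (∀ v : L2plus κ R, IsPow (opNegTsq κ R) α (J u) v →
      IsPow (opL κ R) (1 / 2 - α) (ContinuousLinearMap.adjoint J v) ((cConst κ R : ℂ) • u)) ∧
    (α ≤ 1 / 4 → ∃ v : L2plus κ R, IsPow (opNegTsq κ R) α (J u) v) := by
  have h1 : ∀ i : ℕ × ℝ, (1 : ℝ) ≤ (((i.1 : ℤ) : ℝ) + 1) ^ 2 := fun i => one_le_pow₀ (by simp)
  have h2 : ∀ i : ℕ × ℝ, ridgeLp hκ i.1 i.2 ∈ eigenspace (opL κ R) ((((i.1 : ℤ) : ℝ) + 1) ^ 2) :=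
    fun i => ridgeLp_mem_eigenspace hR hκ i.1 i.2
  have h3 : ∀ i : ℕ × ℝ, J (ridgeLp hκ i.1 i.2) ∈
      eigenspace (opNegTsq κ R) ((((i.1 : ℤ) : ℝ) + 1) ^ 2) :=
    fun i => xray_ridgeLp_mem_eigenspace hR hκ hJ i.1 i.2
  have h4 : ∀ i : ℕ × ℝ, ContinuousLinearMap.adjoint J (J (ridgeLp hκ i.1 i.2))
      = ((cConst κ R * ((((i.1 : ℤ) : ℝ) + 1) ^ 2) ^ (-(1 / 2) : ℝ) : ℝ) : ℂ) •
        ridgeLp hκ i.1 i.2 := fun i => adjoint_xray_ridgeLp hR hκ hJ i.1 i.2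
  have h := IsPositivePurePoint.power_formula (isPositivePurePoint_opL hR hκ)
    (isPositivePurePoint_opNegTsq hR hκ) (ridgeLp_total hR hκ) h1 h2 J h3 h4 α u
  exact h

/-- The inversion formula for `f = w u`, in terms of `y = J u`. -/
theorem inversion_formula (hR : 0 < R) (hκ : R ^ 2 * |κ| < 1) {J : L2M κ R →L[ℂ] L2plus κ R}
    (hJ : ∀ u : L2M κ R, ∀ g : ℂ → ℂ, Measurable g → u =ᵐ[wdVol κ R] g →
      (J u : Lp ℂ 2 (dSigma κ R)) =ᵐ[dSigma κ R] xray κ R fun z => weight κ z * g z)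
    {f u : L2M κ R} (hu : u =ᵐ[wdVol κ R] fun z => f z / weight κ z) {y : L2plus κ R}
    (hy : y = J u) (α : ℝ) :
    (∃ (V : ℝ → L2M κ R) (g : L2M κ R),
      powExpansion α (coeffs (opNegTsq κ R) y) ∈ HilbertScale (opNegTsq κ R) (1 / 2 - 2 * α) ∧
      IsImageOfExpansion (opL κ R) (ContinuousLinearMap.adjoint J)
        (powExpansion α (coeffs (opNegTsq κ R) y)) V ∧
      V ∈ HilbertScale (opL κ R) (1 - 2 * α) ∧
      coeffs (opL κ R) g = powExpansion (1 / 2 - α) V ∧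
      f =ᵐ[wdVol κ R] fun z => ((weight κ z / cConst κ R : ℝ) : ℂ) * g z) ∧
    (∀ v : L2plus κ R, IsPow (opNegTsq κ R) α y v → ∃ g : L2M κ R,
      IsPow (opL κ R) (1 / 2 - α) (ContinuousLinearMap.adjoint J v) g ∧
      f =ᵐ[wdVol κ R] fun z => ((weight κ z / cConst κ R : ℝ) : ℂ) * g z) ∧
    (α ≤ 1 / 4 → ∃ v : L2plus κ R, IsPow (opNegTsq κ R) α y v) := by
  have hc : cConst κ R ≠ 0 :=
    (div_pos (by have := Real.pi_pos; positivity) (one_sub_pos hκ)).ne'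
  have hf := ae_eq_weight_div_mul_smul hκ hu hc
  subst hy
  obtain ⟨⟨V, hV1, hV2, hV3, hV4⟩, h5, h6⟩ := power_formula_xray hR hκ hJ α u
  exact ⟨⟨V, _, hV1, hV2, hV3, hV4, hf⟩, fun v hv => ⟨_, h5 v hv, hf⟩, h6⟩

end Normal
end XrayDisk

theorem theorem2p3 (κ R : ℝ) (hR : 0 < R) (hκ : R ^ 2 * |κ| < 1) :
    XrayDisk.IsPositivePurePoint (XrayDisk.opL κ R) ∧
    XrayDisk.IsPositivePurePoint (XrayDisk.opNegTsq κ R) ∧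
    ∃ (I₀ : XrayDisk.L2M κ R →L[ℂ] XrayDisk.L2plus κ R)
      (I₀star : XrayDisk.L2plus κ R →L[ℂ] XrayDisk.L2M κ R),
      XrayDisk.IsXrayTransform κ R I₀ ∧
      XrayDisk.IsXrayAdjoint κ R I₀ I₀star ∧
      ∀ (α : ℝ) (f : XrayDisk.L2M κ R),
        -- the formula, all operators acting on the Hilbert scales of `-T²` and `𝓛`
        (∃ (V : ℝ → XrayDisk.L2M κ R) (g : XrayDisk.L2M κ R),
          XrayDisk.powExpansion α (XrayDisk.coeffs (XrayDisk.opNegTsq κ R) (I₀ f)) ∈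
            XrayDisk.HilbertScale (XrayDisk.opNegTsq κ R) (1 / 2 - 2 * α) ∧
          XrayDisk.IsImageOfExpansion (XrayDisk.opL κ R) I₀star
            (XrayDisk.powExpansion α (XrayDisk.coeffs (XrayDisk.opNegTsq κ R) (I₀ f))) V ∧
          V ∈ XrayDisk.HilbertScale (XrayDisk.opL κ R) (1 - 2 * α) ∧
          XrayDisk.coeffs (XrayDisk.opL κ R) g = XrayDisk.powExpansion (1 / 2 - α) V ∧
          f =ᵐ[XrayDisk.wdVol κ R] fun z =>
            ((XrayDisk.weight κ z / XrayDisk.cConst κ R : ℝ) : ℂ) * g z) ∧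
        -- the formula, all operators being unbounded operators on the `L²` spaces
        (∀ u : XrayDisk.L2plus κ R, XrayDisk.IsPow (XrayDisk.opNegTsq κ R) α (I₀ f) u →
          ∃ g : XrayDisk.L2M κ R,
            XrayDisk.IsPow (XrayDisk.opL κ R) (1 / 2 - α) (I₀star u) g ∧
            f =ᵐ[XrayDisk.wdVol κ R] fun z =>
              ((XrayDisk.weight κ z / XrayDisk.cConst κ R : ℝ) : ℂ) * g z) ∧
        (α ≤ 1 / 4 → ∃ u : XrayDisk.L2plus κ R,
          XrayDisk.IsPow (XrayDisk.opNegTsq κ R) α (I₀ f) u)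
        := by
  open XrayDisk in
  obtain ⟨I, hI, hIx⟩ := exists_xrayTransform hR hκ
  obtain ⟨W, hW⟩ := exists_weight_clm (R := R) hκ
  -- J u = I₀(w u); its Hilbert space adjoint serves as I₀*. Since w is bounded below, every f is w
  -- u for some u in the space, and then I₀ f = J u.
  obtain ⟨J, hJdef⟩ : ∃ J, J = I.comp W := ⟨_, rfl⟩
  have hJ : ∀ u : L2M κ R, ∀ g : ℂ → ℂ, Measurable g → u =ᵐ[wdVol κ R] g →
      (J u : Lp ℂ 2 (dSigma κ R)) =ᵐ[dSigma κ R] xray κ R fun z => weight κ z * g z := by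
    intro u g hg hu
    subst hJdef
    refine hIx (W u) _ ((Complex.measurable_ofReal.comp (measurable_weight κ)).mul hg) ?_
    filter_upwards [hW u, hu] with z h1 h2
    rw [h1, h2]
  have hdiv : ∀ f : L2M κ R, ∃ u : L2M κ R, u =ᵐ[wdVol κ R] (fun z => f z / weight κ z) ∧
      W u = f := by
    intro f
    obtain ⟨u, hu⟩ := exists_div_weight hR hκ f
    refine ⟨u, hu, Lp.ext ?_⟩
    filter_upwards [hW u, hu, ae_norm_le_wdVol κ R] with z h1 h2 h3
    rw [h1, h2, mul_div_cancel₀ _ (ofReal_weight_ne_zero hκ h3)]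
  refine ⟨isPositivePurePoint_opL hR hκ, isPositivePurePoint_opNegTsq hR hκ, I,
    ContinuousLinearMap.adjoint J, hI, fun f g => ?_, fun α f => ?_⟩
  · obtain ⟨u, hu, hWu⟩ := hdiv f
    have h1 : I f = J u := by rw [hJdef, ContinuousLinearMap.comp_apply, hWu]
    rw [h1, ← ContinuousLinearMap.adjoint_inner_right]
    exact integral_conj_mul_dVol hκ hu _
  · obtain ⟨u, hu, hWu⟩ := hdiv f
    have h1 : I f = J u := by rw [hJdef, ContinuousLinearMap.comp_apply, hWu]
    exact inversion_formula hR hκ hJ hu h1 α
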